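/- Let $N_1,N_2,M$ be abelian groups with finite presentations: generators $a_1,\dots,a_n$ of $N_1$, $a'_1,\dots,a'_p$ of $N_2$, $b_1,\dots,b_m$ of $M$, and in each case a finite list of integer vectors generating the group of all relations. Let $f\colon N_1\times N_2\to M$ be a bilinear map given by structure constants $s_{ij\kappa}\in\mathbb Z$ with $f(a_i,a'_j)=\sum_\kappa s_{ij\kappa}b_\kappa$. Assume that $f$ is full (its values generate $M$) and non-degenerate ($f(x,\cdot)=0$ implies $x=0$, and $f(\cdot,y)=0$ implies $y=0$). A commutative ring $R$ is a ring of scalars of $f$ if $N_1,N_2,M$ are faithful $R$-modules with $f(rx,y)=f(x,ry)=r f(x,y)$; a maximal one, $\mathfrak S(f)$, is one into which every ring of scalars of $f$ embeds compatibly with the actions on $N_1,N_2,M$. A bilinear map is a direct product $f_1\times\dots\times f_k$ if $N_1=\bigoplus N_{1i}$, $N_2=\bigoplus N_{2i}$, $M=\bigoplus M_i$ with bilinear $f_i\colon N_{1i}\times N_{2i}\to M_i$ and $f(\sum x_i,\sum y_i)=\sum f_i(x_i,y_i)$; it is directly indecomposable if it is not a direct product of two or more non-trivial bilinear maps (trivial: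 all three groups are zero). A complete set of primitive idempotents of a ring is a finite family of primitive, pairwise orthogonal idempotents with sum $1$. The canonical decomposition of $f$ is the one into the maps $f_i\colon \varepsilon_iN_1\times\varepsilon_iN_2\to\varepsilon_iM$, $f_i(\varepsilon_ix,\varepsilon_iy)=\varepsilon_if(x,y)$, where $\{\varepsilon_1,\dots,\varepsilon_\ell\}$ is the complete set of primitive idempotents of $\mathfrak S(f)$. Consider the following procedure, in which a pair $(d,d')$ of integer matrices of sizes $n\times n$ and $p\times p$ represents the pair of maps $a_i\mapsto\sum_jd_{ij}a_j$, $a'_i\mapsto\sum_jd'_{ij}a'_j$, and every linear equation over $N_1$, $N_2$ or $M$ is expressed through the given relations. 1. Compute a $\mathbb Z$-basis $(\delta^{(\pi)},\delta'^{(\pi)})$ of the group of pairs $(x,x')$ that respect the relations of $N_1$ and $N_2$ and satisfy $\sum_i x_{ki}f(a_i,a'_l)=\sum_jx'_{lj}f(a_k,a'_j)$ for all $k,l$. Compute a $\mathbb Z$-basis $(z^{(k)})$ of the group of $n\times p$ integer matrices with $\sum_{i,j} z_{ij}f(a_i,a'_j)=0$. Compute a $\mathbb Z$-basis $(A_1,A'_1),\dots,(A_r,A'_r)$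 of the group of those pairs $(x,x')$ in the first group that satisfy also $\sum_{i,j}x_{ki}\delta'^{(\pi)}_{lj}f(a_i,a'_j)=\sum_{i,j}x'_{lj}\delta^{(\pi)}_{ki}f(a_i,a'_j)$ for all $k,l,\pi$ and $\sum_{i,l,j}x_{il}z^{(k)}_{ij}f(a_l,a'_j)=0$ for all $k$. Let $\varphi_k$ be the pair of endomorphisms represented by $(A_k,A'_k)$. 2. Compute a $\mathbb Z$-basis $(u_\lambda)$ of the group of relations $\sum_k x_k\varphi_k=0$, integers $v_k$ with $\sum_k v_k\varphi_k=1$, and integers $t_{ijk}$ with $\varphi_i\varphi_j=\sum_kt_{ijk}\varphi_k$. Let $J=\langle\sum_k v_ky_k-1,\ \sum_ku_{\lambda k}y_k,\ y_iy_j-\sum_kt_{ijk}y_k\rangle\subseteq P=\mathbb Z[y_1,\dots,y_r]$. 3. For a primary decomposition of $J$, group the primary components according to the connected components of $\operatorname{Spec}(P/J)$ that contain their radicals, let $J_1,\dots,J_\ell$ be the intersections of the groups, and compute polynomials $e_i\in\bigcap_{j\ne i}J_j$ with $1-e_i\in J_i$. 4. Compute $E_i=e_i(A_1,\dots,A_r)$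 and $E'_i=e_i(A'_1,\dots,A'_r)$ (the matrices in each term being multiplied in their natural order), and put $(n_{i1},\dots,n_{in})^{tr}=E_i(a_1,\dots,a_n)^{tr}$, $(n'_{i1},\dots,n'_{ip})^{tr}=E'_i(a'_1,\dots,a'_p)^{tr}$. 5. Return the restrictions $f_i\colon N_{1i}\times N_{2i}\to M_i$ of $f$, where $N_{1i}=\langle n_{ij}\rangle_j$, $N_{2i}=\langle n'_{ik}\rangle_k$ and $M_i=\langle f(n_{ij},n'_{ik})\rangle_{j,k}$, each given by the coordinates of the $n_{ij}$, $n'_{ik}$ and $f(n_{ij},n'_{ik})$ in the generators. Then this procedure is effective: there is one algorithm (a partial recursive function) that, on every input as above, halts and carries out the procedure, returning the data computed in it and its result. The maximal ring of scalars $\mathfrak S(f)$ exists. And the procedure is correct, whatever choices of bases, solutions and decompositions are made: there are $\varphi_1,\dots,\varphi_r\in\mathfrak S(f)$ that act on $N_1,N_2$ as the pairs represented by $(A_k,A'_k)$ and generate $\mathfrak S(f)$ additively; $y_k\mapsto\varphi_k$ induces an isomorphism $\mathbb Z[y_1,\dots,y_r]/J\cong\mathfrak S(f)$; the images of $e_1,\dots,e_\ell$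 form a complete set of primitive idempotents of $\mathfrak S(f)$; and $f=f_1\times\dots\times f_\ell$ is the canonical decomposition of $f$, whose factors $f_i$ are full, non-degenerate, non-trivial and directly indecomposable. -/

import Mathlib

universe u

namespace BilinDecomp

/-! ### Bilinear maps, rings of scalars, direct products -/

section Bilinear

variable {N₁ N₂ M : Type u} [AddCommGroup N₁] [AddCommGroup N₂] [AddCommGroup M]

/-- Both one-sided kernels of the bilinear map are zero. -/
def IsNondegenerate (f : N₁ →+ N₂ →+ M) : Prop :=
  (∀ x, (∀ y, f x y = 0) → x = 0) ∧ (∀ y, (∀ x, f x y = 0) → y = 0)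

/-- The values of the bilinear map generate the target group. -/
def IsFull (f : N₁ →+ N₂ →+ M) : Prop :=
  AddSubgroup.closure {z : M | ∃ x y, f x y = z} = ⊤

/-- The commutative ring `R`, acting on the three groups, is a ring of scalars of `f`. -/
def IsRingOfScalars (f : N₁ →+ N₂ →+ M) (R : Type u) [CommRing R]
    [Module R N₁] [Module R N₂] [Module R M] : Prop :=
  FaithfulSMul R N₁ ∧ FaithfulSMul R N₂ ∧ FaithfulSMul R M ∧
    ∀ (r : R) (x : N₁) (y : N₂), f (r • x) y = r • f x y ∧ f x (r • y) = r • f x y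

/-- A ring of scalars is maximal if every ring of scalars embeds into it, the embedding being
one of rings of scalars, that is, compatible with the actions. -/
def IsMaximalRingOfScalars (f : N₁ →+ N₂ →+ M) (S : Type u) [CommRing S]
    [Module S N₁] [Module S N₂] [Module S M] : Prop :=
  IsRingOfScalars f S ∧
    ∀ (R : Type u) [CommRing R] [Module R N₁] [Module R N₂] [Module R M],
      IsRingOfScalars f R →
        ∃ φ : R →+* S, Function.Injective φ ∧ (∀ (r : R) (x : N₁), φ r • x = r • x) ∧
          (∀ (r : R) (y : N₂), φ r • y = r • y) ∧ (∀ (r : R) (z : M), φ r • z = r • z)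

/-- `f` is the (internal) direct product of the bilinear maps `g i : A i × B i → C i`. -/
def IsDirectProduct (f : N₁ →+ N₂ →+ M) {k : ℕ} (A : Fin k → AddSubgroup N₁)
    (B : Fin k → AddSubgroup N₂) (C : Fin k → AddSubgroup M)
    (g : ∀ i, A i →+ B i →+ C i) : Prop :=
  DirectSum.IsInternal A ∧ DirectSum.IsInternal B ∧ DirectSum.IsInternal C ∧
    ∀ (x : ∀ i, A i) (y : ∀ i, B i),
      f (∑ i, (x i : N₁)) (∑ i, (y i : N₂)) = ∑ i, (g i (x i) (y i) : M)

/-- The trivial bilinear map is the one between zero groups. -/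
def IsTrivialMap (_f : N₁ →+ N₂ →+ M) : Prop :=
  Subsingleton N₁ ∧ Subsingleton N₂ ∧ Subsingleton M

/-- `f` is not a direct product of two or more non-trivial bilinear maps. -/
def IsDirectlyIndecomposable (f : N₁ →+ N₂ →+ M) : Prop :=
  ¬ ∃ (k : ℕ) (A : Fin k → AddSubgroup N₁) (B : Fin k → AddSubgroup N₂)
      (C : Fin k → AddSubgroup M) (g : ∀ i, A i →+ B i →+ C i),
      2 ≤ k ∧ IsDirectProduct f A B C g ∧ ∀ i, ¬ IsTrivialMap (g i)

end Bilinear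

/-- A primitive idempotent: non-zero, and not a sum of two non-zero orthogonal idempotents. -/
def IsPrimitiveIdempotent {S : Type*} [CommRing S] (e : S) : Prop :=
  IsIdempotentElem e ∧ e ≠ 0 ∧
    ∀ e' e'' : S, IsIdempotentElem e' → IsIdempotentElem e'' → e' * e'' = 0 → e = e' + e'' →
      e' = 0 ∨ e'' = 0

/-- A complete set of primitive idempotents: primitive, pairwise orthogonal, with sum `1`. -/
def IsCompletePrimitive {S : Type*} [CommRing S] {k : ℕ} (e : Fin k → S) : Prop :=
  CompleteOrthogonalIdempotents e ∧ ∀ i, IsPrimitiveIdempotent (e i)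

/-- The maps `F i : A i × B i → C i` are the canonical decomposition of `f`, cut out by
the complete set `ε` of primitive idempotents of the maximal ring of scalars `S`:
`A i = ε i N₁`, `B i = ε i N₂`, `C i = ε i M` and `F i (ε i x, ε i y) = ε i f (x, y)`. -/
def IsCanonicalDecomposition {N₁ N₂ M : Type u} [AddCommGroup N₁] [AddCommGroup N₂]
    [AddCommGroup M] (f : N₁ →+ N₂ →+ M) (S : Type u) [CommRing S]
    [Module S N₁] [Module S N₂] [Module S M] {k : ℕ} (ε : Fin k → S)
    (A : Fin k → AddSubgroup N₁) (B : Fin k → AddSubgroup N₂) (C : Fin k → AddSubgroup M)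
    (F : ∀ i, A i →+ B i →+ C i) : Prop :=
  IsCompletePrimitive ε ∧
  (∀ i, (A i : Set N₁) = Set.range fun x => ε i • x) ∧
  (∀ i, (B i : Set N₂) = Set.range fun y => ε i • y) ∧
  (∀ i, (C i : Set M) = Set.range fun z => ε i • z) ∧
  (∀ i (x : N₁) (y : N₂) (x' : A i) (y' : B i), (x' : N₁) = ε i • x → (y' : N₂) = ε i • y →
    (F i x' y' : M) = ε i • f x y) ∧
  IsDirectProduct f A B C F

/-! ### The input: presentations and structure constants -/

/-- Finitely many relation vectors on `n` generators. -/
structure Relations (n : ℕ) where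
  num : ℕ
  rel : Fin num → Fin n → ℤ

/-- The integer combination of generators with coefficients `c` is zero in the presented group. -/
def Relations.IsZero {n : ℕ} (P : Relations n) (c : Fin n → ℤ) : Prop :=
  c ∈ Submodule.span ℤ (Set.range P.rel)

/-- `N` is presented by the generators `a` and the relations `P`. -/
def Relations.Presents {n : ℕ} (P : Relations n) {N : Type*} [AddCommGroup N]
    (a : Fin n → N) : Prop :=
  (∀ x : N, ∃ c : Fin n → ℤ, x = ∑ i, c i • a i) ∧
    ∀ c : Fin n → ℤ, ∑ i, c i • a i = 0 ↔ P.IsZero c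

/-- Presentations of `N₁` (on `n` generators), `N₂` (on `p` generators), `M` (on `m` generators),
and structure constants. -/
structure Input where
  n : ℕ
  p : ℕ
  m : ℕ
  rel₁ : Relations n
  rel₂ : Relations p
  relM : Relations m
  s : Fin n → Fin p → Fin m → ℤ

/-- The input describes the bilinear map `f` on the generators `a`, `a'`, `b`. -/
def Input.Describes (I : Input) {N₁ N₂ M : Type*} [AddCommGroup N₁] [AddCommGroup N₂]
    [AddCommGroup M] (a : Fin I.n → N₁) (a' : Fin I.p → N₂) (b : Fin I.m → M)
    (f : N₁ →+ N₂ →+ M) : Prop :=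
  I.rel₁.Presents a ∧ I.rel₂.Presents a' ∧ I.relM.Presents b ∧
    ∀ i j, f (a i) (a' j) = ∑ k, I.s i j k • b k

/-- Pairs of square integer matrices; `(d, d')` stands for the pair of endomorphisms
`a i ↦ ∑ j, d i j • a j` and `a' i ↦ ∑ j, d' i j • a' j`. -/
abbrev Input.Tup (I : Input) : Type :=
  Matrix (Fin I.n) (Fin I.n) ℤ × Matrix (Fin I.p) (Fin I.p) ℤ

/-- `b` is a `ℤ`-basis of the set `X` (which in particular is a subgroup). -/
def IsZBasis {V : Type*} [AddCommGroup V] {k : ℕ} (b : Fin k → V) (X : Set V) : Prop :=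
  LinearIndependent ℤ b ∧ (Submodule.span ℤ (Set.range b) : Set V) = X

namespace Input

variable (I : Input)

/-! ### Step 1: the linear systems for the generators of the maximal ring of scalars -/

/-- Compatibility with the relations of `N₁` and `N₂`. -/
def endSystem : Set I.Tup :=
  {x | (∀ k, I.rel₁.IsZero fun j => ∑ i, x.1 i j * I.rel₁.rel k i) ∧
    ∀ k, I.rel₂.IsZero fun j => ∑ i, x.2 i j * I.rel₂.rel k i}

/-- Symmetry with respect to the bilinear map. -/
def symSystem : Set I.Tup :=
  {x | ∀ k l, I.relM.IsZero fun κ =>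
    (∑ i, x.1 k i * I.s i l κ) - ∑ j, x.2 l j * I.s k j κ}

/-- Commutation with the tuples `δ`. -/
def cenSystem {q : ℕ} (δ : Fin q → I.Tup) : Set I.Tup :=
  {x | ∀ π k l, I.relM.IsZero fun κ =>
    (∑ i, ∑ j, x.1 k i * (δ π).2 l j * I.s i j κ) -
      ∑ i, ∑ j, x.2 l j * (δ π).1 k i * I.s i j κ}

/-- Linear relations among the values of the bilinear map on generators. -/
def valueSystem : Set (Matrix (Fin I.n) (Fin I.p) ℤ) :=
  {x | I.relM.IsZero fun κ => ∑ i, ∑ j, x i j * I.s i j κ}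

/-- Compatibility with the relations `z` among the values of the bilinear map. -/
def wellDefSystem {q : ℕ} (z : Fin q → Matrix (Fin I.n) (Fin I.p) ℤ) : Set I.Tup :=
  {x | ∀ k, I.relM.IsZero fun κ => ∑ i, ∑ l, ∑ j, x.1 i l * z k i j * I.s l j κ}

/-! ### Step 2: the linear systems for the presentation -/

/-- Linear relations among the endomorphisms given by `d`. -/
def relationSystem {r : ℕ} (d : Fin r → I.Tup) : Set (Fin r → ℤ) :=
  {x | (∀ k, I.rel₁.IsZero fun j => ∑ i, x i * (d i).1 k j) ∧
    ∀ k, I.rel₂.IsZero fun j => ∑ i, x i * (d i).2 k j}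

/-- Integer combinations of the endomorphisms given by `d` that are the identity. -/
def oneSystem {r : ℕ} (d : Fin r → I.Tup) : Set (Fin r → ℤ) :=
  {x | (∀ k, I.rel₁.IsZero fun j =>
      (∑ i, x i * (d i).1 k j) - (1 : Matrix (Fin I.n) (Fin I.n) ℤ) k j) ∧
    ∀ k, I.rel₂.IsZero fun j =>
      (∑ i, x i * (d i).2 k j) - (1 : Matrix (Fin I.p) (Fin I.p) ℤ) k j}

/-- Integer combinations of the endomorphisms given by `d` that equal the product of
those with indices `i` and `j`. -/
def mulSystem {r : ℕ} (d : Fin r → I.Tup) (i j : Fin r) : Set (Fin r → ℤ) :=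
  {x | (∀ k, I.rel₁.IsZero fun h =>
      (∑ l, (d j).1 k l * (d i).1 l h) - ∑ κ, x κ * (d κ).1 k h) ∧
    ∀ k, I.rel₂.IsZero fun h =>
      (∑ l, (d j).2 k l * (d i).2 l h) - ∑ κ, x κ * (d κ).2 k h}

end Input

open MvPolynomial in
/-- The ideal generated by `v₁y₁ + ⋯ + vᵣyᵣ - 1`, by the linear forms `∑ₖ uₗₖ yₖ`, and by
`yᵢyⱼ - ∑ₖ tᵢⱼₖ yₖ`. -/
noncomputable def presIdeal {r ρ : ℕ} (v : Fin r → ℤ) (w : Fin ρ → Fin r → ℤ)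
    (t : Fin r → Fin r → Fin r → ℤ) : Ideal (MvPolynomial (Fin r) ℤ) :=
  Ideal.span ({(∑ k, C (v k) * X k) - 1} ∪ Set.range (fun l => ∑ k, C (w l k) * X k) ∪
    Set.range fun ij : Fin r × Fin r => X ij.1 * X ij.2 - ∑ k, C (t ij.1 ij.2 k) * X k)

/-! ### Step 3: idempotents from the connected components of a primary decomposition -/

/-- The family `q` arises from the ideal `J` as follows: take a primary decomposition
`J = ⋂ Q a`, group the `Q a` according to the connected component of `Spec (P / J)` containing the
prime `√(Q a)`, let `Jᵢ` be the intersection of the `i`-th group (the fibre of `c` over `i`),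
and write `1 = q i + (1 - q i)` with `q i ∈ ⋂_{j ≠ i} Jⱼ` and `1 - q i ∈ Jᵢ`. Here
`Spec (P / J)` is the closed subset `V(J)` of `Spec P`. -/
def IsIdempotentStep {P : Type*} [CommRing P] (J : Ideal P) {ν : ℕ} (q : Fin ν → P) : Prop :=
  ∃ (k : ℕ) (Q : Fin k → Ideal P) (pt : Fin k → PrimeSpectrum P) (c : Fin k → Fin ν),
    (∀ a, (Q a).IsPrimary) ∧ J = ⨅ a, Q a ∧ (∀ a, (pt a).asIdeal = (Q a).radical) ∧
    Function.Surjective c ∧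
    (∀ a b, c a = c b ↔ pt b ∈ connectedComponentIn (PrimeSpectrum.zeroLocus (J : Set P)) (pt a)) ∧
    ∀ i, (∀ a, c a ≠ i → q i ∈ Q a) ∧ ∀ a, c a = i → 1 - q i ∈ Q a

/-- A polynomial in `r` variables written as a list of terms (exponents and coefficient). -/
abbrev PolyTerms (r : ℕ) : Type := List ((Fin r → ℕ) × ℤ)

/-- The polynomial with the given list of terms. -/
noncomputable def PolyTerms.toPoly {r : ℕ} (w : PolyTerms r) : MvPolynomial (Fin r) ℤ :=
  (w.map fun c => MvPolynomial.C c.2 * ∏ k, MvPolynomial.X k ^ c.1 k).sum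

/-- Substitution of square matrices; they need not commute, so the variables of each term are
multiplied in their natural order. -/
def PolyTerms.evalMat {r h : ℕ} (w : PolyTerms r) (A : Fin r → Matrix (Fin h) (Fin h) ℤ) :
    Matrix (Fin h) (Fin h) ℤ :=
  (w.map fun c => c.2 • (List.ofFn fun k => A k ^ c.1 k).prod).sum

/-! ### Runs of the algorithm -/

/-- The data computed in the course of a run. -/
structure Run (I : Input) where
  numδ : ℕ
  δ : Fin numδ → I.Tup
  numz : ℕ
  z : Fin numz → Matrix (Fin I.n) (Fin I.p) ℤ
  r : ℕ
  d : Fin r → I.Tup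
  ρ : ℕ
  w : Fin ρ → Fin r → ℤ
  v : Fin r → ℤ
  t : Fin r → Fin r → Fin r → ℤ
  ℓ : ℕ
  e : Fin ℓ → PolyTerms r

namespace Run

variable {I : Input} (R : Run I)

/-- The ideal `J` with `𝔖(f) = ℤ[y₁, …, yᵣ] / J`. -/
noncomputable def ideal : Ideal (MvPolynomial (Fin R.r) ℤ) := presIdeal R.v R.w R.t

/-- The data are obtained by carrying out the first three steps of the algorithm. -/
def IsValid : Prop :=
  IsZBasis R.δ (I.endSystem ∩ I.symSystem) ∧
  IsZBasis R.z I.valueSystem ∧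
  IsZBasis R.d (I.endSystem ∩ I.symSystem ∩ I.cenSystem R.δ ∩ I.wellDefSystem R.z) ∧
  IsZBasis R.w (I.relationSystem R.d) ∧
  R.v ∈ I.oneSystem R.d ∧
  (∀ i j, R.t i j ∈ I.mulSystem R.d i j) ∧
  IsIdempotentStep R.ideal (fun i => (R.e i).toPoly)

/-- Step 4: the matrix `Eᵢ = eᵢ(A₁, …, Aᵣ)`. -/
def E (i : Fin R.ℓ) : Matrix (Fin I.n) (Fin I.n) ℤ := (R.e i).evalMat fun k => (R.d k).1

/-- Step 4: the matrix `E'ᵢ = eᵢ(A'₁, …, A'ᵣ)`. -/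
def E' (i : Fin R.ℓ) : Matrix (Fin I.p) (Fin I.p) ℤ := (R.e i).evalMat fun k => (R.d k).2

/-- Step 5: the values of `fᵢ` on the generators of its two source groups, in coordinates. -/
def outS (i : Fin R.ℓ) (j : Fin I.n) (k : Fin I.p) (κ : Fin I.m) : ℤ :=
  ∑ x, ∑ y, R.E i j x * R.E' i k y * I.s x y κ

variable {N₁ N₂ M : Type u} [AddCommGroup N₁] [AddCommGroup N₂] [AddCommGroup M]

/-- Step 4: the entries of `Eᵢ · (a₁, …, aₙ)ᵗʳ`. -/
def gen₁ (a : Fin I.n → N₁) (i : Fin R.ℓ) (j : Fin I.n) : N₁ := ∑ k, R.E i j k • a k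

/-- Step 4: the entries of `E'ᵢ · (a'₁, …, a'ₚ)ᵗʳ`. -/
def gen₂ (a' : Fin I.p → N₂) (i : Fin R.ℓ) (j : Fin I.p) : N₂ := ∑ k, R.E' i j k • a' k

/-- Step 5: the returned subgroups of `N₁`. -/
def out₁ (a : Fin I.n → N₁) (i : Fin R.ℓ) : AddSubgroup N₁ :=
  AddSubgroup.closure (Set.range (R.gen₁ a i))

/-- Step 5: the returned subgroups of `N₂`. -/
def out₂ (a' : Fin I.p → N₂) (i : Fin R.ℓ) : AddSubgroup N₂ :=
  AddSubgroup.closure (Set.range (R.gen₂ a' i))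

/-- Step 5: the returned subgroups of `M`. -/
def outM (a : Fin I.n → N₁) (a' : Fin I.p → N₂) (f : N₁ →+ N₂ →+ M) (i : Fin R.ℓ) :
    AddSubgroup M :=
  AddSubgroup.closure
    (Set.range fun jk : Fin I.n × Fin I.p => f (R.gen₁ a i jk.1) (R.gen₂ a' i jk.2))

end Run

/-! ### Encoding of input and runs by lists of integers -/

abbrev VecCode : Type := List ℤ
abbrev MatCode : Type := List (List ℤ)
abbrev TensorCode : Type := List (List (List ℤ))

def vecCode {k : ℕ} (x : Fin k → ℤ) : VecCode := List.ofFn x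

def matCode {h k : ℕ} (x : Fin h → Fin k → ℤ) : MatCode := List.ofFn fun i => vecCode (x i)

def tensorCode {g h k : ℕ} (x : Fin g → Fin h → Fin k → ℤ) : TensorCode :=
  List.ofFn fun i => matCode (x i)

abbrev InputCode : Type := (ℕ × ℕ × ℕ) × MatCode × MatCode × MatCode × TensorCode

def Input.code (I : Input) : InputCode :=
  ((I.n, I.p, I.m), matCode I.rel₁.rel, matCode I.rel₂.rel, matCode I.relM.rel, tensorCode I.s)

def tupCode {I : Input} (x : I.Tup) : MatCode × MatCode := (matCode x.1, matCode x.2)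

def polyCode {r : ℕ} (w : PolyTerms r) : List (List ℕ × ℤ) :=
  w.map fun c => (List.ofFn c.1, c.2)

/-- The two lists of tuples and the relations of Step 1, the presentation of Step 2, the
polynomials of Step 3, and the decomposition of Steps 4 and 5. -/
abbrev RunCode : Type :=
  (List (MatCode × MatCode) × TensorCode × List (MatCode × MatCode)) ×
    (MatCode × VecCode × TensorCode) × List (List (List ℕ × ℤ)) ×
      List (MatCode × MatCode × TensorCode)

def Run.code {I : Input} (R : Run I) : RunCode :=
  ((List.ofFn fun i => tupCode (R.δ i), tensorCode R.z, List.ofFn fun i => tupCode (R.d i)),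
    (matCode R.w, vecCode R.v, tensorCode R.t), (List.ofFn fun i => polyCode (R.e i)),
      List.ofFn fun i => (matCode (R.E i), matCode (R.E' i), tensorCode (R.outS i)))

end BilinDecomp

/-!
Consider the triples of endomorphisms of `N₁`, `N₂`, `M` that act as scalars, that is, with
`f (α x) y = γ (f x y) = f x (β y)`. One of two such triples can be moved to the first argument of
`f` and the other to the second, so that for a full non-degenerate map they commute. They form the
maximal ring of scalars (`exists_isMaximalRingOfScalars`, `IsMaximalRingOfScalars.exists_smul`).

*Correctness.* The solutions of the linear systems of the procedure are the matrix pairs that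
describe the action of a scalar (`mem_scalarSystem_iff`). So the `φ_k` generate the maximal ring
of scalars additively, and since `J` reduces every polynomial to a linear form, it is the kernel
of `y_k ↦ φ_k` (`IsRingPresentation.ker_aeval`). Polynomials are obtained from a primary
decomposition of `J`, grouped by connected components of the spectrum, if and only if their
classes form a complete set of primitive idempotents (`IsIdempotentStep.isCompletePrimitive`,
`IsIdempotentStep.of_isCompletePrimitive`). A decomposition of the factor cut out by a primitive
idempotent `ε` would have projections that form an idempotent scalar strictly between `0` and `ε`;
so the factors are indecomposable (`isDirectlyIndecomposable_of_isPrimitiveIdempotent`,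
`exists_isCanonicalDecomposition`, `Run.IsValid.correct`).

*Effectiveness.* Every input has a valid run whose polynomials are linear forms
(`exists_isValid`), because a Noetherian ring has a complete set of primitive idempotents
(`exists_isCompletePrimitive`). An unbounded search finds such a run (`Semi.exists_search`),
provided that validity is semidecidable, that is, equivalent to the existence of a finite
certificate that can be checked mechanically (`rawCert_iff_isValid`). For the bases of solutions
of linear systems a certificate consists of identities between integer linear forms
(`indepOn_iff`, `spanned_iff`, `isZBasis_iff_basisCert`). That given elements form a complete set
of primitive idempotents is certified (`IdemCert`) by homomorphisms to fields, one for each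
minimal prime, whose common kernel is spanned by nilpotent elements, and by congruences which show
that no element of the ring takes the values `0` and `1` at these homomorphisms in a way that
would split one of the given idempotents. A homomorphism to a field is described by an irreducible
polynomial over `ℤ` or `ZMod c` (`HomCert`), whose irreducibility is a finite check by the bound
of Mignotte for the coefficients of a factor (`IrrCert`).
-/

namespace BilinDecomp

/-! ### Primitive recursive functions of integers and of integer arrays -/

section Primitive

open Encodable

variable {α β γ : Type} [Primcodable α] [Primcodable β] [Primcodable γ]

attribute [fun_prop] Primrec
attribute [fun_prop] Primrec.id Primrec.const Primrec.comp

@[fun_prop]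
theorem primrec_pair {f : α → β} {g : α → γ} (hf : Primrec f) (hg : Primrec g) :
    Primrec fun a => (f a, g a) := hf.pair hg

@[fun_prop]
theorem primrec_fst {f : α → β × γ} (hf : Primrec f) : Primrec fun a => (f a).1 :=
  Primrec.fst.comp hf

@[fun_prop]
theorem primrec_snd {f : α → β × γ} (hf : Primrec f) : Primrec fun a => (f a).2 :=
  Primrec.snd.comp hf

@[fun_prop]
theorem primrec_nat_add {f g : α → ℕ} (hf : Primrec f) (hg : Primrec g) :
    Primrec fun a => f a + g a := Primrec.nat_add.comp hf hg

@[fun_prop]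
theorem primrec_nat_sub {f g : α → ℕ} (hf : Primrec f) (hg : Primrec g) :
    Primrec fun a => f a - g a := Primrec.nat_sub.comp hf hg

@[fun_prop]
theorem primrec_nat_mul {f g : α → ℕ} (hf : Primrec f) (hg : Primrec g) :
    Primrec fun a => f a * g a := Primrec.nat_mul.comp hf hg

@[fun_prop]
theorem primrec_nat_div {f g : α → ℕ} (hf : Primrec f) (hg : Primrec g) :
    Primrec fun a => f a / g a := Primrec.nat_div.comp hf hg

@[fun_prop]
theorem primrec_nat_mod {f g : α → ℕ} (hf : Primrec f) (hg : Primrec g) :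
    Primrec fun a => f a % g a := Primrec.nat_mod.comp hf hg

@[fun_prop]
theorem primrec_nat_pow {f g : α → ℕ} (hf : Primrec f) (hg : Primrec g) :
    Primrec fun a => f a ^ g a :=
  (Primrec₂.unpaired'.1 Nat.Primrec.pow : Primrec₂ fun m n : ℕ => m ^ n).comp hf hg

@[fun_prop]
theorem primrec_ite_nat_eq {f g : α → ℕ} {u v : α → β} (hf : Primrec f) (hg : Primrec g)
    (hu : Primrec u) (hv : Primrec v) : Primrec fun a => if f a = g a then u a else v a :=
  Primrec.ite (Primrec.eq.comp hf hg) hu hv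

theorem primrec_ite_nat_lt {f g : α → ℕ} {u v : α → β} (hf : Primrec f) (hg : Primrec g)
    (hu : Primrec u) (hv : Primrec v) : Primrec fun a => if f a < g a then u a else v a :=
  Primrec.ite (Primrec.nat_lt.comp hf hg) hu hv

/-- The encoding of the integers lists them as `0, -1, 1, -2, 2, …`. -/
theorem encode_int (z : ℤ) : encode z = if 0 ≤ z then 2 * z.toNat else 2 * (-z).toNat - 1 := by
  rcases z with n | n
  · change Equiv.intEquivNat (Int.ofNat n) = _
    have h : (0 : ℤ) ≤ Int.ofNat n := by simp
    rw [if_pos h]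
    rfl
  · change Equiv.intEquivNat (Int.negSucc n) = _
    have : ¬ (0 ≤ Int.negSucc n) := by omega
    rw [if_neg this]
    have h2 : (-Int.negSucc n).toNat = n + 1 := by omega
    rw [h2]
    simp [Equiv.intEquivNat, Equiv.intEquivNatSumNat]
    omega

@[fun_prop]
theorem primrec_toNat {f : α → ℤ} (hf : Primrec f) : Primrec fun a => (f a).toNat := by
  have h : Primrec fun z : ℤ => z.toNat := by
    have h1 : Primrec fun z : ℤ => if encode z % 2 = 0 then encode z / 2 else 0 := by
      have : Primrec fun z : ℤ => encode z := Primrec.encode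
      fun_prop
    refine h1.of_eq fun z => ?_
    rw [encode_int]
    split_ifs <;> omega
  exact h.comp hf

theorem primrec_toNat_neg {f : α → ℤ} (hf : Primrec f) : Primrec fun a => (-f a).toNat := by
  have h : Primrec fun z : ℤ => (-z).toNat := by
    have h1 : Primrec fun z : ℤ => if encode z % 2 = 0 then 0 else (encode z + 1) / 2 := by
      have : Primrec fun z : ℤ => encode z := Primrec.encode
      fun_prop
    refine h1.of_eq fun z => ?_
    rw [encode_int]
    split_ifs <;> omega
  exact h.comp hf

theorem primrec_int_subNat {f g : α → ℕ} (hf : Primrec f) (hg : Primrec g) :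
    Primrec fun a => (f a : ℤ) - (g a : ℤ) := by
  rw [← Primrec.encode_iff]
  have : Primrec fun a => if f a < g a then 2 * (g a - f a) - 1 else 2 * (f a - g a) :=
    primrec_ite_nat_lt hf hg (by fun_prop) (by fun_prop)
  refine this.of_eq fun a => ?_
  rw [encode_int]
  split_ifs <;> omega

@[fun_prop]
theorem primrec_natCast {f : α → ℕ} (hf : Primrec f) : Primrec fun a => (f a : ℤ) := by
  simpa using primrec_int_subNat hf (Primrec.const 0)

@[fun_prop]
theorem primrec_int_add {f g : α → ℤ} (hf : Primrec f) (hg : Primrec g) :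
    Primrec fun a => f a + g a := by
  refine (primrec_int_subNat (primrec_nat_add (primrec_toNat hf) (primrec_toNat hg))
    (primrec_nat_add (primrec_toNat_neg hf) (primrec_toNat_neg hg))).of_eq fun a => ?_
  omega

@[fun_prop]
theorem primrec_int_neg {f : α → ℤ} (hf : Primrec f) : Primrec fun a => -f a := by
  refine (primrec_int_subNat (primrec_toNat_neg hf) (primrec_toNat hf)).of_eq fun a => ?_
  omega

@[fun_prop]
theorem primrec_int_sub {f g : α → ℤ} (hf : Primrec f) (hg : Primrec g) :
    Primrec fun a => f a - g a := by
  simp only [sub_eq_add_neg]; fun_prop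

/-- Integers are differences of natural numbers, namely of their positive and negative parts, and
products are expanded accordingly. -/
@[fun_prop]
theorem primrec_int_mul {f g : α → ℤ} (hf : Primrec f) (hg : Primrec g) :
    Primrec fun a => f a * g a := by
  have key : ∀ x y : ℤ, ((x.toNat * y.toNat + (-x).toNat * (-y).toNat : ℕ) : ℤ) -
      ((x.toNat * (-y).toNat + (-x).toNat * y.toNat : ℕ) : ℤ) = x * y := by
    intro x y
    have hx : x = (x.toNat : ℤ) - ((-x).toNat : ℤ) := by omega
    have hy : y = (y.toNat : ℤ) - ((-y).toNat : ℤ) := by omega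
    conv_rhs => rw [hx, hy]
    push_cast
    ring
  have h1 := primrec_toNat hf
  have h2 := primrec_toNat hg
  have h3 := primrec_toNat_neg hf
  have h4 := primrec_toNat_neg hg
  refine (primrec_int_subNat (primrec_nat_add (primrec_nat_mul h1 h2) (primrec_nat_mul h3 h4))
    (primrec_nat_add (primrec_nat_mul h1 h4) (primrec_nat_mul h3 h2))).of_eq fun a => key _ _

@[fun_prop]
theorem primrec_natAbs {f : α → ℤ} (hf : Primrec f) : Primrec fun a => (f a).natAbs := by
  refine (primrec_nat_add (primrec_toNat hf) (primrec_toNat_neg hf)).of_eq fun a => ?_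
  omega

@[fun_prop]
theorem primrec_list_map {f : α → List β} {g : α → β → γ} (hf : Primrec f)
    (hg : Primrec fun p : α × β => g p.1 p.2) : Primrec fun a => (f a).map (g a) :=
  Primrec.list_map hf hg

@[fun_prop]
theorem primrec_list_range {f : α → ℕ} (hf : Primrec f) : Primrec fun a => List.range (f a) :=
  Primrec.list_range.comp hf

@[fun_prop]
theorem primrec_list_append {f g : α → List β} (hf : Primrec f) (hg : Primrec g) :
    Primrec fun a => f a ++ g a := Primrec.list_append.comp hf hg

@[fun_prop]
theorem primrec_list_length {f : α → List β} (hf : Primrec f) : Primrec fun a => (f a).length :=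
  Primrec.list_length.comp hf

@[fun_prop]
theorem primrec_list_flatMap {f : α → List β} {g : α → β → List γ} (hf : Primrec f)
    (hg : Primrec fun p : α × β => g p.1 p.2) : Primrec fun a => (f a).flatMap (g a) :=
  Primrec.list_flatMap hf hg

@[fun_prop]
theorem primrec_list_getD {f : α → List β} {g : α → ℕ} {d : β} (hf : Primrec f)
    (hg : Primrec g) : Primrec fun a => (f a).getD (g a) d :=
  (Primrec.list_getD d).comp hf hg

@[fun_prop]
theorem primrec_sum_range {n : α → ℕ} {f : α → ℕ → ℤ} (hn : Primrec n)
    (hf : Primrec fun p : α × ℕ => f p.1 p.2) :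
    Primrec fun a => ∑ i ∈ Finset.range (n a), f a i := by
  have h : Primrec fun a => (((List.range (n a)).map (f a)).foldr (fun x s => x + s) 0) := by
    have hl : Primrec fun a => (List.range (n a)).map (f a) := by fun_prop
    exact Primrec.list_foldr (h := fun (_ : α) (x : ℤ × ℤ) => x.1 + x.2) hl (Primrec.const 0)
      (show Primrec fun p : α × ℤ × ℤ => p.2.1 + p.2.2 by fun_prop)
  refine h.of_eq fun a => ?_
  change ((List.range (n a)).map (f a)).sum = _
  rw [Finset.sum_eq_multiset_sum]
  rfl

/-- The entry with index `k` of the integer array `D`; the index may be of any encodable type,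
and entries that are not stored are `0`. -/
def look {κ : Type*} [Encodable κ] (D : List ℤ) (k : κ) : ℤ := D.getD (encode k) 0

@[fun_prop]
theorem primrec_look {f : α → List ℤ} {g : α → γ} (hf : Primrec f) (hg : Primrec g) :
    Primrec fun a => look (f a) (g a) := by
  unfold look
  have := Primrec.encode.comp hg
  fun_prop

/-- Every function on a finite index set is stored in some integer array. -/
theorem exists_look {κ : Type*} [Encodable κ] (s : Finset κ) (F : κ → ℤ) :
    ∃ D : List ℤ, ∀ k ∈ s, look D k = F k := by
  classical
  obtain ⟨N, hN⟩ : ∃ N, ∀ k ∈ s, encode k < N :=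
    ⟨s.sup encode + 1, fun k hk => Nat.lt_succ_of_le (Finset.le_sup (f := encode) hk)⟩
  refine ⟨(List.range N).map fun i => ((decode i : Option κ).map F).getD 0, fun k hk => ?_⟩
  simp [look, List.getD, hN k hk]

theorem exists_look₁ (N : ℕ) (F : ℕ → ℤ) : ∃ D : List ℤ, ∀ i < N, look D i = F i := by
  obtain ⟨D, hD⟩ := exists_look (Finset.range N) F
  exact ⟨D, fun i hi => hD i (by simpa using hi)⟩

theorem exists_look₂ (N N' : ℕ) (F : ℕ → ℕ → ℤ) :
    ∃ D : List ℤ, ∀ i < N, ∀ j < N', look D (i, j) = F i j := by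
  obtain ⟨D, hD⟩ := exists_look (Finset.range N ×ˢ Finset.range N') fun p => F p.1 p.2
  exact ⟨D, fun i hi j hj => hD (i, j) (by simp [hi, hj])⟩

theorem exists_look₃ (N N' N'' : ℕ) (F : ℕ → ℕ → ℕ → ℤ) :
    ∃ D : List ℤ, ∀ i < N, ∀ j < N', ∀ k < N'', look D (i, j, k) = F i j k := by
  obtain ⟨D, hD⟩ := exists_look (Finset.range N ×ˢ Finset.range N' ×ˢ Finset.range N'')
    fun p => F p.1 p.2.1 p.2.2
  exact ⟨D, fun i hi j hj k hk => hD (i, j, k) (by simp [hi, hj, hk])⟩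

end Primitive

/-! ### Semidecidable predicates -/

section Semi

open Encodable

variable {α β γ : Type} [Primcodable α] [Primcodable β] [Primcodable γ]

/-- A predicate is semidecidable if it is the projection of a primitive recursive relation. -/
def Semi (p : α → Prop) : Prop :=
  ∃ q : α × ℕ → Prop, PrimrecPred q ∧ ∀ a, p a ↔ ∃ n, q (a, n)

namespace Semi

theorem of_primrecPred {p : α → Prop} (hp : PrimrecPred p) : Semi p :=
  ⟨fun x => p x.1, hp.comp Primrec.fst, fun a => by simp⟩

theorem of_iff {p q : α → Prop} (hp : Semi p) (h : ∀ a, q a ↔ p a) : Semi q := by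
  obtain ⟨r, hr, H⟩ := hp
  exact ⟨r, hr, fun a => (h a).trans (H a)⟩

theorem ex {p : α → β → Prop} (hp : Semi fun x : α × β => p x.1 x.2) :
    Semi fun a => ∃ b, p a b := by
  obtain ⟨q, hq, H⟩ := hp
  classical
  -- a natural number codes both a candidate for `b` and a witness for `p a b`
  let t : α × ℕ → Option Bool := fun x =>
    (decode (α := β) x.2.unpair.1).map fun b => decide (q ((x.1, b), x.2.unpair.2))
  have ht : Primrec t := by
    refine Primrec.option_map (Primrec.decode.comp (Primrec.fst.comp
      (Primrec.unpair.comp Primrec.snd))) ?_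
    have h1 : Primrec fun y : (α × ℕ) × β => ((y.1.1, y.2), y.1.2.unpair.2) := by
      have := Primrec.unpair
      fun_prop
    exact (primrecPred_iff_primrec_decide.1 hq).comp h1
  refine ⟨fun x => t x = some true, Primrec.eq.comp ht (Primrec.const _), fun a => ?_⟩
  constructor
  · rintro ⟨b, hb⟩
    obtain ⟨n, hn⟩ := (H (a, b)).1 hb
    exact ⟨Nat.pair (encode b) n, by simp [t, hn]⟩
  · rintro ⟨n, hn⟩
    simp only [t, Option.map_eq_some_iff, decide_eq_true_eq] at hn
    obtain ⟨b, -, hb⟩ := hn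
    exact ⟨b, (H (a, b)).2 ⟨_, hb⟩⟩

theorem and {p q : α → Prop} (hp : Semi p) (hq : Semi q) : Semi fun a => p a ∧ q a := by
  obtain ⟨r, hr, H⟩ := hp
  obtain ⟨s, hs, K⟩ := hq
  have h : Semi fun a => ∃ x : ℕ × ℕ, r (a, x.1) ∧ s (a, x.2) :=
    ex (of_primrecPred ((hr.comp (f := fun y : α × ℕ × ℕ => (y.1, y.2.1)) (by fun_prop)).and
      (hs.comp (f := fun y : α × ℕ × ℕ => (y.1, y.2.2)) (by fun_prop))))
  refine h.of_iff fun a => ?_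
  rw [H, K]
  exact ⟨fun ⟨⟨m, hm⟩, n, hn⟩ => ⟨(m, n), hm, hn⟩, fun ⟨x, hm, hn⟩ => ⟨⟨_, hm⟩, _, hn⟩⟩

theorem or {p q : α → Prop} (hp : Semi p) (hq : Semi q) : Semi fun a => p a ∨ q a := by
  obtain ⟨r, hr, H⟩ := hp
  obtain ⟨s, hs, K⟩ := hq
  refine ⟨fun x => r x ∨ s x, hr.or hs, fun a => ?_⟩
  change p a ∨ q a ↔ ∃ k, r (a, k) ∨ s (a, k)
  rw [H, K, exists_or]

theorem ball {n : α → ℕ} {p : α → ℕ → Prop} (hn : Primrec n)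
    (hp : Semi fun x : α × ℕ => p x.1 x.2) : Semi fun a => ∀ i < n a, p a i := by
  obtain ⟨q, hq, H⟩ := hp
  -- a single bound serves for the finitely many witnesses
  refine ⟨fun x => ∀ i < n x.1, ∃ k < x.2, q ((x.1, i), k), ?_, fun a => ?_⟩
  · have h1 : PrimrecRel fun (k : ℕ) (y : (α × ℕ) × ℕ) => q ((y.1.1, y.2), k) :=
      hq.comp (f := fun z : ℕ × (α × ℕ) × ℕ => ((z.2.1.1, z.2.2), z.1)) (by fun_prop)
    have h2 : PrimrecRel fun (i : ℕ) (x : α × ℕ) => ∃ k ∈ List.range x.2, q ((x.1, i), k) :=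
      h1.exists_mem_list.comp (f := fun z : ℕ × α × ℕ => List.range z.2.2)
        (g := fun z => (z.2, z.1)) (by fun_prop) (by fun_prop)
    have h3 : Primrec fun x : α × ℕ => List.range (n x.1) := by fun_prop
    exact (h2.forall_mem_list.comp h3 Primrec.id).of_eq fun x => by simp
  · constructor
    · intro h
      have h' : ∀ i, ∃ k, i < n a → q ((a, i), k) := by
        intro i
        by_cases hi : i < n a
        · obtain ⟨k, hk⟩ := (H (a, i)).1 (h i hi)
          exact ⟨k, fun _ => hk⟩
        · exact ⟨0, fun h => absurd h hi⟩
      choose k hk using h'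
      refine ⟨(Finset.range (n a)).sup k + 1, fun i hi => ⟨k i, ?_, hk i hi⟩⟩
      exact Nat.lt_succ_of_le (Finset.le_sup (by simpa using hi))
    · rintro ⟨m, h⟩ i hi
      obtain ⟨k, -, hk⟩ := h i hi
      exact (H (a, i)).2 ⟨k, hk⟩

theorem bex {n : α → ℕ} {p : α → ℕ → Prop} (hn : Primrec n)
    (hp : Semi fun x : α × ℕ => p x.1 x.2) : Semi fun a => ∃ i < n a, p a i :=
  ex ((of_primrecPred (Primrec.nat_lt.comp Primrec.snd (hn.comp Primrec.fst))).and hp)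

theorem eq [DecidableEq β] {f g : α → β} (hf : Primrec f) (hg : Primrec g) :
    Semi fun a => f a = g a := of_primrecPred (Primrec.eq.comp hf hg)

theorem ne [DecidableEq β] {f g : α → β} (hf : Primrec f) (hg : Primrec g) :
    Semi fun a => f a ≠ g a := of_primrecPred (Primrec.eq.comp hf hg).not

theorem le {f g : α → ℕ} (hf : Primrec f) (hg : Primrec g) : Semi fun a => f a ≤ g a :=
  of_primrecPred (Primrec.nat_le.comp hf hg)

theorem dvd {f g : α → ℤ} (hf : Primrec f) (hg : Primrec g) : Semi fun a => f a ∣ g a := by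
  have h : Semi fun a => (g a).natAbs % (f a).natAbs = 0 := eq (by fun_prop) (by fun_prop)
  exact h.of_iff fun a => by rw [← Int.natAbs_dvd_natAbs, Nat.dvd_iff_mod_eq_zero]

theorem not_dvd {f g : α → ℤ} (hf : Primrec f) (hg : Primrec g) : Semi fun a => ¬ f a ∣ g a := by
  have h : Semi fun a => (g a).natAbs % (f a).natAbs ≠ 0 := ne (by fun_prop) (by fun_prop)
  exact h.of_iff fun a => by rw [← Int.natAbs_dvd_natAbs, Nat.dvd_iff_mod_eq_zero]

/-- A semidecidable predicate `p a b` for which every `a ∈ s` has a solution `b` can be solved by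
a partial recursive function: it searches through all `b` and all witnesses. -/
theorem exists_search {p : α → β → Prop} (hp : Semi fun x : α × β => p x.1 x.2)
    {out : α → β → γ} (ho : Primrec fun x : α × β => out x.1 x.2) :
    ∃ alg : α →. γ, Partrec alg ∧
      ∀ a, (∃ b, p a b) → ∃ b, p a b ∧ alg a = Part.some (out a b) := by
  classical
  obtain ⟨q, hq, H⟩ := hp
  let t : α → ℕ → Option γ := fun a n =>
    (decode (α := β) n.unpair.1).bind fun b =>
      if q ((a, b), n.unpair.2) then some (out a b) else none
  have ht : Primrec fun x : α × ℕ => t x.1 x.2 := by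
    refine Primrec.option_bind (Primrec.decode.comp (Primrec.fst.comp
      (Primrec.unpair.comp Primrec.snd))) ?_
    have h1 : Primrec fun y : (α × ℕ) × β => ((y.1.1, y.2), y.1.2.unpair.2) := by
      have := Primrec.unpair
      fun_prop
    have h2 : Primrec fun y : (α × ℕ) × β => out y.1.1 y.2 :=
      ho.comp (f := fun x : α × β => out x.1 x.2) (g := fun y : (α × ℕ) × β => (y.1.1, y.2))
        (by fun_prop)
    exact Primrec.ite (hq.comp h1) (Primrec.option_some.comp h2) (Primrec.const none)
  have hP : Partrec fun a => Nat.rfindOpt (t a) := Partrec.rfindOpt ht.to_comp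
  refine ⟨fun a => Nat.rfindOpt (t a), hP, fun a ⟨b, hb⟩ => ?_⟩
  have hdom : (Nat.rfindOpt (t a)).Dom := by
    rw [Nat.rfindOpt_dom]
    obtain ⟨n, hn⟩ := (H (a, b)).1 hb
    exact ⟨Nat.pair (encode b) n, out a b, by simp [t, hn]⟩
  obtain ⟨n, hn⟩ := Nat.rfindOpt_spec (Part.get_mem hdom)
  simp only [t, Option.mem_def, Option.bind_eq_some_iff] at hn
  obtain ⟨b', -, hb'⟩ := hn
  split_ifs at hb' with h
  refine ⟨b', (H (a, b')).2 ⟨_, h⟩, ?_⟩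
  rw [Option.some.injEq] at hb'
  rw [hb']
  exact (Part.some_get hdom).symm

end Semi

end Semi

/-! ### Certificates for integer linear systems -/

section LinearSystems

theorem exists_common_denominator {X : Type*} [Finite X] (q : X → ℚ) :
    ∃ D : ℤ, D ≠ 0 ∧ ∃ z : X → ℤ, ∀ v, (z v : ℚ) = D * q v := by
  obtain ⟨D, hD⟩ := IsLocalization.exist_integer_multiples_of_finite (nonZeroDivisors ℤ) q
  refine ⟨D, nonZeroDivisors.ne_zero D.2, ?_⟩
  choose z hz using hD
  refine ⟨z, fun v => ?_⟩
  have := hz v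
  simpa [Submonoid.smul_def] using this

/-- An integer linear form that vanishes on the integer solutions of a homogeneous system is,
up to a non-zero factor, an integer combination of the equations. -/
theorem exists_multiplier {X Y : Type*} [Fintype X] [Fintype Y] (G : Y → X → ℤ) (φ : X → ℤ)
    (h : ∀ x : X → ℤ, (∀ y, ∑ v, G y v * x v = 0) → ∑ v, φ v * x v = 0) :
    ∃ D : ℤ, D ≠ 0 ∧ ∃ C : Y → ℤ, ∀ v, D * φ v = ∑ y, C y * G y v := by
  classical
  let W : Submodule ℚ (X → ℚ) := Submodule.span ℚ (Set.range fun y v => (G y v : ℚ))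
  have hmem : (fun v => (φ v : ℚ)) ∈ W := by
    -- otherwise some rational solution, hence some integer one, is not a zero of `φ`
    by_contra hφ
    obtain ⟨f, hf, hfW⟩ := Submodule.exists_le_ker_of_notMem hφ
    obtain ⟨D, hD, z, hz⟩ := exists_common_denominator fun v => f (Pi.single v 1)
    have key : ∀ u : X → ℤ, ((∑ v, u v * z v : ℤ) : ℚ) = D * f fun v => (u v : ℚ) := by
      intro u
      rw [LinearMap.pi_apply_eq_sum_univ f, Finset.mul_sum]
      push_cast
      refine Finset.sum_congr rfl fun v _ => ?_
      rw [hz, smul_eq_mul]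
      have : (fun j => if v = j then (1 : ℚ) else 0) = Pi.single v 1 := by
        funext j; simp [Pi.single_apply, eq_comm]
      rw [this]; ring
    have h1 := h z fun y => by
      have h2 := key (G y)
      rw [LinearMap.mem_ker.1 (hfW (Submodule.subset_span ⟨y, rfl⟩)), mul_zero] at h2
      exact_mod_cast h2
    have h3 := key φ
    rw [h1] at h3
    have : (D : ℚ) ≠ 0 := by exact_mod_cast hD
    exact hf (by simpa [this] using h3.symm)
  obtain ⟨c, hc⟩ := (Submodule.mem_span_range_iff_exists_fun ℚ).1 hmem
  obtain ⟨D, hD, z, hz⟩ := exists_common_denominator c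
  refine ⟨D, hD, z, fun v => ?_⟩
  have h1 := congrFun hc v
  simp only [Finset.sum_apply, Pi.smul_apply, smul_eq_mul] at h1
  have : ((D * φ v : ℤ) : ℚ) = ((∑ y, z y * G y v : ℤ) : ℚ) := by
    push_cast
    rw [← h1, Finset.mul_sum]
    exact Finset.sum_congr rfl fun y _ => by rw [hz]; ring
  exact_mod_cast this

/-- The first `N` coordinates of the vectors `b 0, …, b (T - 1)` are linearly independent. -/
def IndepOn (T N : ℕ) (b : ℕ → ℕ → ℤ) : Prop :=
  ∀ n : ℕ → ℤ, (∀ u < N, ∑ i ∈ Finset.range T, n i * b i u = 0) → ∀ i < T, n i = 0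

/-- Extension by zero. -/
def extend {N : ℕ} (F : Fin N → ℤ) (i : ℕ) : ℤ := if h : i < N then F ⟨i, h⟩ else 0

@[simp]
theorem extend_coe {N : ℕ} (F : Fin N → ℤ) (i : Fin N) : extend F i = F i := by
  simp [extend]

theorem extend_of_lt {N : ℕ} (F : Fin N → ℤ) {i : ℕ} (h : i < N) : extend F i = F ⟨i, h⟩ := by
  simp [extend, h]

/-- Linear independence is certified by a left inverse up to a non-zero factor. -/
theorem indepOn_iff (T N : ℕ) (b : ℕ → ℕ → ℤ) :
    IndepOn T N b ↔ ∃ D : ℤ, D ≠ 0 ∧ ∃ G : List ℤ, ∀ i < T, ∀ i' < T,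
      ∑ u ∈ Finset.range N, look G (i, u) * b i' u = if i = i' then D else 0 := by
  constructor
  · intro h
    have h1 : ∀ i : Fin T, ∃ D : ℤ, D ≠ 0 ∧ ∃ C : Fin N → ℤ, ∀ v : Fin T,
        D * (Pi.single i 1 : Fin T → ℤ) v = ∑ u, C u * b v u := by
      intro i
      refine exists_multiplier (fun (u : Fin N) (v : Fin T) => b v u) _ fun x hx => ?_
      have := h (extend x) (fun u hu => by
        simpa [Finset.sum_range, mul_comm] using hx ⟨u, hu⟩) i i.2
      simpa [Pi.single_apply] using this
    choose D hD C hC using h1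
    obtain ⟨G, hG⟩ := exists_look₂ T N fun i u =>
      if hi : i < T then (∏ k ∈ Finset.univ.erase ⟨i, hi⟩, D k) * extend (C ⟨i, hi⟩) u else 0
    refine ⟨∏ k, D k, Finset.prod_ne_zero_iff.2 fun k _ => hD k, G, fun i hi i' hi' => ?_⟩
    have h2 := hC ⟨i, hi⟩ ⟨i', hi'⟩
    rw [Finset.sum_congr rfl fun u hu => by rw [hG i hi u (by simpa using hu), dif_pos hi]]
    simp only [Finset.sum_range, extend_coe, mul_assoc]
    rw [← Finset.mul_sum, ← h2, ← mul_assoc, mul_comm _ (D _), Finset.mul_prod_erase _ _ (by simp)]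
    simp [Pi.single_apply, eq_comm]
  · rintro ⟨D, hD, G, hG⟩ n hn i hi
    have h1 : ∑ i' ∈ Finset.range T, n i' *
        ∑ u ∈ Finset.range N, look G (i, u) * b i' u = 0 := by
      simp only [Finset.mul_sum]
      rw [Finset.sum_comm]
      refine Finset.sum_eq_zero fun u hu => ?_
      have := hn u (by simpa using hu)
      calc _ = look G (i, u) * ∑ i' ∈ Finset.range T, n i' * b i' u := by
            rw [Finset.mul_sum]; exact Finset.sum_congr rfl fun _ _ => by ring
        _ = 0 := by rw [this, mul_zero]
    rw [Finset.sum_congr rfl fun i' hi' => by rw [hG i hi i' (by simpa using hi')]] at h1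
    simpa [hi, hD] using h1

/-- The homogeneous condition "for every `q < Q` the vector `(∑ᵥ A q j v * x v)_j` is an integer
combination of the relations `rel q 0, …, rel q (num q - 1)`". -/
def Solves (N Q : ℕ) (dim num : ℕ → ℕ) (A rel : ℕ → ℕ → ℕ → ℤ) (x : ℕ → ℤ) : Prop :=
  ∀ q < Q, ∃ y : ℕ → ℤ, ∀ j < dim q, ∑ v ∈ Finset.range N, A q j v * x v =
    ∑ l ∈ Finset.range (num q), y l * rel q l j

/-- Every solution is an integer combination of `b 0, …, b (T - 1)`. -/
def Spanned (N Q : ℕ) (dim num : ℕ → ℕ) (A rel : ℕ → ℕ → ℕ → ℤ) (T : ℕ) (b : ℕ → ℕ → ℤ) : Prop :=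
  ∀ x, Solves N Q dim num A rel x →
    ∃ n : ℕ → ℤ, ∀ u < N, x u = ∑ i ∈ Finset.range T, n i * b i u

/-- That the solutions are spanned by given vectors is certified by an identity between linear
forms in the unknowns `x` and in the coefficients `y` of the relations. -/
theorem spanned_iff (N Q : ℕ) (dim num : ℕ → ℕ) (A rel : ℕ → ℕ → ℕ → ℤ) (T : ℕ)
    (b : ℕ → ℕ → ℤ) : Spanned N Q dim num A rel T b ↔
      ∃ D : ℤ, D ≠ 0 ∧ ∃ lam mu C : List ℤ,
        (∀ u < N, ∀ v < N, D * ((if u = v then 1 else 0) -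
          ∑ i ∈ Finset.range T, look lam (i, v) * b i u) =
            ∑ q ∈ Finset.range Q, ∑ j ∈ Finset.range (dim q), look C (u, q, j) * A q j v) ∧
        ∀ u < N, ∀ q < Q, ∀ l < num q, D * ∑ i ∈ Finset.range T, look mu (i, q, l) * b i u =
          ∑ j ∈ Finset.range (dim q), look C (u, q, j) * rel q l j := by
  classical
  constructor
  · intro h
    -- `g` expresses the conditions in the unknowns `x` and the coefficients `y` of the relations
    let X := Fin N ⊕ Σ q : Fin Q, Fin (num q)
    let Y := Σ q : Fin Q, Fin (dim q)
    let G : Y → X → ℤ := fun y => Sum.elim (fun v => A y.1 y.2 v)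
      (fun z => if z.1 = y.1 then - rel z.1 z.2 y.2 else 0)
    let g : (X → ℤ) →ₗ[ℤ] (Y → ℤ) := Matrix.mulVecLin (Matrix.of G)
    have hg : ∀ x y, g x y = ∑ v : Fin N, A y.1 y.2 v * x (Sum.inl v) -
        ∑ l : Fin (num y.1), x (Sum.inr ⟨y.1, l⟩) * rel y.1 l y.2 := by
      intro x y
      change ∑ z, G y z * x z = _
      rw [Fintype.sum_sum_type, sub_eq_add_neg, ← Finset.sum_neg_distrib,
        Fintype.sum_sigma, Finset.sum_eq_single y.1]
      · congr 1
        refine Finset.sum_congr rfl fun l _ => ?_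
        simp [G, mul_comm]
      · intro q _ hq
        simp [G, hq]
      · simp
    -- the range of `g` is free, so its kernel has a complement
    obtain ⟨s, hs⟩ := Module.projective_lifting_property g.rangeRestrict LinearMap.id
      g.surjective_rangeRestrict
    have hs' : ∀ x, g (s (g.rangeRestrict x)) = g x := fun x =>
      congrArg Subtype.val (LinearMap.congr_fun hs (g.rangeRestrict x))
    let π : (X → ℤ) → X → ℤ := fun x => x - s (g.rangeRestrict x)
    have hπ : ∀ x, ∃ n : ℕ → ℤ, ∀ u : Fin N,
        π x (Sum.inl u) = ∑ i ∈ Finset.range T, n i * b i u := by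
      intro x
      have h0 : g (π x) = 0 := by simp only [π, map_sub, hs', sub_self]
      obtain ⟨n, hn⟩ := h (extend fun u => π x (Sum.inl u)) (fun q hq =>
        ⟨extend fun l => π x (Sum.inr ⟨⟨q, hq⟩, l⟩), fun j hj => by
          have := congrFun h0 ⟨⟨q, hq⟩, ⟨j, hj⟩⟩
          rw [hg] at this
          simpa [Finset.sum_range, sub_eq_zero] using this⟩)
      exact ⟨n, fun u => by rw [← hn u u.2, extend_coe]⟩
    choose n hn using hπ
    -- the other component vanishes on the kernel of `g`, hence comes from the equations
    have hmul : ∀ u : Fin N, ∃ D : ℤ, D ≠ 0 ∧ ∃ C : Y → ℤ, ∀ v : X,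
        D * s (g.rangeRestrict (Pi.single v 1)) (Sum.inl u) = ∑ y, C y * G y v := by
      intro u
      refine exists_multiplier G _ fun x hx => ?_
      have hx0 : g.rangeRestrict x = 0 := Subtype.ext (funext hx)
      have h1 : (LinearMap.proj (Sum.inl u : X) ∘ₗ s ∘ₗ g.rangeRestrict) x = 0 := by
        simp [hx0]
      rw [LinearMap.pi_apply_eq_sum_univ] at h1
      rw [← h1]
      refine Finset.sum_congr rfl fun v _ => ?_
      have : (fun j => if v = j then (1 : ℤ) else 0) = Pi.single v 1 := by
        funext j; simp [Pi.single_apply, eq_comm]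
      rw [this, smul_eq_mul, mul_comm]
      rfl
    choose D hD C hC using hmul
    -- the multipliers of the coordinates are brought to a common denominator
    let Ct : Fin N → Y → ℤ := fun u y => (∏ k ∈ Finset.univ.erase u, D k) * C u y
    have hCt : ∀ u v, (∏ k, D k) * ((Pi.single v 1 : X → ℤ) (Sum.inl u) -
        π (Pi.single v 1) (Sum.inl u)) = ∑ y, Ct u y * G y v := by
      intro u v
      have h1 : (Pi.single v 1 : X → ℤ) (Sum.inl u) - π (Pi.single v 1) (Sum.inl u) =
        s (g.rangeRestrict (Pi.single v 1)) (Sum.inl u) := by simp [π]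
      rw [h1, ← Finset.mul_prod_erase _ _ (Finset.mem_univ u), mul_comm (D u), mul_assoc, hC,
        Finset.mul_sum]
      exact Finset.sum_congr rfl fun _ _ => by simp only [Ct]; ring
    let M := ∑ q ∈ Finset.range Q, (dim q + num q)
    have hMd : ∀ q < Q, dim q + num q ≤ M := fun q hq =>
      Finset.single_le_sum (f := fun q => dim q + num q) (fun _ _ => Nat.zero_le _)
        (by simpa using hq)
    obtain ⟨lam, hlam⟩ := exists_look₂ T N fun i v =>
      if hv : v < N then n (Pi.single (Sum.inl ⟨v, hv⟩) 1) i else 0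
    obtain ⟨mu, hmu⟩ := exists_look₃ T Q M fun i q l =>
      if hq : q < Q then if hl : l < num q then
        n (Pi.single (Sum.inr ⟨⟨q, hq⟩, ⟨l, hl⟩⟩) 1) i else 0 else 0
    obtain ⟨CC, hCC⟩ := exists_look₃ N Q M fun u q j =>
      if hu : u < N then if hq : q < Q then if hj : j < dim q then
        Ct ⟨u, hu⟩ ⟨⟨q, hq⟩, ⟨j, hj⟩⟩ else 0 else 0 else 0
    have hCC' : ∀ (u : Fin N) (q : Fin Q) (j : Fin (dim q)),
        look CC ((u : ℕ), (q : ℕ), (j : ℕ)) = Ct u ⟨q, j⟩ := by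
      intro u q j
      rw [hCC u u.2 q q.2 j (lt_of_lt_of_le j.2 (le_trans (Nat.le_add_right _ _) (hMd q q.2)))]
      simp
    refine ⟨∏ k, D k, Finset.prod_ne_zero_iff.2 fun k _ => hD k, lam, mu, CC, ?_, ?_⟩
    · intro u hu v hv
      have h1 := hCt ⟨u, hu⟩ (Sum.inl ⟨v, hv⟩)
      rw [hn, Fintype.sum_sigma] at h1
      rw [Finset.sum_range (n := Q)]
      refine Eq.trans ?_ (h1.trans (Finset.sum_congr rfl fun q _ => ?_))
      · congr 2
        · simp [Pi.single_apply, X]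
        · refine Finset.sum_congr rfl fun i hi => ?_
          rw [hlam i (by simpa using hi) v hv, dif_pos hv]
      · rw [Finset.sum_range]
        exact Finset.sum_congr rfl fun j _ => by rw [← hCC' ⟨u, hu⟩ q j]; rfl
    · intro u hu q hq l hl
      have h1 := hCt ⟨u, hu⟩ (Sum.inr ⟨⟨q, hq⟩, ⟨l, hl⟩⟩)
      rw [hn, Fintype.sum_sigma, Finset.sum_eq_single (ι := Fin Q) ⟨q, hq⟩
        (fun q' _ hq' => by simp [G, hq'.symm]) (by simp)] at h1
      rw [← neg_inj, ← mul_neg, Finset.sum_range (n := dim q)]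
      refine Eq.trans ?_ (h1.trans ((Finset.sum_congr rfl fun j _ => ?_).trans
        (Finset.sum_neg_distrib (s := Finset.univ) _)))
      · congr 1
        simp only [Pi.single_apply, reduceCtorEq, if_false, zero_sub]
        congr 1
        refine Finset.sum_congr rfl fun i hi => ?_
        rw [hmu i (by simpa using hi) q hq l
          (lt_of_lt_of_le hl (le_trans (Nat.le_add_left _ _) (hMd q hq))), dif_pos hq, dif_pos hl]
      · rw [← hCC' ⟨u, hu⟩ ⟨q, hq⟩ j]
        simp [G]
  · rintro ⟨D, hD, lam, mu, C, h1, h2⟩ x hx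
    have hx' : ∀ q, ∃ y : ℕ → ℤ, q < Q → ∀ j < dim q, ∑ v ∈ Finset.range N, A q j v * x v =
        ∑ l ∈ Finset.range (num q), y l * rel q l j := by
      intro q
      by_cases hq : q < Q
      · obtain ⟨y, hy⟩ := hx q hq
        exact ⟨y, fun _ => hy⟩
      · exact ⟨0, fun h => absurd h hq⟩
    choose y hy using hx'
    refine ⟨fun i => (∑ v ∈ Finset.range N, look lam (i, v) * x v) +
      ∑ q ∈ Finset.range Q, ∑ l ∈ Finset.range (num q), look mu (i, q, l) * y q l,
      fun u hu => ?_⟩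
    refine mul_left_cancel₀ hD ?_
    have e1 : D * (x u - ∑ v ∈ Finset.range N,
        (∑ i ∈ Finset.range T, look lam (i, v) * b i u) * x v) =
        ∑ q ∈ Finset.range Q, ∑ j ∈ Finset.range (dim q), look C (u, q, j) *
          ∑ v ∈ Finset.range N, A q j v * x v := by
      have hxu : x u = ∑ v ∈ Finset.range N, (if u = v then 1 else 0) * x v := by
        simp [hu]
      rw [hxu, ← Finset.sum_sub_distrib, Finset.mul_sum]
      have : ∀ v ∈ Finset.range N, D * ((if u = v then 1 else 0) * x v -
          (∑ i ∈ Finset.range T, look lam (i, v) * b i u) * x v) =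
          ∑ q ∈ Finset.range Q, ∑ j ∈ Finset.range (dim q),
            look C (u, q, j) * (A q j v * x v) := by
        intro v hv
        rw [← sub_mul, ← mul_assoc, h1 u hu v (by simpa using hv)]
        simp only [Finset.sum_mul, mul_assoc]
      rw [Finset.sum_congr rfl this, Finset.sum_comm]
      refine Finset.sum_congr rfl fun q _ => ?_
      rw [Finset.sum_comm]
      exact Finset.sum_congr rfl fun j _ => by rw [Finset.mul_sum]
    have e2 : ∑ q ∈ Finset.range Q, ∑ j ∈ Finset.range (dim q), look C (u, q, j) *
          ∑ v ∈ Finset.range N, A q j v * x v =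
        D * ∑ q ∈ Finset.range Q, ∑ l ∈ Finset.range (num q),
          (∑ i ∈ Finset.range T, look mu (i, q, l) * b i u) * y q l := by
      rw [Finset.mul_sum]
      refine Finset.sum_congr rfl fun q hq => ?_
      have hq' : q < Q := by simpa using hq
      rw [Finset.sum_congr rfl fun j hj => by rw [hy q hq' j (by simpa using hj), Finset.mul_sum],
        Finset.sum_comm, Finset.mul_sum]
      refine Finset.sum_congr rfl fun l hl => ?_
      rw [← mul_assoc, h2 u hu q hq' l (by simpa using hl), Finset.sum_mul]
      exact Finset.sum_congr rfl fun _ _ => by ring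
    have e3 : D * x u = D * (∑ v ∈ Finset.range N,
        (∑ i ∈ Finset.range T, look lam (i, v) * b i u) * x v) +
        D * ∑ q ∈ Finset.range Q, ∑ l ∈ Finset.range (num q),
          (∑ i ∈ Finset.range T, look mu (i, q, l) * b i u) * y q l := by
      rw [← e2, ← e1]; ring
    rw [e3, ← mul_add]
    congr 1
    simp only [add_mul, Finset.sum_add_distrib, Finset.sum_mul]
    congr 1
    · rw [Finset.sum_comm]
      exact Finset.sum_congr rfl fun _ _ => Finset.sum_congr rfl fun _ _ => by ring
    · rw [Finset.sum_comm (s := Finset.range T)]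
      refine Finset.sum_congr rfl fun q _ => ?_
      rw [Finset.sum_comm (s := Finset.range T)]
      exact Finset.sum_congr rfl fun _ _ => Finset.sum_congr rfl fun _ _ => by ring

variable {α : Type} [Primcodable α]

theorem Semi.indepOn {T N : α → ℕ} {b : α → ℕ → ℕ → ℤ} (hT : Primrec T) (hN : Primrec N)
    (hb : Primrec fun x : α × ℕ × ℕ => b x.1 x.2.1 x.2.2) :
    Semi fun a => IndepOn (T a) (N a) (b a) := by
  simp only [indepOn_iff]
  refine ex ?_
  refine and (ne (by fun_prop) (by fun_prop)) ?_
  refine ex ?_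
  refine ball (by fun_prop) ?_
  refine ball (by fun_prop) ?_
  exact eq (by fun_prop) (by fun_prop)

theorem Semi.spanned {N Q T : α → ℕ} {dim num : α → ℕ → ℕ} {A rel : α → ℕ → ℕ → ℕ → ℤ}
    {b : α → ℕ → ℕ → ℤ} (hN : Primrec N) (hQ : Primrec Q) (hT : Primrec T)
    (hdim : Primrec fun x : α × ℕ => dim x.1 x.2) (hnum : Primrec fun x : α × ℕ => num x.1 x.2)
    (hA : Primrec fun x : α × ℕ × ℕ × ℕ => A x.1 x.2.1 x.2.2.1 x.2.2.2)
    (hrel : Primrec fun x : α × ℕ × ℕ × ℕ => rel x.1 x.2.1 x.2.2.1 x.2.2.2)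
    (hb : Primrec fun x : α × ℕ × ℕ => b x.1 x.2.1 x.2.2) :
    Semi fun a => Spanned (N a) (Q a) (dim a) (num a) (A a) (rel a) (T a) (b a) := by
  simp only [spanned_iff]
  refine ex ?_
  refine and (ne (by fun_prop) (by fun_prop)) ?_
  refine ex ?_
  refine ex ?_
  refine ex ?_
  refine and ?_ ?_
  · refine ball (by fun_prop) ?_
    refine ball (by fun_prop) ?_
    exact eq (by fun_prop) (by fun_prop)
  · refine ball (by fun_prop) ?_
    refine ball (by fun_prop) ?_
    refine ball (by fun_prop) ?_
    exact eq (by fun_prop) (by fun_prop)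

end LinearSystems

/-! ### Certificates for irreducibility modulo zero or a prime -/

section Irreducibility

open Polynomial

/-- The polynomial `u 0 + u 1 X + ⋯ + u (m - 1) X ^ (m - 1)` over the ring `R`. -/
noncomputable def polyOf (R : Type*) [CommRing R] (m : ℕ) (u : ℕ → ℤ) : R[X] :=
  ∑ a ∈ Finset.range m, C (u a : R) * X ^ a

/-- The coefficient of `X ^ n` in the product of `polyOf _ m u` and `polyOf _ m' u'`. -/
def conv (m m' : ℕ) (u u' : ℕ → ℤ) (n : ℕ) : ℤ :=
  ∑ a ∈ Finset.range m, ∑ b ∈ Finset.range m', if a + b = n then u a * u' b else 0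

variable {R : Type*} [CommRing R]

theorem coeff_polyOf (m : ℕ) (u : ℕ → ℤ) (n : ℕ) :
    (polyOf R m u).coeff n = if n < m then (u n : R) else 0 := by
  simp [polyOf, coeff_X_pow]

theorem degree_polyOf_lt (m : ℕ) (u : ℕ → ℤ) : (polyOf R m u).degree < m := by
  rw [degree_lt_iff_coeff_zero]
  intro n hn
  rw [coeff_polyOf, if_neg (by omega)]

theorem eq_polyOf {m : ℕ} {p : R[X]} (hp : p.degree < m) {u : ℕ → ℤ}
    (hu : ∀ a < m, (u a : R) = p.coeff a) : p = polyOf R m u := by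
  ext n
  rw [coeff_polyOf]
  split_ifs with h
  · rw [hu n h]
  · exact (degree_lt_iff_coeff_zero _ _).1 hp n (by omega)

theorem coeff_polyOf_mul (m m' : ℕ) (u u' : ℕ → ℤ) (n : ℕ) :
    (polyOf R m u * polyOf R m' u').coeff n = (conv m m' u u' n : ℤ) := by
  have h : ∀ a b, (C (u a : R) * X ^ a * (C (u' b : R) * X ^ b)).coeff n =
      if a + b = n then ((u a * u' b : ℤ) : R) else 0 := by
    intro a b
    have : C (u a : R) * X ^ a * (C (u' b : R) * X ^ b) =
        C ((u a * u' b : ℤ) : R) * X ^ (a + b) := by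
      rw [pow_add]; push_cast; rw [C_mul]; ring
    rw [this, coeff_C_mul, coeff_X_pow]
    simp [eq_comm]
  simp only [polyOf, conv, Finset.sum_mul_sum, finsetSum_coeff, h]
  push_cast
  rfl

theorem conv_eq_zero {m m' : ℕ} (u u' : ℕ → ℤ) {n : ℕ} (h : m + m' ≤ n + 1) :
    conv m m' u u' n = 0 := by
  refine Finset.sum_eq_zero fun a ha => Finset.sum_eq_zero fun b hb => if_neg ?_
  simp only [Finset.mem_range] at ha hb
  omega

theorem coeff_polyOf' (m : ℕ) (u : ℕ → ℤ) (n : ℕ) :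
    (polyOf R m u).coeff n = (conv 1 m (fun _ => 1) u n : ℤ) := by
  rw [← coeff_polyOf_mul]
  simp [polyOf]

theorem coeff_C_mul_polyOf (m : ℕ) (d : ℤ) (u : ℕ → ℤ) (n : ℕ) :
    (C (d : R) * polyOf R m u).coeff n = (conv 1 m (fun _ => d) u n : ℤ) := by
  rw [← coeff_polyOf_mul]
  simp [polyOf]

/-- The `a`-th digit of `u` in base `2 * B + 1`, shifted into the interval `[-B, B]`. -/
def digit (B u a : ℕ) : ℤ := ((u / (2 * B + 1) ^ a % (2 * B + 1) : ℕ) : ℤ) - B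

theorem exists_digit (B m : ℕ) (z : ℕ → ℤ) (hz : ∀ a < m, |z a| ≤ B) :
    ∃ u < (2 * B + 1) ^ m, ∀ a < m, digit B u a = z a := by
  induction m generalizing z with
  | zero => exact ⟨0, by simp, by simp⟩
  | succ m ih =>
    obtain ⟨u, hu, hd⟩ := ih (fun a => z (a + 1)) fun a ha => hz _ (by omega)
    have h0 := abs_le.1 (hz 0 (by omega))
    have hlt : (z 0 + B).toNat < 2 * B + 1 := by omega
    refine ⟨(z 0 + B).toNat + (2 * B + 1) * u, ?_, fun a ha => ?_⟩
    · calc _ < (2 * B + 1) * 1 + (2 * B + 1) * u := by omega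
        _ = (2 * B + 1) * (u + 1) := by ring
        _ ≤ (2 * B + 1) * (2 * B + 1) ^ m := Nat.mul_le_mul_left _ hu
        _ = _ := by ring
    · rcases a with _ | a
      · simp only [digit, pow_zero, Nat.div_one, Nat.add_mul_mod_self_left,
          Nat.mod_eq_of_lt hlt]
        omega
      · rw [← hd a (by omega), digit, digit, pow_succ', ← Nat.div_div_eq_div_mul,
          Nat.add_mul_div_left _ _ (by omega), Nat.div_eq_of_lt hlt, zero_add]

/-- The polynomial with coefficients `g 0, …, g m` is monic of degree `m ≥ 1`, and modulo `c`,
which is zero or a prime, it has no factorization into polynomials of smaller degree. The numbers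
`u` and `u'` run through all candidates for the factors with coefficients bounded by `B`. -/
def IrrCert (c m : ℕ) (g : ℕ → ℤ) : Prop :=
  1 ≤ m ∧ g m = 1 ∧ ∃ B : ℕ,
    ((c = 0 ∧ 2 ^ m * (∑ a ∈ Finset.range (m + 1), ((g a).natAbs : ℤ)).toNat ≤ B) ∨
      (2 ≤ c ∧ c ≤ B ∧ ∀ a < c, ∀ b < c, a * b ≠ c)) ∧
    ∀ u < (2 * B + 1) ^ m, ∀ u' < (2 * B + 1) ^ m, ∃ n < 2 * m,
      ¬ (c : ℤ) ∣ conv m m (digit B u) (digit B u') n - conv 1 (m + 1) (fun _ => 1) g n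

section

variable {α : Type} [Primcodable α]

@[fun_prop]
theorem primrec_conv {m m' n : α → ℕ} {u u' : α → ℕ → ℤ} (hm : Primrec m) (hm' : Primrec m')
    (hu : Primrec fun x : α × ℕ => u x.1 x.2) (hu' : Primrec fun x : α × ℕ => u' x.1 x.2)
    (hn : Primrec n) : Primrec fun a => conv (m a) (m' a) (u a) (u' a) (n a) := by
  unfold conv
  fun_prop

@[fun_prop]
theorem primrec_digit {B u k : α → ℕ} (hB : Primrec B) (hu : Primrec u) (hk : Primrec k) :
    Primrec fun a => digit (B a) (u a) (k a) := by
  unfold digit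
  fun_prop

theorem Semi.irrCert {c m : α → ℕ} {g : α → ℕ → ℤ} (hc : Primrec c)
    (hm : Primrec m) (hg : Primrec fun x : α × ℕ => g x.1 x.2) :
    Semi fun a => IrrCert (c a) (m a) (g a) := by
  unfold IrrCert
  refine and (le (by fun_prop) (by fun_prop)) ?_
  refine and (eq (by fun_prop) (by fun_prop)) ?_
  refine ex ?_
  refine and (or (and (eq (by fun_prop) (by fun_prop)) (le ?_ (by fun_prop))) ?_) ?_
  · fun_prop
  · refine and (le (by fun_prop) (by fun_prop)) ?_
    refine and (le (by fun_prop) (by fun_prop)) ?_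
    refine ball (by fun_prop) ?_
    refine ball (by fun_prop) ?_
    exact ne (by fun_prop) (by fun_prop)
  · refine ball (by fun_prop) ?_
    refine ball (by fun_prop) ?_
    refine bex (by fun_prop) ?_
    exact not_dvd (by fun_prop) (by fun_prop)

end

theorem monic_polyOf {m : ℕ} {g : ℕ → ℤ} (hg : g m = 1) : (polyOf R (m + 1) g).Monic := by
  refine monic_of_degree_le m ?_ ?_
  · exact Order.lt_succ_iff.1 (degree_polyOf_lt (m + 1) g)
  · simp [coeff_polyOf, hg]

theorem natDegree_polyOf [Nontrivial R] {m : ℕ} {g : ℕ → ℤ} (hg : g m = 1) :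
    (polyOf R (m + 1) g).natDegree = m := by
  refine natDegree_eq_of_degree_eq_some (le_antisymm ?_ (le_degree_of_ne_zero ?_))
  · exact Order.lt_succ_iff.1 (degree_polyOf_lt (m + 1) g)
  · simp [coeff_polyOf, hg]

/-- The coefficients of a monic integer factor are bounded in terms of those of the product, by
the bound of Mignotte. -/
theorem abs_coeff_le_of_mul_eq {m : ℕ} {g : ℕ → ℤ} {p q : ℤ[X]} (hp : p.natDegree ≤ m)
    (hq : q.Monic) (h : p * q = polyOf ℤ (m + 1) g) (n : ℕ) :
    |p.coeff n| ≤ 2 ^ m * ∑ a ∈ Finset.range (m + 1), ((g a).natAbs : ℤ) := by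
  let φ := Int.castRingHom ℂ
  have h1 := norm_coeff_le_choose_mul_mahlerMeasure_of_one_le_mahlerMeasure n (p.map φ) (q.map φ)
    (one_le_mahlerMeasure_of_ne_zero hq.ne_zero)
  rw [← Polynomial.map_mul, h] at h1
  have h2 : ((polyOf ℤ (m + 1) g).map φ).mahlerMeasure ≤
      ∑ a ∈ Finset.range (m + 1), ((g a).natAbs : ℝ) := by
    refine (mahlerMeasure_le_sum_norm_coeff _).trans (le_of_eq ?_)
    have hd : ((polyOf ℤ (m + 1) g).map φ).degree < (m + 1 : ℕ) :=
      lt_of_le_of_lt degree_map_le (degree_polyOf_lt _ _)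
    rw [sum_over_range' _ (by simp) (m + 1) ?_]
    · refine Finset.sum_congr rfl fun a ha => ?_
      rw [coeff_map, coeff_polyOf, if_pos (by simpa using ha)]
      simp [φ, Nat.cast_natAbs]
    · by_cases h0 : (polyOf ℤ (m + 1) g).map φ = 0
      · simp [h0]
      · exact (natDegree_lt_iff_degree_lt h0).2 hd
  have h3 : ((p.map φ).natDegree.choose n : ℝ) ≤ 2 ^ m := by
    have : (p.map φ).natDegree.choose n ≤ 2 ^ m :=
      (Nat.choose_le_two_pow _ _).trans
        (Nat.pow_le_pow_right (by norm_num) (natDegree_map_le.trans hp))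
    exact_mod_cast this
  have h4 : ‖(p.map φ).coeff n‖ ≤ 2 ^ m * ∑ a ∈ Finset.range (m + 1), ((g a).natAbs : ℝ) :=
    h1.trans (mul_le_mul h3 h2 (mahlerMeasure_nonneg _) (by positivity))
  rw [coeff_map] at h4
  simp only [φ, eq_intCast, Complex.norm_intCast] at h4
  refine (Int.cast_le (R := ℝ)).1 ?_
  push_cast
  simpa [Nat.cast_natAbs] using h4

variable {c : ℕ} [CharP R c]

theorem eq_iff_dvd (x y : ℤ) : (x : R) = y ↔ (c : ℤ) ∣ x - y := by
  rw [← CharP.intCast_eq_zero_iff R c, Int.cast_sub, sub_eq_zero]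

variable [IsDomain R]

/-- The certificate is sound: the polynomial is irreducible over the domain `ℤ` or `ZMod c`. -/
theorem IrrCert.irreducible (hs : Function.Surjective (Int.cast : ℤ → R)) {m : ℕ} {g : ℕ → ℤ}
    (h : IrrCert c m g) : Irreducible (polyOf R (m + 1) g) := by
  obtain ⟨hm, hg, B, hB, hfac⟩ := h
  have hmon := monic_polyOf (R := R) hg
  have hdeg := natDegree_polyOf (R := R) hg
  rw [hmon.irreducible_iff_natDegree]
  refine ⟨fun h1 => by rw [h1, natDegree_one] at hdeg; omega, fun p q hp hq hpq => ?_⟩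
  by_contra! hne
  have hsum : p.natDegree + q.natDegree = m := by rw [← hp.natDegree_mul hq, hpq, hdeg]
  -- the coefficients of a factor lift to integers that are bounded by `B`
  have hlift : ∀ p q : R[X], p.Monic → q.Monic → p * q = polyOf R (m + 1) g → p.natDegree < m →
      ∃ z : ℕ → ℤ, (∀ a < m, |z a| ≤ B) ∧ ∀ a < m, (z a : R) = p.coeff a := by
    intro p q hp hq hpq hpm
    rcases hB with ⟨rfl, hB⟩ | ⟨hc2, hB, -⟩
    · have : CharZero R := CharP.charP_to_charZero R
      let φ : ℤ ≃+* R := RingEquiv.ofBijective (Int.castRingHom R) ⟨Int.cast_injective, hs⟩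
      let ψ : R →+* ℤ := φ.symm.toRingHom
      have hψ : ∀ z : ℤ, ψ (z : R) = z := fun z => by simp
      have hz : ∀ x : R, ((ψ x : ℤ) : R) = x := fun x => φ.apply_symm_apply x
      refine ⟨fun a => ψ (p.coeff a), fun a _ => ?_, fun a _ => hz _⟩
      have h1 : p.map ψ * q.map ψ = polyOf ℤ (m + 1) g := by
        rw [← Polynomial.map_mul, hpq]
        ext n
        rw [coeff_map, coeff_polyOf, coeff_polyOf]
        split_ifs
        · simp [hψ]
        · simp
      have h2 := abs_coeff_le_of_mul_eq (natDegree_map_le.trans hpm.le) (hq.map ψ) h1 a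
      rw [coeff_map] at h2
      refine h2.trans (le_trans (le_of_eq ?_) (Int.ofNat_le.2 hB))
      push_cast
      rw [Int.toNat_of_nonneg (Finset.sum_nonneg fun _ _ => by positivity)]
    · choose s hs using hs
      refine ⟨fun a => s (p.coeff a) % c, fun a _ => ?_, fun a _ => ?_⟩
      · have h1 := Int.emod_nonneg (s (p.coeff a)) (b := c) (by omega)
        have h2 := Int.emod_lt_of_pos (s (p.coeff a)) (b := c) (by omega)
        rw [abs_of_nonneg h1]
        omega
      · conv_rhs => rw [← hs (p.coeff a)]
        rw [eq_iff_dvd (c := c)]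
        exact Int.dvd_emod_sub_self
  have hpm : p.natDegree < m := by omega
  have hqm : q.natDegree < m := by omega
  obtain ⟨z, hzB, hz⟩ := hlift p q hp hq hpq hpm
  obtain ⟨z', hzB', hz'⟩ := hlift q p hq hp (by rw [mul_comm, hpq]) hqm
  obtain ⟨u, hu, hud⟩ := exists_digit B m z hzB
  obtain ⟨u', hu', hud'⟩ := exists_digit B m z' hzB'
  obtain ⟨n, -, hn⟩ := hfac u hu u' hu'
  refine hn ((eq_iff_dvd (R := R) _ _).1 ?_)
  rw [← coeff_polyOf_mul, ← coeff_polyOf', ← hpq]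
  congr 2
  · exact (eq_polyOf (degree_le_natDegree.trans_lt (by exact_mod_cast hpm)) fun a ha => by
      rw [hud a ha, hz a ha]).symm
  · exact (eq_polyOf (degree_le_natDegree.trans_lt (by exact_mod_cast hqm)) fun a ha => by
      rw [hud' a ha, hz' a ha]).symm

/-- The certificate is complete. -/
theorem IrrCert.of_irreducible {m : ℕ} {g : ℕ → ℤ} (hg : g m = 1)
    (h : Irreducible (polyOf R (m + 1) g)) : IrrCert c m g := by
  have hmon := monic_polyOf (R := R) hg
  have hdeg := natDegree_polyOf (R := R) hg
  have hm : 1 ≤ m := by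
    by_contra hm
    refine h.not_isUnit ?_
    rw [hmon.natDegree_eq_zero.1 (by omega)]
    exact isUnit_one
  refine ⟨hm, hg, max c (2 ^ m * (∑ a ∈ Finset.range (m + 1), ((g a).natAbs : ℤ)).toNat),
    ?_, fun u _ u' _ => ?_⟩
  · rcases CharP.char_is_prime_or_zero R c with hc | hc
    · refine Or.inr ⟨hc.two_le, le_max_left _ _, fun a ha b hb hab => ?_⟩
      rcases (Nat.dvd_prime hc).1 ⟨b, hab.symm⟩ with rfl | rfl
      · omega
      · omega
    · exact Or.inl ⟨hc, le_max_right _ _⟩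
  · by_contra! hcon
    set B := max c (2 ^ m * (∑ a ∈ Finset.range (m + 1), ((g a).natAbs : ℤ)).toNat)
    have hmul : polyOf R m (digit B u) * polyOf R m (digit B u') = polyOf R (m + 1) g := by
      ext n
      rw [coeff_polyOf_mul, coeff_polyOf', eq_iff_dvd (c := c)]
      by_cases hn : n < 2 * m
      · exact hcon n hn
      · rw [conv_eq_zero _ _ (by omega), conv_eq_zero _ _ (by omega), sub_self]
        exact dvd_zero _
    have hne : polyOf R m (digit B u) * polyOf R m (digit B u') ≠ 0 := by
      rw [hmul]; exact hmon.ne_zero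
    have hlt : ∀ u, polyOf R m (digit B u) ≠ 0 → (polyOf R m (digit B u)).natDegree < m :=
      fun u hu => (natDegree_lt_iff_degree_lt hu).2 (degree_polyOf_lt _ _)
    have h1 := hlt u (left_ne_zero_of_mul hne)
    have h2 := hlt u' (right_ne_zero_of_mul hne)
    have h3 := natDegree_mul (left_ne_zero_of_mul hne) (right_ne_zero_of_mul hne)
    rw [hmul, hdeg] at h3
    rcases h.isUnit_or_isUnit hmul.symm with hu | hu
    · rw [natDegree_eq_zero_of_isUnit hu] at h3; omega
    · rw [natDegree_eq_zero_of_isUnit hu] at h3; omega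

end Irreducibility

/-! ### Certificates for homomorphisms to fields -/

section PrimeCertificates

open Polynomial

/-- The elements `y 0, …, y (r - 1)` generate the additive group of the ring `S`, with relations
generated by `w 0, …, w (ρ - 1)`; the vector `v` represents `1` and `t i j` represents
`y i * y j`. -/
structure IsPresented {S : Type*} [CommRing S] (y : ℕ → S) (r ρ : ℕ) (w : ℕ → ℕ → ℤ)
    (v : ℕ → ℤ) (t : ℕ → ℕ → ℕ → ℤ) : Prop where
  gen : ∀ s, ∃ x : ℕ → ℤ, s = ∑ k ∈ Finset.range r, x k • y k
  rel : ∀ x : ℕ → ℤ, ∑ k ∈ Finset.range r, x k • y k = 0 ↔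
    ∃ z : ℕ → ℤ, ∀ k < r, x k = ∑ l ∈ Finset.range ρ, z l * w l k
  one : ∑ k ∈ Finset.range r, v k • y k = 1
  mul : ∀ i < r, ∀ j < r, y i * y j = ∑ k ∈ Finset.range r, t i j k • y k

/-- With `R = ℤ` or `R = ZMod c` and `G = polyOf R (m + 1) g`, the assignment
`y k ↦ D⁻¹ * polyOf R m (h k)` defines a ring homomorphism from the presented ring to the field of
fractions of `R[X] / (G)`. -/
def HomCert (r ρ : ℕ) (w : ℕ → ℕ → ℤ) (v : ℕ → ℤ) (t : ℕ → ℕ → ℕ → ℤ) (c m : ℕ) (g : ℕ → ℤ)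
    (D : ℤ) (h : ℕ → ℕ → ℤ) : Prop :=
  IrrCert c m g ∧ ¬ (c : ℤ) ∣ D ∧
  (∀ a < m, (c : ℤ) ∣ (∑ k ∈ Finset.range r, v k * h k a) - if a = 0 then D else 0) ∧
  (∀ l < ρ, ∀ a < m, (c : ℤ) ∣ ∑ k ∈ Finset.range r, w l k * h k a) ∧
  ∀ i < r, ∀ j < r, ∃ q : List ℤ, ∀ n < 2 * m, (c : ℤ) ∣ conv m m (h i) (h j) n -
    conv 1 m (fun _ => D) (fun a => ∑ k ∈ Finset.range r, t i j k * h k a) n -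
    conv m (m + 1) (fun a => look q a) g n

/-- The vector `x` represents an element that the homomorphism of the certificate maps to the
integer `d`. -/
def MapsTo (r c m : ℕ) (D : ℤ) (h : ℕ → ℕ → ℤ) (x : ℕ → ℤ) (d : ℤ) : Prop :=
  ∀ a < m, (c : ℤ) ∣ (∑ k ∈ Finset.range r, x k * h k a) - if a = 0 then d * D else 0

section

variable {α : Type} [Primcodable α]

theorem Semi.homCert {r ρ c m : α → ℕ} {w : α → ℕ → ℕ → ℤ} {v : α → ℕ → ℤ}
    {t : α → ℕ → ℕ → ℕ → ℤ} {g : α → ℕ → ℤ} {D : α → ℤ} {h : α → ℕ → ℕ → ℤ}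
    (hr : Primrec r) (hρ : Primrec ρ) (hc : Primrec c) (hm : Primrec m)
    (hw : Primrec fun x : α × ℕ × ℕ => w x.1 x.2.1 x.2.2)
    (hv : Primrec fun x : α × ℕ => v x.1 x.2)
    (ht : Primrec fun x : α × ℕ × ℕ × ℕ => t x.1 x.2.1 x.2.2.1 x.2.2.2)
    (hg : Primrec fun x : α × ℕ => g x.1 x.2) (hD : Primrec D)
    (hh : Primrec fun x : α × ℕ × ℕ => h x.1 x.2.1 x.2.2) :
    Semi fun a => HomCert (r a) (ρ a) (w a) (v a) (t a) (c a) (m a) (g a) (D a) (h a) := by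
  unfold HomCert
  refine and (irrCert hc hm hg) ?_
  refine and (not_dvd (by fun_prop) (by fun_prop)) ?_
  refine and ?_ (and ?_ ?_)
  · refine ball (by fun_prop) ?_
    exact dvd (by fun_prop) (by fun_prop)
  · refine ball (by fun_prop) ?_
    refine ball (by fun_prop) ?_
    exact dvd (by fun_prop) (by fun_prop)
  · refine ball (by fun_prop) ?_
    refine ball (by fun_prop) ?_
    refine ex ?_
    refine ball (by fun_prop) ?_
    exact dvd (by fun_prop) (by fun_prop)

theorem Semi.mapsTo {r c m : α → ℕ} {D d : α → ℤ} {h : α → ℕ → ℕ → ℤ} {x : α → ℕ → ℤ}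
    (hr : Primrec r) (hc : Primrec c) (hm : Primrec m) (hD : Primrec D)
    (hh : Primrec fun x : α × ℕ × ℕ => h x.1 x.2.1 x.2.2)
    (hx : Primrec fun y : α × ℕ => x y.1 y.2) (hd : Primrec d) :
    Semi fun a => MapsTo (r a) (c a) (m a) (D a) (h a) (x a) (d a) := by
  unfold MapsTo
  refine ball (by fun_prop) ?_
  exact dvd (by fun_prop) (by fun_prop)

end

variable {S : Type*} [CommRing S] {y : ℕ → S} {r ρ : ℕ} {w : ℕ → ℕ → ℤ} {v : ℕ → ℤ}
  {t : ℕ → ℕ → ℕ → ℤ}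

theorem IsPresented.mul_eq (hS : IsPresented y r ρ w v t) (x x' : ℕ → ℤ) :
    (∑ k ∈ Finset.range r, x k • y k) * (∑ k ∈ Finset.range r, x' k • y k) =
      ∑ k ∈ Finset.range r,
        (∑ i ∈ Finset.range r, ∑ j ∈ Finset.range r, x i * x' j * t i j k) • y k := by
  rw [Finset.sum_mul_sum]
  simp only [Finset.sum_smul]
  rw [Finset.sum_comm' (s := Finset.range r) (t := fun _ => Finset.range r)
    (t' := Finset.range r) (s' := fun _ => Finset.range r) (by simp)]
  rw [Finset.sum_comm]
  conv_rhs => rw [Finset.sum_comm]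
  refine Finset.sum_congr rfl fun i hi => ?_
  conv_rhs => rw [Finset.sum_comm]
  refine Finset.sum_congr rfl fun j hj => ?_
  rw [smul_mul_smul_comm, hS.mul i (by simpa using hi) j (by simpa using hj), Finset.smul_sum]
  simp only [mul_smul]

/-- An element with coordinates `x` is mapped to the class of `∑ₖ x k * polyOf R m (h k)`, divided
by `D`, in the field of fractions of `R[X] / (G)`. Polynomials of degree less than `m` are
determined by their classes, so that `MapsTo` describes the integer values. -/
theorem HomCert.exists_hom_aux {R : Type u} [CommRing R] [IsDomain R] [UniqueFactorizationMonoid R]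
    {c : ℕ} [CharP R c] (hs : Function.Surjective (Int.cast : ℤ → R)) {m : ℕ} {g : ℕ → ℤ} {D : ℤ}
    {h : ℕ → ℕ → ℤ} (hS : IsPresented y r ρ w v t) (H : HomCert r ρ w v t c m g D h) :
    ∃ (K : Type u) (_ : Field K) (ψ : S →+* K), ∀ (x : ℕ → ℤ) (d : ℤ),
      ψ (∑ k ∈ Finset.range r, x k • y k) = d ↔ MapsTo r c m D h x d := by
  obtain ⟨hirr, hD, hone, hrel, hmul⟩ := H
  have hG := hirr.irreducible (R := R) hs
  obtain ⟨hm, hg, -⟩ := hirr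
  set G := polyOf R (m + 1) g with hGdef
  have hmon : G.Monic := monic_polyOf hg
  have hdeg : G.degree = m := by
    rw [degree_eq_natDegree hmon.ne_zero, natDegree_polyOf hg]
  have hprime : Prime G := hG.prime
  have : Fact (Irreducible G) := ⟨hG⟩
  have : IsDomain (AdjoinRoot G) :=
    (Ideal.Quotient.isDomain_iff_prime _).2 ((Ideal.span_singleton_prime hprime.ne_zero).2 hprime)
  let K := FractionRing (AdjoinRoot G)
  let θ : R[X] →+* K := (algebraMap (AdjoinRoot G) K).comp (AdjoinRoot.mk G)
  have hθ : ∀ p : R[X], θ p = 0 ↔ G ∣ p := by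
    intro p
    rw [RingHom.comp_apply, map_eq_zero_iff _ (IsFractionRing.injective (AdjoinRoot G) K),
      AdjoinRoot.mk_eq_zero]
  have hθ' : ∀ p : R[X], p.degree < m → (θ p = 0 ↔ p = 0) := by
    intro p hp
    rw [hθ]
    refine ⟨fun hd => ?_, fun h => h ▸ dvd_zero _⟩
    by_contra hp0
    exact absurd (degree_le_of_dvd hd hp0) (by rw [hdeg]; exact not_le.2 hp)
  -- the numerator of the value at the element with coordinates `x`
  let P : (ℕ → ℤ) → R[X] := fun x =>
    polyOf R m fun a => ∑ k ∈ Finset.range r, x k * h k a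
  have hPadd : ∀ x x', P (x - x') = P x - P x' := by
    intro x x'
    ext n
    simp only [P, coeff_polyOf, coeff_sub]
    split_ifs
    · simp [sub_mul, Finset.sum_sub_distrib]
    · simp
  have hPz : ∀ x, P x = ∑ k ∈ Finset.range r, C (x k : R) * polyOf R m (h k) := by
    intro x
    ext n
    simp only [P, coeff_polyOf, finsetSum_coeff, coeff_C_mul]
    split_ifs <;> simp
  have hDC : ∀ d : ℤ, (C (d : R)).degree < m := fun d =>
    lt_of_le_of_lt degree_C_le (by exact_mod_cast hm)
  have hmaps : ∀ (x : ℕ → ℤ) (d : ℤ), θ (P x) = θ (C ((d * D : ℤ) : R)) ↔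
      MapsTo r c m D h x d := by
    intro x d
    rw [← sub_eq_zero, ← map_sub, hθ' _ (lt_of_le_of_lt (degree_sub_le _ _)
      (max_lt (degree_polyOf_lt _ _) (hDC _))), sub_eq_zero, Polynomial.ext_iff]
    have hcoef : ∀ n, (P x).coeff n = (C ((d * D : ℤ) : R)).coeff n ↔ (n < m →
        (c : ℤ) ∣ (∑ k ∈ Finset.range r, x k * h k n) - if n = 0 then d * D else 0) := by
      intro n
      simp only [P, coeff_polyOf, coeff_C]
      by_cases hn : n < m
      · simp only [hn, if_true, true_imp_iff]
        rw [← eq_iff_dvd (R := R) (c := c)]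
        split_ifs <;> simp
      · have : n ≠ 0 := by omega
        simp [hn, this]
    exact forall_congr' hcoef
  -- the value does not depend on the choice of the coordinates
  have hwell : ∀ x : ℕ → ℤ, ∑ k ∈ Finset.range r, x k • y k = 0 → θ (P x) = 0 := by
    intro x hx
    obtain ⟨z, hz⟩ := (hS.rel x).1 hx
    have := (hmaps x 0).2 fun a ha => by
      simp only [zero_mul, ite_self, sub_zero]
      rw [Finset.sum_congr rfl fun k hk => by rw [hz k (by simpa using hk), Finset.sum_mul],
        Finset.sum_comm]
      refine Finset.dvd_sum fun l hl => ?_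
      simp only [mul_assoc]
      rw [← Finset.mul_sum]
      exact (hrel l (by simpa using hl) a ha).mul_left _
    simpa using this
  choose co hco using hS.gen
  have hf : ∀ x : ℕ → ℤ, θ (P (co (∑ k ∈ Finset.range r, x k • y k))) = θ (P x) := by
    intro x
    rw [← sub_eq_zero, ← map_sub, ← hPadd]
    refine hwell _ ?_
    simp only [Pi.sub_apply, sub_smul, Finset.sum_sub_distrib]
    rw [← hco, sub_self]
  have hD0 : θ (C (D : R)) ≠ 0 := by
    rw [Ne, hθ' _ (hDC D), C_eq_zero, CharP.intCast_eq_zero_iff R c]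
    exact hD
  have hmulP : ∀ i < r, ∀ j < r, θ (polyOf R m (h i)) * θ (polyOf R m (h j)) =
      θ (C (D : R)) * θ (P (t i j)) := by
    intro i hi j hj
    obtain ⟨q, hq⟩ := hmul i hi j hj
    rw [← map_mul, ← map_mul, ← sub_eq_zero, ← map_sub, hθ]
    refine ⟨polyOf R m (fun a => look q a), ?_⟩
    ext n
    rw [mul_comm G, coeff_sub, coeff_polyOf_mul, coeff_C_mul_polyOf, coeff_polyOf_mul,
      ← Int.cast_sub, eq_iff_dvd (c := c)]
    by_cases hn : n < 2 * m
    · exact hq n hn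
    · rw [conv_eq_zero _ _ (by omega), conv_eq_zero _ _ (by omega), conv_eq_zero _ _ (by omega)]
      simp
  refine ⟨K, inferInstance,
    { toFun := fun s => θ (P (co s)) / θ (C (D : R)), map_one' := ?_, map_mul' := ?_,
      map_zero' := ?_, map_add' := ?_ }, fun x d => ?_⟩
  · rw [div_eq_one_iff_eq hD0]
    conv_lhs => rw [← hS.one]
    rw [hf]
    have := (hmaps v 1).2 fun a ha => by simpa using hone a ha
    simpa using this
  · intro s s'
    rw [hco s, hco s', hS.mul_eq]
    rw [hf, hf, hf, div_mul_div_comm, div_eq_div_iff hD0 (mul_ne_zero hD0 hD0)]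
    have key : θ (C (D : R)) * θ (P fun k => ∑ i ∈ Finset.range r, ∑ j ∈ Finset.range r,
        co s i * co s' j * t i j k) = θ (P (co s)) * θ (P (co s')) := by
      rw [hPz (co s), hPz (co s'), map_sum, map_sum, Finset.sum_mul_sum]
      have e1 : (P fun k => ∑ i ∈ Finset.range r, ∑ j ∈ Finset.range r,
          co s i * co s' j * t i j k) = ∑ i ∈ Finset.range r, ∑ j ∈ Finset.range r,
            C ((co s i * co s' j : ℤ) : R) * P (t i j) := by
        simp only [hPz, Finset.mul_sum]
        rw [Finset.sum_congr rfl fun k _ => by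
          rw [Int.cast_sum, map_sum, Finset.sum_mul]]
        rw [Finset.sum_comm]
        refine Finset.sum_congr rfl fun i _ => ?_
        rw [Finset.sum_congr rfl fun k _ => by
          rw [Int.cast_sum, map_sum, Finset.sum_mul]]
        rw [Finset.sum_comm]
        refine Finset.sum_congr rfl fun j _ => Finset.sum_congr rfl fun k _ => ?_
        push_cast
        simp only [C_mul]
        ring
      rw [e1, map_sum, Finset.mul_sum]
      refine Finset.sum_congr rfl fun i hi => ?_
      rw [map_sum, Finset.mul_sum]
      refine Finset.sum_congr rfl fun j hj => ?_
      have := hmulP i (by simpa using hi) j (by simpa using hj)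
      simp only [map_mul, Int.cast_mul]
      linear_combination (-(θ (C (co s i : R)) * θ (C (co s' j : R)))) * this
    linear_combination θ (C (D : R)) * key
  · rw [div_eq_zero_iff]
    exact Or.inl (hwell _ (hco 0).symm)
  · intro s s'
    rw [← add_div]
    congr 1
    rw [← sub_eq_zero, ← map_add, ← map_sub]
    have : P (co (s + s')) - (P (co s) + P (co s')) = P (co (s + s') - co s - co s') := by
      rw [hPadd, hPadd]; ring
    rw [this]
    refine hwell _ ?_
    simp only [Pi.sub_apply, sub_smul, Finset.sum_sub_distrib]
    rw [← hco, ← hco, ← hco]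
    ring
  · change θ (P (co _)) / _ = _ ↔ _
    rw [hf, div_eq_iff hD0, ← hmaps]
    simp

/-- A certificate yields a homomorphism to a field. -/
theorem HomCert.exists_hom {c m : ℕ} {g : ℕ → ℤ} {D : ℤ} {h : ℕ → ℕ → ℤ}
    (hS : IsPresented y r ρ w v t) (H : HomCert r ρ w v t c m g D h) :
    ∃ (K : Type) (_ : Field K) (ψ : S →+* K), ∀ (x : ℕ → ℤ) (d : ℤ),
      ψ (∑ k ∈ Finset.range r, x k • y k) = d ↔ MapsTo r c m D h x d := by
  obtain ⟨-, -, B, hB, -⟩ := H.1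
  rcases hB with ⟨rfl, -⟩ | ⟨hc2, -, hc⟩
  · exact H.exists_hom_aux (R := ℤ) (fun z => ⟨z, rfl⟩) hS
  · have : Fact c.Prime := by
      refine ⟨Nat.prime_def_lt.2 ⟨hc2, fun a ha ⟨b, hb⟩ => ?_⟩⟩
      by_contra ha1
      refine hc a ha b ?_ hb.symm
      have : a ≠ 0 := by rintro rfl; omega
      have hb0 : b ≠ 0 := by rintro rfl; omega
      calc b = 1 * b := (one_mul b).symm
        _ < a * b := Nat.mul_lt_mul_of_pos_right (by omega) (by omega)
        _ = c := hb.symm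
    exact H.exists_hom_aux (R := ZMod c) (ZMod.intCast_surjective) hS

end PrimeCertificates

section PrimeCertificates

open Polynomial

/-- Finitely many integral elements of a field are, up to a common denominator, polynomials in
one integral element: the primitive element theorem without denominators. -/
theorem exists_integral_generator {R F K : Type*} [CommRing R] [IsDomain R] [Field F] [Field K]
    [Algebra R F] [IsFractionRing R F] [Algebra R K] [Algebra F K] [IsScalarTower R F K]
    [PerfectField F] {r : ℕ} (y : ℕ → K) (hy : ∀ k < r, IsIntegral R (y k)) :
    ∃ θ : K, IsIntegral R θ ∧ ∃ D : R, D ≠ 0 ∧ ∃ h : ℕ → R[X], ∀ k < r,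
      aeval θ (h k) = algebraMap R K D * y k := by
  let E : IntermediateField F K := IntermediateField.adjoin F (y '' Set.Iio r)
  have hfd : FiniteDimensional F E := by
    have : Finite (y '' Set.Iio r) := (Set.finite_Iio r).image y
    refine IntermediateField.finiteDimensional_adjoin ?_
    rintro _ ⟨k, hk, rfl⟩
    exact (hy k hk).tower_top
  obtain ⟨α, hα⟩ := Field.exists_primitive_element F E
  have hαF : IsIntegral F α := Algebra.IsIntegral.isIntegral α
  -- scale the primitive element so that it becomes integral over `R`
  have halg : IsAlgebraic R (α : K) := by
    have h1 : IsAlgebraic F (α : K) := (hαF.isAlgebraic).algebraMap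
    exact (IsFractionRing.isAlgebraic_iff R F K).2 h1
  obtain ⟨d, hd, hint⟩ := halg.exists_integral_multiple
  refine ⟨d • (α : K), hint, ?_⟩
  have hdF : algebraMap R F d ≠ 0 := by
    rwa [Ne, map_eq_zero_iff _ (IsFractionRing.injective R F)]
  have hp : ∀ k < r, ∃ p : F[X], aeval (d • (α : K)) p = y k := by
    intro k hk
    have hmem : (⟨y k, IntermediateField.subset_adjoin F _ ⟨k, hk, rfl⟩⟩ : E) ∈
        IntermediateField.adjoin F {α} := by rw [hα]; trivial
    rw [← IntermediateField.mem_toSubalgebra,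
      IntermediateField.adjoin_simple_toSubalgebra_of_isAlgebraic hαF.isAlgebraic,
      Algebra.adjoin_singleton_eq_range_aeval] at hmem
    obtain ⟨p, hp⟩ := hmem
    refine ⟨p.comp (C (algebraMap R F d)⁻¹ * X), ?_⟩
    rw [aeval_comp]
    have : aeval (d • (α : K)) (C (algebraMap R F d)⁻¹ * X) = (α : K) := by
      rw [map_mul, aeval_C, aeval_X, Algebra.smul_def, IsScalarTower.algebraMap_apply R F K,
        ← mul_assoc, ← map_mul, inv_mul_cancel₀ hdF, map_one, one_mul]
    rw [this]
    have h2 := congrArg (algebraMap E K) hp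
    simpa [← aeval_algebraMap_apply] using h2
  have hp' : ∀ k, ∃ p : F[X], k < r → aeval (d • (α : K)) p = y k := by
    intro k
    by_cases hk : k < r
    · obtain ⟨p, hp⟩ := hp k hk
      exact ⟨p, fun _ => hp⟩
    · exact ⟨0, fun h => absurd h hk⟩
  choose p hp using hp'
  -- the denominators of the coefficients of these polynomials are cleared
  have hq : ∀ k, ∃ b : R, b ≠ 0 ∧ ∃ q : R[X], q.map (algebraMap R F) = b • p k := by
    intro k
    obtain ⟨b, hb, h⟩ := IsLocalization.integerNormalization_spec (nonZeroDivisors R) (p k)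
    exact ⟨b, nonZeroDivisors.ne_zero hb, _, h⟩
  choose b hb q hq using hq
  refine ⟨∏ k ∈ Finset.range r, b k, Finset.prod_ne_zero_iff.2 fun k _ => hb k,
    fun k => C (∏ i ∈ (Finset.range r).erase k, b i) * q k, fun k hk => ?_⟩
  rw [map_mul, aeval_C, ← Finset.mul_prod_erase _ _ (Finset.mem_range.2 hk), mul_comm (b k),
    map_mul, mul_assoc]
  congr 1
  rw [← aeval_map_algebraMap F, hq, ← algebraMap_smul F (b k) (p k), map_smul, hp k hk,
    algebraMap_smul, Algebra.smul_def]

variable {S : Type*} [CommRing S] {y : ℕ → S} {r ρ : ℕ} {w : ℕ → ℕ → ℤ} {v : ℕ → ℤ}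
  {t : ℕ → ℕ → ℕ → ℤ}

/-- The values of the generators are, up to a common denominator `D`, polynomials in one integral
element `θ` of the field, whose minimal polynomial is irreducible over the integrally closed ring
`R`. -/
theorem exists_homCert_aux {R F K : Type*} [CommRing R] [IsDomain R] [IsIntegrallyClosed R]
    [Field F] [Field K] [Algebra R F] [IsFractionRing R F] [Algebra R K] [Algebra F K]
    [IsScalarTower R F K] [PerfectField F] {c : ℕ} [CharP R c]
    (hs : Function.Surjective (Int.cast : ℤ → R)) (hS : IsPresented y r ρ w v t) (σ : S →+* K) :
    ∃ (m : ℕ) (g : ℕ → ℤ) (D : ℤ) (h : ℕ → ℕ → ℤ), HomCert r ρ w v t c m g D h ∧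
      ∀ (x : ℕ → ℤ) (d : ℤ), σ (∑ k ∈ Finset.range r, x k • y k) = d ↔ MapsTo r c m D h x d := by
  have hfin : Module.Finite ℤ S := by
    refine Module.Finite.of_surjective (Fintype.linearCombination ℤ fun k : Fin r => y k) ?_
    intro s
    obtain ⟨x, hx⟩ := hS.gen s
    exact ⟨fun k => x k, by rw [hx, Finset.sum_range]; rfl⟩
  have hy : ∀ k < r, IsIntegral R (σ (y k)) := by
    intro k _
    have h1 : IsIntegral ℤ (y k) := Algebra.IsIntegral.isIntegral _
    have h2 : IsIntegral ℤ (σ (y k)) := h1.map (σ : S →+* K).toIntAlgHom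
    exact h2.tower_top
  obtain ⟨θ, hθ, D, hD, p, hp⟩ := exists_integral_generator (F := F) (fun k => σ (y k)) hy
  have hinj : Function.Injective (algebraMap R K) := by
    rw [IsScalarTower.algebraMap_eq R F K]
    exact (algebraMap F K).injective.comp (IsFractionRing.injective R F)
  have : FaithfulSMul R K := (faithfulSMul_iff_algebraMap_injective R K).2 hinj
  have : Module.IsTorsionFree R K := inferInstance
  -- `g` lifts the minimal polynomial of `θ`, and `h k` the numerator of `σ (y k)` reduced modulo it
  set G := minpoly R θ with hG
  have hmon : G.Monic := minpoly.monic hθ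
  have hirr : Irreducible G := minpoly.irreducible hθ
  have hdvd : ∀ p : R[X], aeval θ p = 0 ↔ G ∣ p := fun p =>
    (minpoly.isIntegrallyClosed_dvd_iff hθ p)
  let m := G.natDegree
  have hdegG : G.degree = m := degree_eq_natDegree hmon.ne_zero
  choose lift hlift using hs
  let g : ℕ → ℤ := fun a => if a = m then 1 else lift (G.coeff a)
  have hgm : g m = 1 := by simp [g]
  have hGg : G = polyOf R (m + 1) g := by
    refine eq_polyOf ?_ fun a _ => ?_
    · rw [hdegG]; exact_mod_cast Nat.lt_succ_self m
    · by_cases ha : a = m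
      · simp only [g, ha, if_true, Int.cast_one]
        exact hmon.coeff_natDegree.symm
      · simp [g, ha, hlift]
  let h : ℕ → ℕ → ℤ := fun k a => lift ((p k %ₘ G).coeff a)
  have hmod : ∀ p : R[X], (p %ₘ G).degree < m := fun p => hdegG ▸ degree_modByMonic_lt p hmon
  have hh : ∀ k, polyOf R m (h k) = p k %ₘ G := fun k =>
    (eq_polyOf (hmod _) fun a _ => hlift _).symm
  have hhθ : ∀ k < r, aeval θ (polyOf R m (h k)) = algebraMap R K D * σ (y k) := by
    intro k hk
    rw [hh, ← hp k hk, ← modByMonic_add_div (p k) G, map_add, map_mul, (hdvd G).2 dvd_rfl,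
      zero_mul, add_zero]
    rw [modByMonic_add_div]
  have hm1 : 1 ≤ m := by
    by_contra hm
    refine hirr.not_isUnit ?_
    rw [hmon.natDegree_eq_zero.1 (show G.natDegree = 0 by omega)]
    exact isUnit_one
  have hPz : ∀ x : ℕ → ℤ, (polyOf R m fun a => ∑ k ∈ Finset.range r, x k * h k a) =
      ∑ k ∈ Finset.range r, C (x k : R) * polyOf R m (h k) := by
    intro x
    ext n
    simp only [coeff_polyOf, finsetSum_coeff, coeff_C_mul]
    split_ifs <;> simp
  have hD' : algebraMap R K D ≠ 0 := by rwa [Ne, map_eq_zero_iff _ hinj]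
  have hPθ : ∀ x : ℕ → ℤ, aeval θ (polyOf R m fun a => ∑ k ∈ Finset.range r, x k * h k a) =
      algebraMap R K D * σ (∑ k ∈ Finset.range r, x k • y k) := by
    intro x
    rw [hPz, map_sum, map_sum, Finset.mul_sum]
    refine Finset.sum_congr rfl fun k hk => ?_
    rw [map_mul, aeval_C, hhθ k (by simpa using hk)]
    simp
    ring
  have hmaps : ∀ (x : ℕ → ℤ) (d : ℤ), σ (∑ k ∈ Finset.range r, x k • y k) = d ↔
      MapsTo r c m (lift D) h x d := by
    intro x d
    have h1 : (polyOf R m (fun a => ∑ k ∈ Finset.range r, x k * h k a) -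
        C ((d * lift D : ℤ) : R)).degree < m :=
      lt_of_le_of_lt (degree_sub_le _ _) (max_lt (degree_polyOf_lt _ _)
        (lt_of_le_of_lt degree_C_le (by exact_mod_cast hm1)))
    have h2 : σ (∑ k ∈ Finset.range r, x k • y k) = d ↔
        polyOf R m (fun a => ∑ k ∈ Finset.range r, x k * h k a) = C ((d * lift D : ℤ) : R) := by
      rw [← sub_eq_zero (b := C _)]
      have h3 : polyOf R m (fun a => ∑ k ∈ Finset.range r, x k * h k a) -
          C ((d * lift D : ℤ) : R) = 0 ↔ aeval θ (polyOf R m (fun a =>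
            ∑ k ∈ Finset.range r, x k * h k a) - C ((d * lift D : ℤ) : R)) = 0 := by
        refine ⟨fun h => by rw [h, map_zero], fun h => ?_⟩
        by_contra h0
        exact absurd (degree_le_of_dvd ((hdvd _).1 h) h0) (by rw [hdegG]; exact not_le.2 h1)
      rw [h3, map_sub, hPθ, aeval_C, Int.cast_mul, hlift, map_mul, map_intCast, mul_comm (d : K),
        ← mul_sub, mul_eq_zero, or_iff_right hD', sub_eq_zero]
    rw [h2, Polynomial.ext_iff]
    refine forall_congr' fun n => ?_
    simp only [coeff_polyOf, coeff_C]
    by_cases hn : n < m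
    · simp only [hn, if_true, true_imp_iff]
      rw [← eq_iff_dvd (R := R) (c := c)]
      split_ifs <;> simp
    · have : n ≠ 0 := by omega
      simp [hn, this]
  refine ⟨m, g, lift D, h, ⟨?_, ?_, ?_, ?_, ?_⟩, hmaps⟩
  · exact IrrCert.of_irreducible (R := R) hgm (hGg ▸ hirr)
  · rw [← CharP.intCast_eq_zero_iff R c, hlift]
    exact hD
  · have h1 := (hmaps v 1).1 (by rw [hS.one]; simp)
    intro a ha
    simpa using h1 a ha
  · intro l hl a ha
    have h1 := (hmaps (w l) 0).1 (by
      rw [(hS.rel (w l)).2 ⟨Pi.single l 1, fun k _ => by simp [Pi.single_apply, hl]⟩]; simp)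
    simpa using h1 a ha
  · intro i hi j hj
    let q := (polyOf R m (h i) * polyOf R m (h j) - C D *
      polyOf R m fun a => ∑ k ∈ Finset.range r, t i j k * h k a) /ₘ G
    have hzero : aeval θ (polyOf R m (h i) * polyOf R m (h j) - C D *
        polyOf R m fun a => ∑ k ∈ Finset.range r, t i j k * h k a) = 0 := by
      rw [map_sub, map_mul, map_mul, aeval_C, hhθ i hi, hhθ j hj, hPθ, ← hS.mul i hi j hj, map_mul]
      ring
    have hqG : G * q = polyOf R m (h i) * polyOf R m (h j) - C D *
        polyOf R m fun a => ∑ k ∈ Finset.range r, t i j k * h k a := by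
      have h1 := modByMonic_add_div (polyOf R m (h i) * polyOf R m (h j) - C D *
        polyOf R m fun a => ∑ k ∈ Finset.range r, t i j k * h k a) G
      rwa [(modByMonic_eq_zero_iff_dvd hmon).2 ((hdvd _).1 hzero), zero_add] at h1
    -- the certificate stores only the coefficients of `q` below `m`
    have hqdeg : q.degree < m := by
      by_contra hcon
      have h1 : (G * q).degree = m + q.degree := by rw [hmon.degree_mul_comm, hmon.degree_mul,
        hdegG, add_comm]
      have h2 : ∀ n, 2 * m ≤ n → (G * q).coeff n = 0 := by
        intro n hn
        have hDl : C D = C ((lift D : ℤ) : R) := by rw [hlift]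
        rw [hqG, hDl, coeff_sub, coeff_polyOf_mul, coeff_C_mul_polyOf, conv_eq_zero _ _ (by omega),
          conv_eq_zero _ _ (by omega)]
        simp
      have h3 : (G * q).degree < (2 * m : ℕ) := (degree_lt_iff_coeff_zero _ _).2 h2
      rw [h1] at h3
      have h4 : ((2 * m : ℕ) : WithBot ℕ) ≤ m + q.degree := by
        rw [two_mul, Nat.cast_add]
        exact add_le_add le_rfl (not_lt.1 hcon)
      exact absurd h3 (not_lt.2 h4)
    obtain ⟨qq, hqq⟩ := exists_look₁ m fun a => lift (q.coeff a)
    have hqpoly : q = polyOf R m fun a => look qq a :=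
      eq_polyOf hqdeg fun a ha => by rw [hqq a ha, hlift]
    refine ⟨qq, fun n _ => ?_⟩
    rw [← eq_iff_dvd (R := R), Int.cast_sub, ← coeff_polyOf_mul, ← coeff_C_mul_polyOf,
      ← coeff_polyOf_mul, ← coeff_sub, ← hGg, ← hqpoly, hlift, ← hqG, mul_comm]

/-- Every homomorphism to a field is described by a certificate. -/
theorem exists_homCert (hS : IsPresented y r ρ w v t) {K : Type*} [Field K] (σ : S →+* K) :
    ∃ (c m : ℕ) (g : ℕ → ℤ) (D : ℤ) (h : ℕ → ℕ → ℤ), HomCert r ρ w v t c m g D h ∧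
      ∀ (x : ℕ → ℤ) (d : ℤ), σ (∑ k ∈ Finset.range r, x k • y k) = d ↔ MapsTo r c m D h x d := by
  obtain ⟨c, hc⟩ := CharP.exists K
  refine ⟨c, ?_⟩
  rcases CharP.char_is_prime_or_zero K c with hp | rfl
  · have : Fact c.Prime := ⟨hp⟩
    let _ : Algebra (ZMod c) K := ZMod.algebra K c
    exact exists_homCert_aux (R := ZMod c) (F := ZMod c) ZMod.intCast_surjective hS σ
  · have : CharZero K := CharP.charP_to_charZero K
    exact exists_homCert_aux (R := ℤ) (F := ℚ) (fun z => ⟨z, rfl⟩) hS σ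

end PrimeCertificates

/-! ### Complete sets of primitive idempotents -/

section Idempotents

variable {S : Type*} [CommRing S]

/-- Below a primitive idempotent `e` there are no idempotents other than `0` and `e`. -/
theorem IsPrimitiveIdempotent.mul_eq {e f : S} (he : IsPrimitiveIdempotent e)
    (hf : IsIdempotentElem f) : f * e = 0 ∨ f * e = e := by
  have h1 : IsIdempotentElem (f * e) := hf.mul he.1
  have h2 : IsIdempotentElem ((1 - f) * e) := hf.one_sub.mul he.1
  rcases he.2.2 _ _ h1 h2 (by
      have := hf.eq
      linear_combination (-e * e) * this) (by ring) with h | h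
  · exact Or.inl h
  · exact Or.inr (by linear_combination -h)

/-- An idempotent is determined by the minimal primes that contain it: the difference of two
idempotents that lie in the same minimal primes is nilpotent. -/
theorem finite_idempotents [IsNoetherianRing S] : {e : S | IsIdempotentElem e}.Finite := by
  have hfin := minimalPrimes.finite_of_isNoetherianRing S
  refine Set.Finite.of_finite_image (f := fun e => {P : Ideal S | P ∈ minimalPrimes S ∧ e ∈ P})
    (hfin.finite_subsets.subset ?_) ?_
  · rintro _ ⟨e, -, rfl⟩ P hP
    exact hP.1
  · intro e he f hf hef
    refine eq_of_isNilpotent_sub_of_isIdempotentElem_of_commute he hf ?_ (Commute.all e f)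
    rw [← mem_nilradical, nilradical, ← Ideal.sInf_minimalPrimes, Ideal.mem_sInf]
    intro P hP
    have hPp : P.IsPrime := hP.1.1
    have hiff : e ∈ P ↔ f ∈ P := by
      have := Set.ext_iff.1 hef P
      exact ⟨fun h => (this.1 ⟨hP, h⟩).2, fun h => (this.2 ⟨hP, h⟩).2⟩
    have hor : ∀ g : S, IsIdempotentElem g → g ∈ P ∨ 1 - g ∈ P := fun g hg =>
      hPp.mem_or_mem (by rw [mul_sub, mul_one, hg.eq, sub_self]; exact P.zero_mem)
    by_cases heP : e ∈ P
    · exact P.sub_mem heP (hiff.1 heP)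
    · have h1 := (hor e he).resolve_left heP
      have h2 := (hor f hf).resolve_left fun h => heP (hiff.2 h)
      have : e - f = (1 - f) - (1 - e) := by ring
      rw [this]
      exact P.sub_mem h2 h1

/-- A Noetherian commutative ring has a complete set of primitive idempotents: the idempotents
form a finite Boolean algebra, and the primitive ones are its atoms. -/
theorem exists_isCompletePrimitive [IsNoetherianRing S] :
    ∃ (k : ℕ) (e : Fin k → S), IsCompletePrimitive e := by
  classical
  have hfin : {e : S | IsPrimitiveIdempotent e}.Finite := finite_idempotents.subset fun e he => he.1
  let E := hfin.toFinset
  have hE : ∀ e, e ∈ E ↔ IsPrimitiveIdempotent e := by simp [E]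
  have horth : ∀ e ∈ E, ∀ f ∈ E, e ≠ f → e * f = 0 := by
    intro e he f hf hne
    rcases ((hE f).1 hf).mul_eq ((hE e).1 he).1 with h | h
    · exact h
    · rcases ((hE e).1 he).mul_eq ((hE f).1 hf).1 with h' | h'
      · rw [mul_comm]; exact h'
      · exact absurd (by rw [← h', mul_comm, h]) hne
  -- every non-zero idempotent lies above a primitive one
  have hbelow : ∀ u : S, IsIdempotentElem u → u ≠ 0 → ∃ e ∈ E, u * e = e := by
    intro u hu hu0
    let X := {f : S | IsIdempotentElem f ∧ f ≠ 0 ∧ u * f = f}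
    have hX : X.Finite := finite_idempotents.subset fun f hf => hf.1
    -- a non-zero idempotent below `u` with as few idempotents below it as possible
    obtain ⟨f, hf, hmin⟩ := hX.exists_minimalFor (fun f => {g ∈ X | f * g = g}.ncard) X
      ⟨u, hu, hu0, hu.eq⟩
    refine ⟨f, (hE f).2 ⟨hf.1, hf.2.1, fun e' e'' he' he'' h0 hsum => ?_⟩, hf.2.2⟩
    by_contra! hne
    have hfe : f * e' = e' := by rw [hsum, add_mul, he'.eq, mul_comm e'', h0, add_zero]
    have he'X : e' ∈ X := ⟨he', hne.1, by rw [← hfe, ← mul_assoc, hf.2.2]⟩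
    have hss : {g ∈ X | e' * g = g} ⊂ {g ∈ X | f * g = g} := by
      refine ⟨fun g hg => ⟨hg.1, by rw [← hg.2, ← mul_assoc, hfe]⟩, fun hcon => ?_⟩
      have hff : e' * f = f := (hcon ⟨hf, hf.1.eq⟩).2
      refine hne.2 ?_
      have : e' = f := by rw [← hfe, mul_comm, hff]
      rw [this] at hsum
      simpa using hsum
    exact absurd (hmin he'X (Set.ncard_le_ncard hss.1 (hX.subset fun _ h => h.1)))
      (not_le.2 (Set.ncard_lt_ncard hss (hX.subset fun _ h => h.1)))
  refine ⟨E.card, fun i => (E.equivFin.symm i : S), ⟨⟨⟨fun i => ?_, fun i j hij => ?_⟩, ?_⟩,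
    fun i => (hE _).1 (E.equivFin.symm i).2⟩⟩
  · exact ((hE _).1 (E.equivFin.symm i).2).1
  · refine horth _ (E.equivFin.symm i).2 _ (E.equivFin.symm j).2 fun h => hij ?_
    exact E.equivFin.symm.injective (Subtype.ext h)
  · have hsum : ∑ i, (E.equivFin.symm i : S) = ∑ e ∈ E, e := by
      rw [← Finset.sum_coe_sort E (fun e => e)]
      exact Equiv.sum_comp E.equivFin.symm (fun e : E => (e : S))
    rw [hsum]
    have hmul : ∀ e ∈ E, (∑ f ∈ E, f) * e = e := by
      intro e he
      rw [Finset.sum_mul, Finset.sum_eq_single e (fun f hf hne => horth f hf e he hne)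
        (fun h => absurd he h), ((hE e).1 he).1.eq]
    have hid : IsIdempotentElem (∑ f ∈ E, f) := by
      change _ * _ = _
      rw [Finset.mul_sum]
      exact Finset.sum_congr rfl hmul
    by_contra hne
    obtain ⟨e, he, h⟩ := hbelow _ hid.one_sub (sub_ne_zero.2 (Ne.symm hne))
    rw [sub_mul, one_mul, hmul e he, sub_self] at h
    exact ((hE e).1 he).2.1 h.symm

end Idempotents

/-! ### Certificates for unsolvability of integer congruences -/

section Fredholm

/-- An integer vector outside a subgroup is separated from it by a linear form modulo some
integer. -/
theorem exists_separating_form {X : Type*} [Fintype X] (W : AddSubgroup (X → ℤ)) (τ : X → ℤ)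
    (hτ : τ ∉ W) : ∃ (q : ℤ) (Λ : X → ℤ), (∀ u ∈ W, q ∣ ∑ x, Λ x * u x) ∧ ¬ q ∣ ∑ x, Λ x * τ x := by
  classical
  have h0 : (QuotientAddGroup.mk τ : (X → ℤ) ⧸ W) ≠ 0 := by
    rwa [Ne, QuotientAddGroup.eq_zero_iff]
  obtain ⟨χ, hχ⟩ := CharacterModule.exists_character_apply_ne_zero_of_ne_zero h0
  -- a character with values in `ℚ / ℤ` is the reduction of a rational linear form
  let φ : (X → ℤ) →+ AddCircle (1 : ℚ) :=
    (show ((X → ℤ) ⧸ W) →+ AddCircle (1 : ℚ) from χ).comp (QuotientAddGroup.mk' W)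
  have hsurj : ∀ x, ∃ s : ℚ, (s : AddCircle (1 : ℚ)) = φ (Pi.single x 1) := fun x =>
    QuotientAddGroup.mk_surjective _
  choose s hs using hsurj
  obtain ⟨D, hD, z, hz⟩ := exists_common_denominator s
  have hφ : ∀ u : X → ℤ, φ u = ((∑ x, u x • s x : ℚ) : AddCircle (1 : ℚ)) := by
    intro u
    conv_lhs => rw [← Finset.univ_sum_single u]
    rw [map_sum]
    have : ((∑ x, u x • s x : ℚ) : AddCircle (1 : ℚ)) =
        ∑ x, ((u x • s x : ℚ) : AddCircle (1 : ℚ)) :=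
      map_sum (QuotientAddGroup.mk' (AddSubgroup.zmultiples (1 : ℚ))) _ _
    rw [this]
    refine Finset.sum_congr rfl fun x _ => ?_
    rw [AddCircle.coe_zsmul, hs, ← map_zsmul, ← Pi.single_smul', smul_eq_mul, mul_one]
  have hiff : ∀ u : X → ℤ, φ u = 0 ↔ D ∣ ∑ x, z x * u x := by
    intro u
    rw [hφ, AddCircle.coe_eq_zero_iff]
    have hDq : (D : ℚ) ≠ 0 := by exact_mod_cast hD
    have hsum : ((∑ x, z x * u x : ℤ) : ℚ) = D * ∑ x, u x • s x := by
      push_cast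
      rw [Finset.mul_sum]
      refine Finset.sum_congr rfl fun x _ => ?_
      rw [hz, zsmul_eq_mul]
      ring
    constructor
    · rintro ⟨n, hn⟩
      refine ⟨n, ?_⟩
      have : ((∑ x, z x * u x : ℤ) : ℚ) = ((D * n : ℤ) : ℚ) := by
        rw [hsum, ← hn]; simp
      exact_mod_cast this
    · rintro ⟨n, hn⟩
      refine ⟨n, ?_⟩
      rw [hn] at hsum
      push_cast at hsum
      have := mul_left_cancel₀ hDq hsum
      simpa using this
  refine ⟨D, z, fun u hu => (hiff u).1 ?_, fun h => hχ ((hiff τ).2 h)⟩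
  change χ (QuotientAddGroup.mk u) = 0
  rw [(QuotientAddGroup.eq_zero_iff u).2 hu, map_zero]

/-- A linear form modulo `q` that shows that the homomorphisms with the data `c j`, `m j`, `D j`,
`h j` do not take the integer values `β j` simultaneously. -/
def SepCert (r J : ℕ) (c m : ℕ → ℕ) (D : ℕ → ℤ) (h : ℕ → ℕ → ℕ → ℤ) (β : ℕ → ℤ) : Prop :=
  ∃ (q : ℤ) (Λ : List ℤ),
    (∀ k < r, q ∣ ∑ j ∈ Finset.range J, ∑ a ∈ Finset.range (m j), look Λ (j, a) * h j k a) ∧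
    (∀ j < J, ∀ a < m j, q ∣ look Λ (j, a) * (c j : ℤ)) ∧
    ¬ q ∣ ∑ j ∈ Finset.range J, ∑ a ∈ Finset.range (m j),
      look Λ (j, a) * (if a = 0 then β j * D j else 0)

/-- An element with the prescribed values excludes a separating linear form. -/
theorem not_sepCert {r J : ℕ} {c m : ℕ → ℕ} {D : ℕ → ℤ} {h : ℕ → ℕ → ℕ → ℤ} {β : ℕ → ℤ}
    (x : ℕ → ℤ) (hx : ∀ j < J, MapsTo r (c j) (m j) (D j) (h j) x (β j)) :
    ¬ SepCert r J c m D h β := by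
  rintro ⟨q, Λ, h1, h2, h3⟩
  refine h3 ?_
  have h4 : q ∣ ∑ j ∈ Finset.range J, ∑ a ∈ Finset.range (m j),
      look Λ (j, a) * ∑ k ∈ Finset.range r, x k * h j k a := by
    have : ∑ j ∈ Finset.range J, ∑ a ∈ Finset.range (m j),
        look Λ (j, a) * ∑ k ∈ Finset.range r, x k * h j k a =
        ∑ k ∈ Finset.range r, x k *
          ∑ j ∈ Finset.range J, ∑ a ∈ Finset.range (m j), look Λ (j, a) * h j k a := by
      simp only [Finset.mul_sum]
      rw [Finset.sum_comm (s := Finset.range r)]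
      refine Finset.sum_congr rfl fun j _ => ?_
      rw [Finset.sum_comm (s := Finset.range r)]
      exact Finset.sum_congr rfl fun _ _ => Finset.sum_congr rfl fun _ _ => by ring
    rw [this]
    exact Finset.dvd_sum fun k hk => (h1 k (by simpa using hk)).mul_left _
  refine (dvd_sub_right h4).1 ?_
  simp only [← Finset.sum_sub_distrib, ← mul_sub]
  refine Finset.dvd_sum fun j hj => Finset.dvd_sum fun a ha => ?_
  obtain ⟨z, hz⟩ := hx j (by simpa using hj) a (by simpa using ha)
  rw [hz, ← mul_assoc]
  exact (h2 j (by simpa using hj) a (by simpa using ha)).mul_right _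

/-- Values that no element has are excluded by a linear form that separates them from the subgroup
generated by the values of the generators and by the multiples of the characteristics. -/
theorem exists_sepCert {r J : ℕ} {c m : ℕ → ℕ} {D : ℕ → ℤ} {h : ℕ → ℕ → ℕ → ℤ} {β : ℕ → ℤ}
    (hx : ¬ ∃ x : ℕ → ℤ, ∀ j < J, MapsTo r (c j) (m j) (D j) (h j) x (β j)) :
    SepCert r J c m D h β := by
  classical
  let X := Σ j : Fin J, Fin (m j)
  let τ : X → ℤ := fun p => if (p.2 : ℕ) = 0 then β p.1 * D p.1 else 0
  let G : (Fin r → ℤ) × (X → ℤ) →+ (X → ℤ) := AddMonoidHom.mk'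
    (fun z p => ∑ k : Fin r, z.1 k * h p.1 k p.2 + z.2 p * c p.1) (by
      intro z z'
      funext p
      simp only [Prod.fst_add, Prod.snd_add, Pi.add_apply, add_mul, Finset.sum_add_distrib]
      ring)
  have hτ : τ ∉ G.range := by
    rintro ⟨z, hz⟩
    refine hx ⟨extend z.1, fun j hj a ha => ?_⟩
    have h1 := congrFun hz ⟨⟨j, hj⟩, ⟨a, ha⟩⟩
    simp only [G, AddMonoidHom.mk'_apply, τ] at h1
    rw [Finset.sum_range, ← h1]
    refine ⟨- z.2 ⟨⟨j, hj⟩, ⟨a, ha⟩⟩, ?_⟩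
    simp only [extend_coe]
    ring
  obtain ⟨q, L, hL, hLτ⟩ := exists_separating_form _ _ hτ
  have hM : ∀ j < J, m j ≤ ∑ j ∈ Finset.range J, m j := fun j hj =>
    Finset.single_le_sum (f := m) (fun _ _ => Nat.zero_le _) (by simpa using hj)
  obtain ⟨Λ, hΛ⟩ := exists_look₂ J (∑ j ∈ Finset.range J, m j) fun j a =>
    if hj : j < J then if ha : a < m j then L ⟨⟨j, hj⟩, ⟨a, ha⟩⟩ else 0 else 0
  have hΛ' : ∀ p : X, look Λ ((p.1 : ℕ), (p.2 : ℕ)) = L p := by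
    intro p
    rw [hΛ p.1 p.1.2 p.2 (lt_of_lt_of_le p.2.2 (hM p.1 p.1.2))]
    simp
  have hsum : ∀ F : ℕ → ℕ → ℤ, ∑ j ∈ Finset.range J, ∑ a ∈ Finset.range (m j),
      look Λ (j, a) * F j a = ∑ p : X, L p * F p.1 p.2 := by
    intro F
    rw [Fintype.sum_sigma, Finset.sum_range]
    refine Finset.sum_congr rfl fun j _ => ?_
    rw [Finset.sum_range]
    exact Finset.sum_congr rfl fun a _ => by rw [← hΛ' ⟨j, a⟩]
  refine ⟨q, Λ, fun k hk => ?_, fun j hj a ha => ?_, ?_⟩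
  · rw [hsum fun j a => h j k a]
    have := hL _ ⟨(Pi.single ⟨k, hk⟩ 1, 0), rfl⟩
    simpa [G, Pi.single_apply] using this
  · let p₀ : X := ⟨⟨j, hj⟩, ⟨a, ha⟩⟩
    have := hL _ ⟨(0, Pi.single p₀ 1), rfl⟩
    rw [Fintype.sum_eq_single p₀ fun p hp => by simp [G, hp]] at this
    rw [hΛ' p₀]
    simpa [G] using this
  · rw [hsum fun j a => if a = 0 then β j * D j else 0]
    exact hLτ

theorem Semi.sepCert {α : Type} [Primcodable α] {r J : α → ℕ} {c m : α → ℕ → ℕ} {D : α → ℕ → ℤ}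
    {h : α → ℕ → ℕ → ℕ → ℤ} {β : α → ℕ → ℤ} (hr : Primrec r) (hJ : Primrec J)
    (hc : Primrec fun x : α × ℕ => c x.1 x.2) (hm : Primrec fun x : α × ℕ => m x.1 x.2)
    (hD : Primrec fun x : α × ℕ => D x.1 x.2)
    (hh : Primrec fun x : α × ℕ × ℕ × ℕ => h x.1 x.2.1 x.2.2.1 x.2.2.2)
    (hβ : Primrec fun x : α × ℕ => β x.1 x.2) :
    Semi fun a => SepCert (r a) (J a) (c a) (m a) (D a) (h a) (β a) := by
  unfold SepCert
  refine ex ?_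
  refine ex ?_
  refine and ?_ (and ?_ ?_)
  · refine ball (by fun_prop) ?_
    exact dvd (by fun_prop) (by fun_prop)
  · refine ball (by fun_prop) ?_
    refine ball (by fun_prop) ?_
    exact dvd (by fun_prop) (by fun_prop)
  · exact not_dvd (by fun_prop) (by fun_prop)

end Fredholm

/-! ### Certificates for complete sets of primitive idempotents -/

section IdempotentCertificates

/-- The vector `x` is an integer combination of the relations `w 0, …, w (ρ - 1)`. -/
def IsRel (r ρ : ℕ) (w : ℕ → ℕ → ℤ) (x : ℕ → ℤ) : Prop :=
  ∃ z : List ℤ, ∀ k < r, x k = ∑ l ∈ Finset.range ρ, look z l * w l k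

/-- The element represented by `x` is nilpotent: the rows of the array `q` are the coordinates of
the result of repeated squaring, and the last one represents zero. -/
def NilCert (r ρ : ℕ) (w : ℕ → ℕ → ℤ) (t : ℕ → ℕ → ℕ → ℤ) (x : ℕ → ℤ) : Prop :=
  ∃ (s : ℕ) (q : List ℤ), (∀ k < r, look q (0, k) = x k) ∧
    (∀ u < s, IsRel r ρ w fun k => (∑ i ∈ Finset.range r, ∑ j ∈ Finset.range r,
      look q (u, i) * look q (u, j) * t i j k) - look q (u + 1, k)) ∧
    IsRel r ρ w fun k => look q (s, k)

/-- The `j`-th binary digit of `b`. -/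
def bit (b j : ℕ) : ℕ := b / 2 ^ j % 2

theorem exists_bit (m : ℕ) (z : ℕ → ℕ) (hz : ∀ j < m, z j < 2) :
    ∃ b < 2 ^ m, ∀ j < m, bit b j = z j := by
  induction m generalizing z with
  | zero => exact ⟨0, by simp, by simp⟩
  | succ m ih =>
    obtain ⟨u, hu, hd⟩ := ih (fun a => z (a + 1)) fun a ha => hz _ (by omega)
    have h0 := hz 0 (by omega)
    refine ⟨z 0 + 2 * u, by rw [pow_succ']; omega, fun a ha => ?_⟩
    rcases a with _ | a
    · simp only [bit, pow_zero, Nat.div_one, Nat.add_mul_mod_self_left, Nat.mod_eq_of_lt h0]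
    · rw [← hd a (by omega), bit, bit, pow_succ', ← Nat.div_div_eq_div_mul,
        Nat.add_mul_div_left _ _ (by omega), Nat.div_eq_of_lt h0, zero_add]

/-- The vectors `e 0, …, e (ℓ - 1)` represent a complete set of primitive idempotents. Besides the
identities that make them orthogonal idempotents with sum `1` there are homomorphisms to fields,
`J` in number, the `j`-th of which maps the idempotent with index `comp j`, and no other, to `1`.
Their common kernel is spanned by nilpotent elements, and a vector of zeros and ones that is not
constant on some fibre of `comp` is not the vector of values of an element of the ring. -/
def IdemCert (r ρ : ℕ) (w : ℕ → ℕ → ℤ) (v : ℕ → ℤ) (t : ℕ → ℕ → ℕ → ℤ) (ℓ : ℕ)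
    (e : ℕ → ℕ → ℤ) : Prop :=
  (∀ i < ℓ, ∀ j < ℓ, IsRel r ρ w fun k => (∑ a ∈ Finset.range r, ∑ b ∈ Finset.range r,
    e i a * e j b * t a b k) - if i = j then e i k else 0) ∧
  (IsRel r ρ w fun k => (∑ i ∈ Finset.range ℓ, e i k) - v k) ∧
  ∃ (J : ℕ) (c m comp g D h : List ℤ),
    (∀ j < J, HomCert r ρ w v t (look c j).toNat (look m j).toNat (fun a => look g (j, a))
      (look D j) fun k a => look h (j, k, a)) ∧
    (∀ j < J, ∀ i < ℓ, MapsTo r (look c j).toNat (look m j).toNat (look D j)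
      (fun k a => look h (j, k, a)) (e i) (if i = (look comp j).toNat then 1 else 0)) ∧
    (∀ i < ℓ, ∃ j < J, (look comp j).toNat = i) ∧
    (∀ b < 2 ^ J,
      (∀ j < J, ∀ j' < J, (look comp j).toNat ≠ (look comp j').toNat ∨ bit b j = bit b j') ∨
      SepCert r J (fun j => (look c j).toNat) (fun j => (look m j).toNat) (fun j => look D j)
        (fun j k a => look h (j, k, a)) fun j => (bit b j : ℤ)) ∧
    ∃ (T : ℕ) (ν : List ℤ),
      Spanned r J (fun j => (look m j).toNat) (fun j => (look m j).toNat)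
        (fun j a k => look h (j, k, a)) (fun j l a => if l = a then ((look c j).toNat : ℤ) else 0) T
        (fun i k => look ν (i, k)) ∧
      ∀ i < T, NilCert r ρ w t fun k => look ν (i, k)

section

variable {α : Type} [Primcodable α] {r ρ : α → ℕ} {w : α → ℕ → ℕ → ℤ}

theorem Semi.isRel {x : α → ℕ → ℤ} (hr : Primrec r) (hρ : Primrec ρ)
    (hw : Primrec fun x : α × ℕ × ℕ => w x.1 x.2.1 x.2.2)
    (hx : Primrec fun y : α × ℕ => x y.1 y.2) :
    Semi fun a => IsRel (r a) (ρ a) (w a) (x a) := by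
  unfold IsRel
  refine ex ?_
  refine ball (by fun_prop) ?_
  exact eq (by fun_prop) (by fun_prop)

theorem Semi.nilCert {t : α → ℕ → ℕ → ℕ → ℤ} {x : α → ℕ → ℤ} (hr : Primrec r) (hρ : Primrec ρ)
    (hw : Primrec fun x : α × ℕ × ℕ => w x.1 x.2.1 x.2.2)
    (ht : Primrec fun x : α × ℕ × ℕ × ℕ => t x.1 x.2.1 x.2.2.1 x.2.2.2)
    (hx : Primrec fun y : α × ℕ => x y.1 y.2) :
    Semi fun a => NilCert (r a) (ρ a) (w a) (t a) (x a) := by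
  unfold NilCert
  refine ex ?_
  refine ex ?_
  refine and ?_ (and ?_ ?_)
  · refine ball (by fun_prop) ?_
    exact eq (by fun_prop) (by fun_prop)
  · refine ball (by fun_prop) ?_
    exact isRel (by fun_prop) (by fun_prop) (by fun_prop) (by fun_prop)
  · exact isRel (by fun_prop) (by fun_prop) (by fun_prop) (by fun_prop)

@[fun_prop]
theorem primrec_bit {b j : α → ℕ} (hb : Primrec b) (hj : Primrec j) :
    Primrec fun a => bit (b a) (j a) := by
  unfold bit
  fun_prop

theorem Semi.idemCert {v : α → ℕ → ℤ} {t : α → ℕ → ℕ → ℕ → ℤ} {ℓ : α → ℕ} {e : α → ℕ → ℕ → ℤ}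
    (hr : Primrec r) (hρ : Primrec ρ)
    (hw : Primrec fun x : α × ℕ × ℕ => w x.1 x.2.1 x.2.2)
    (hv : Primrec fun x : α × ℕ => v x.1 x.2)
    (ht : Primrec fun x : α × ℕ × ℕ × ℕ => t x.1 x.2.1 x.2.2.1 x.2.2.2)
    (hℓ : Primrec ℓ) (he : Primrec fun x : α × ℕ × ℕ => e x.1 x.2.1 x.2.2) :
    Semi fun a => IdemCert (r a) (ρ a) (w a) (v a) (t a) (ℓ a) (e a) := by
  unfold IdemCert
  refine and ?_ (and ?_ ?_)
  · refine ball (by fun_prop) ?_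
    refine ball (by fun_prop) ?_
    exact isRel (by fun_prop) (by fun_prop) (by fun_prop) (by fun_prop)
  · exact isRel (by fun_prop) (by fun_prop) (by fun_prop) (by fun_prop)
  refine ex ?_
  refine ex ?_
  refine ex ?_
  refine ex ?_
  refine ex ?_
  refine ex ?_
  refine ex ?_
  refine and ?_ (and ?_ (and ?_ (and ?_ ?_)))
  · refine ball (by fun_prop) ?_
    exact homCert (by fun_prop) (by fun_prop) (by fun_prop) (by fun_prop) (by fun_prop)
      (by fun_prop) (by fun_prop) (by fun_prop) (by fun_prop) (by fun_prop)
  · refine ball (by fun_prop) ?_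
    refine ball (by fun_prop) ?_
    exact mapsTo (by fun_prop) (by fun_prop) (by fun_prop) (by fun_prop) (by fun_prop)
      (by fun_prop) (by fun_prop)
  · refine ball (by fun_prop) ?_
    refine bex (by fun_prop) ?_
    exact eq (by fun_prop) (by fun_prop)
  · refine ball (by fun_prop) (or ?_ ?_)
    · refine ball (by fun_prop) ?_
      refine ball (by fun_prop) ?_
      exact or (ne (by fun_prop) (by fun_prop)) (eq (by fun_prop) (by fun_prop))
    · exact sepCert (by fun_prop) (by fun_prop) (by fun_prop) (by fun_prop) (by fun_prop)
        (by fun_prop) (by fun_prop)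
  · refine ex ?_
    refine ex ?_
    refine and ?_ ?_
    · exact spanned (by fun_prop) (by fun_prop) (by fun_prop) (by fun_prop) (by fun_prop)
        (by fun_prop) (by fun_prop) (by fun_prop)
    · refine ball (by fun_prop) ?_
      exact nilCert (by fun_prop) (by fun_prop) (by fun_prop) (by fun_prop) (by fun_prop)

end

theorem conv_congr {m m' : ℕ} {u u' z z' : ℕ → ℤ} (h : ∀ a < m, u a = z a)
    (h' : ∀ a < m', u' a = z' a) : conv m m' u u' = conv m m' z z' := by
  funext n
  refine Finset.sum_congr rfl fun a ha => Finset.sum_congr rfl fun b hb => ?_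
  rw [h a (by simpa using ha), h' b (by simpa using hb)]

theorem IrrCert.congr {c m : ℕ} {g g' : ℕ → ℤ} (H : IrrCert c m g)
    (hg : ∀ a < m + 1, g a = g' a) : IrrCert c m g' := by
  unfold IrrCert at H ⊢
  rw [← conv_congr (fun _ _ => rfl) hg, ← hg m (by omega), ← Finset.sum_congr rfl fun a ha =>
    congrArg (fun z : ℤ => (z.natAbs : ℤ)) (hg a (by simpa using ha))]
  exact H

theorem HomCert.congr {r ρ : ℕ} {w : ℕ → ℕ → ℤ} {v : ℕ → ℤ} {t : ℕ → ℕ → ℕ → ℤ} {c m : ℕ}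
    {g g' : ℕ → ℤ} {D : ℤ} {h h' : ℕ → ℕ → ℤ} (H : HomCert r ρ w v t c m g D h)
    (hg : ∀ a < m + 1, g a = g' a) (hh : ∀ k < r, ∀ a < m, h k a = h' k a) :
    HomCert r ρ w v t c m g' D h' := by
  have hsum : ∀ (x : ℕ → ℤ), ∀ a < m, ∑ k ∈ Finset.range r, x k * h' k a =
      ∑ k ∈ Finset.range r, x k * h k a := fun x a ha =>
    Finset.sum_congr rfl fun k hk => by rw [hh k (by simpa using hk) a ha]
  obtain ⟨H1, H2, H3, H4, H5⟩ := H
  refine ⟨H1.congr hg, H2, fun a ha => ?_, fun l hl a ha => ?_, fun i hi j hj => ?_⟩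
  · rw [hsum _ a ha]
    exact H3 a ha
  · rw [hsum _ a ha]
    exact H4 l hl a ha
  · obtain ⟨q, hq⟩ := H5 i hi j hj
    refine ⟨q, ?_⟩
    rw [← conv_congr (hh i hi) (hh j hj), ← conv_congr (fun _ _ => rfl) hg,
      conv_congr (fun _ _ => rfl) (hsum (t i j))]
    exact hq

theorem MapsTo.congr {r c m : ℕ} {D : ℤ} {h h' : ℕ → ℕ → ℤ}
    (hh : ∀ k < r, ∀ a < m, h k a = h' k a) (x : ℕ → ℤ) (d : ℤ) :
    MapsTo r c m D h x d ↔ MapsTo r c m D h' x d := by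
  refine forall_congr' fun a => forall_congr' fun ha => ?_
  rw [Finset.sum_congr rfl fun k hk => by rw [hh k (by simpa using hk) a ha]]

variable {S : Type*} [CommRing S] {y : ℕ → S} {r ρ : ℕ} {w : ℕ → ℕ → ℤ} {v : ℕ → ℤ}
  {t : ℕ → ℕ → ℕ → ℤ}

theorem isRel_iff_exists (r ρ : ℕ) (w : ℕ → ℕ → ℤ) (x : ℕ → ℤ) : IsRel r ρ w x ↔
    ∃ z : ℕ → ℤ, ∀ k < r, x k = ∑ l ∈ Finset.range ρ, z l * w l k := by
  refine ⟨fun ⟨z, hz⟩ => ⟨_, hz⟩, fun ⟨z, hz⟩ => ?_⟩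
  obtain ⟨z', hz'⟩ := exists_look₁ ρ z
  refine ⟨z', fun k hk => ?_⟩
  rw [hz k hk]
  exact Finset.sum_congr rfl fun l hl => by rw [hz' l (by simpa using hl)]

theorem IsPresented.isRel_iff (hS : IsPresented y r ρ w v t) (x : ℕ → ℤ) :
    IsRel r ρ w x ↔ ∑ k ∈ Finset.range r, x k • y k = 0 := by
  rw [hS.rel, isRel_iff_exists]

theorem IsPresented.isRel_mul_sub_iff (hS : IsPresented y r ρ w v t) (x x' x'' : ℕ → ℤ) :
    (IsRel r ρ w fun k => (∑ i ∈ Finset.range r, ∑ j ∈ Finset.range r,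
      x i * x' j * t i j k) - x'' k) ↔
    (∑ k ∈ Finset.range r, x k • y k) * (∑ k ∈ Finset.range r, x' k • y k) =
      ∑ k ∈ Finset.range r, x'' k • y k := by
  rw [hS.isRel_iff, hS.mul_eq, ← sub_eq_zero (b := ∑ k ∈ Finset.range r, x'' k • y k),
    ← Finset.sum_sub_distrib]
  simp only [sub_smul]

theorem IsPresented.nilCert_iff (hS : IsPresented y r ρ w v t) (x : ℕ → ℤ) :
    NilCert r ρ w t x ↔ IsNilpotent (∑ k ∈ Finset.range r, x k • y k) := by
  constructor
  · rintro ⟨s, q, h0, hq, hs⟩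
    refine ⟨2 ^ s, ?_⟩
    rw [hS.isRel_iff] at hs
    rw [← hs]
    have : ∀ u ≤ s, (∑ k ∈ Finset.range r, x k • y k) ^ 2 ^ u =
        ∑ k ∈ Finset.range r, look q (u, k) • y k := by
      intro u
      induction u with
      | zero =>
        intro _
        rw [pow_zero, pow_one]
        exact Finset.sum_congr rfl fun k hk => by rw [h0 k (by simpa using hk)]
      | succ u ih =>
        intro hu
        have := (hS.isRel_mul_sub_iff _ _ _).1 (hq u hu)
        rw [pow_succ, pow_mul, ih (by omega), sq, this]
    exact this s le_rfl
  · rintro ⟨n, hn⟩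
    choose X hX using fun u => hS.gen ((∑ k ∈ Finset.range r, x k • y k) ^ 2 ^ u)
    obtain ⟨q, hq⟩ := exists_look₂ (n + 1) r fun u k => if u = 0 then x k else X u k
    have hq' : ∀ u < n + 1, (∑ k ∈ Finset.range r, x k • y k) ^ 2 ^ u =
        ∑ k ∈ Finset.range r, look q (u, k) • y k := by
      intro u hu
      have : ∑ k ∈ Finset.range r, look q (u, k) • y k =
          ∑ k ∈ Finset.range r, (if u = 0 then x k else X u k) • y k :=
        Finset.sum_congr rfl fun k hk => by rw [hq u hu k (by simpa using hk)]
      rw [this]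
      rcases u with _ | u
      · simp
      · simpa using hX (u + 1)
    refine ⟨n, q, fun k hk => by simp [hq 0 (by omega) k hk], fun u hu => ?_, ?_⟩
    · rw [hS.isRel_mul_sub_iff, ← hq' u (by omega), ← hq' (u + 1) (by omega), ← sq, ← pow_mul,
        pow_succ]
    · rw [hS.isRel_iff, ← hq' n (by omega)]
      exact pow_eq_zero_of_le Nat.lt_two_pow_self.le hn

theorem IsPresented.isNoetherianRing (hS : IsPresented y r ρ w v t) : IsNoetherianRing S := by
  classical
  have : Module.Finite ℤ S := by
    refine ⟨⟨(Finset.range r).image y, ?_⟩⟩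
    rw [eq_top_iff]
    intro s _
    obtain ⟨x, rfl⟩ := hS.gen s
    exact Submodule.sum_mem _ fun k hk => Submodule.smul_mem _ _
      (Submodule.subset_span (by simpa using ⟨k, by simpa using hk, rfl⟩))
  exact isNoetherian_of_tower ℤ inferInstance

/-- The homomorphisms take the values `0` and `1` at an idempotent. Below the idempotent with index
`i` these values vanish off the fibre of `comp` over `i` and are constant on it. So either this
idempotent or its complement in the one with index `i` vanishes under all homomorphisms; it is
nilpotent, hence zero. -/
theorem IdemCert.isCompletePrimitive (hS : IsPresented y r ρ w v t) {ℓ : ℕ} {e : ℕ → ℕ → ℤ}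
    (H : IdemCert r ρ w v t ℓ e) :
    IsCompletePrimitive fun i : Fin ℓ => ∑ k ∈ Finset.range r, e i k • y k := by
  obtain ⟨h1, h2, J, c, m, comp, g, D, h, h3, h4, h5, h6, T, ν, h7, h8⟩ := H
  simp only [hS.nilCert_iff] at h8
  set E : Fin ℓ → S := fun i => ∑ k ∈ Finset.range r, e i k • y k with hE
  have hmul : ∀ i j, E i * E j = if i = j then E i else 0 := by
    intro i j
    have := (hS.isRel_mul_sub_iff _ _ _).1 (h1 i i.2 j j.2)
    rw [hE, this]
    by_cases hij : i = j
    · simp [hij]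
    · simp [hij, Fin.val_ne_of_ne hij]
  have hone : ∑ i, E i = 1 := by
    rw [hS.isRel_iff] at h2
    rw [← hS.one, ← sub_eq_zero, ← h2, Finset.sum_comm, ← Finset.sum_sub_distrib]
    refine Finset.sum_congr rfl fun k _ => ?_
    rw [sub_smul, Finset.sum_range, Finset.sum_smul]
  have hidem : ∀ i, IsIdempotentElem (E i) := fun i => (hmul i i).trans (if_pos rfl)
  have hψ' := fun j : Fin J => (h3 j j.2).exists_hom hS
  choose K hK ψ hψ using hψ'
  -- the common kernel of the homomorphisms consists of nilpotent elements
  have hnil : ∀ s : S, (∀ j, ψ j s = 0) → IsNilpotent s := by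
    intro s hs
    obtain ⟨x, rfl⟩ := hS.gen s
    obtain ⟨n, hn⟩ := h7 x fun j hj => by
      have := (hψ ⟨j, hj⟩ x 0).1 (by simpa using hs ⟨j, hj⟩)
      have hz : ∀ a, ∃ z : ℤ, a < (look m j).toNat → ∑ k ∈ Finset.range r,
          look h (j, k, a) * x k = z * ((look c j).toNat : ℤ) := by
        intro a
        by_cases ha : a < (look m j).toNat
        · obtain ⟨z, hz⟩ := this a ha
          refine ⟨z, fun _ => ?_⟩
          rw [mul_comm z, ← hz]
          simp [mul_comm]
        · exact ⟨0, fun h => absurd h ha⟩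
      choose z hz using hz
      refine ⟨z, fun a ha => ?_⟩
      rw [hz a ha]
      simp [ha]
    rw [← mem_nilradical]
    have : ∑ k ∈ Finset.range r, x k • y k =
        ∑ i ∈ Finset.range T, n i • ∑ k ∈ Finset.range r, look ν (i, k) • y k := by
      simp only [Finset.smul_sum]
      rw [Finset.sum_comm]
      refine Finset.sum_congr rfl fun k hk => ?_
      rw [hn k (by simpa using hk), Finset.sum_smul]
      simp only [mul_smul]
    rw [this]
    exact Ideal.sum_mem _ fun i hi => zsmul_mem (mem_nilradical.2 (h8 i (by simpa using hi))) _
  have hzero : ∀ s : S, IsIdempotentElem s → (∀ j, ψ j s = 0) → s = 0 := fun s hs hj =>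
    eq_of_isNilpotent_sub_of_isIdempotentElem_of_commute hs .zero (by simpa using hnil s hj)
      (Commute.zero_right s)
  have hval : ∀ (j : Fin J) (i : Fin ℓ),
      ψ j (E i) = if (i : ℕ) = (look comp (j : ℕ)).toNat then 1 else 0 := by
    intro j i
    have := (hψ j (e i) _).2 (h4 j j.2 i i.2)
    rw [hE, this]
    split_ifs <;> simp
  refine ⟨⟨⟨hidem, fun i j hij => (hmul i j).trans (if_neg hij)⟩, hone⟩, fun i => ⟨hidem i, ?_, ?_⟩⟩
  · intro h0
    obtain ⟨j, hj, hji⟩ := h5 i i.2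
    have := hval ⟨j, hj⟩ i
    simp [hji, h0] at this
  intro e' e'' he' he'' hort hsum
  have hbit : ∀ j, ∃ z : ℕ, z < 2 ∧ ψ j e' = (z : ℤ) := by
    intro j
    rcases IsIdempotentElem.iff_eq_zero_or_one.1 (he'.map (ψ j)) with h | h
    · exact ⟨0, by simp [h]⟩
    · exact ⟨1, by simp [h]⟩
  choose z hz hzψ using hbit
  obtain ⟨b, hb, hbz⟩ := exists_bit J (fun j => if hj : j < J then z ⟨j, hj⟩ else 0)
    fun j hj => by simp [hj, hz]
  replace hbz : ∀ j : Fin J, bit b j = z j := fun j => by simp [hbz j j.2]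
  obtain ⟨x, hx⟩ := hS.gen e'
  -- the values of `e'` are those of an element, so no linear form excludes them
  have hconst := (h6 b hb).resolve_right <| not_sepCert x fun j hj => by
    rw [← hψ ⟨j, hj⟩, ← hx, hzψ, hbz ⟨j, hj⟩]
  obtain ⟨j₀, hj₀, hji⟩ := h5 i i.2
  have h0 : ∀ j : Fin J, (look comp (j : ℕ)).toNat ≠ i → ψ j e' = 0 ∧ ψ j e'' = 0 := by
    intro j hj
    have h := hval j i
    rw [if_neg (Ne.symm hj)] at h
    have h1 : e' = e' * E i := by rw [hsum, mul_add, hort, he'.eq, add_zero]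
    have h2 : e'' = e'' * E i := by rw [hsum, mul_add, mul_comm e'' e', hort, he''.eq, zero_add]
    rw [h1, h2, map_mul, map_mul, h, mul_zero, mul_zero]
    exact ⟨rfl, rfl⟩
  have hcon : ∀ j : Fin J, (look comp (j : ℕ)).toNat = i → z j = z ⟨j₀, hj₀⟩ := by
    intro j hj
    rw [← hbz, ← hbz]
    exact (hconst j j.2 j₀ hj₀).resolve_left fun h => h (hj.trans hji.symm)
  -- the constant value of `e'` on the fibre decides which of the two parts vanishes
  have hlt := hz ⟨j₀, hj₀⟩
  interval_cases hz0 : z ⟨j₀, hj₀⟩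
  · refine Or.inl (hzero e' he' fun j => ?_)
    by_cases hj : (look comp (j : ℕ)).toNat = i
    · rw [hzψ, hcon j hj]; simp
    · exact (h0 j hj).1
  · refine Or.inr (hzero e'' he'' fun j => ?_)
    by_cases hj : (look comp (j : ℕ)).toNat = i
    · have h := hval j i
      rw [if_pos hj.symm, hsum, map_add, hzψ, hcon j hj] at h
      simpa using h
    · exact (h0 j hj).2

/-- The homomorphisms of the certificate are the residue maps at the minimal primes, whose
intersection is the nilradical. An element with values `0` and `1` at all of them is idempotent
modulo the nilradical, hence lifts to an idempotent, which is a sum of primitive ones; so the values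
are constant on the fibres of `comp`. -/
theorem IdemCert.of_isCompletePrimitive (hS : IsPresented y r ρ w v t) {ℓ : ℕ} {e : ℕ → ℕ → ℤ}
    (H : IsCompletePrimitive fun i : Fin ℓ => ∑ k ∈ Finset.range r, e i k • y k) :
    IdemCert r ρ w v t ℓ e := by
  classical
  have := hS.isNoetherianRing
  set E : Fin ℓ → S := fun i => ∑ k ∈ Finset.range r, e i k • y k with hE
  obtain ⟨hE1, hE2⟩ := H
  -- the minimal primes
  have hfin := minimalPrimes.finite_of_isNoetherianRing S
  obtain ⟨J, ⟨φ⟩⟩ := Finite.exists_equiv_fin (minimalPrimes S) (h := hfin)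
  let P : Fin J → Ideal S := fun j => (φ.symm j).1
  have hP : ∀ j, (P j).IsPrime := fun j => (φ.symm j).2.1.1
  have hnil : ∀ s, (∀ j, s ∈ P j) → IsNilpotent s := by
    intro s hs
    rw [← mem_nilradical, nilradical, ← Ideal.sInf_minimalPrimes, Ideal.mem_sInf]
    intro Q hQ
    simpa [P] using hs (φ ⟨Q, hQ⟩)
  have hnil' : ∀ s, IsNilpotent s → ∀ j, s ∈ P j := fun s ⟨n, hn⟩ j =>
    (hP j).mem_of_pow_mem n (hn ▸ (P j).zero_mem)
  have hcert : ∀ j : Fin J, ∃ (c m : ℕ) (g : ℕ → ℤ) (D : ℤ) (h : ℕ → ℕ → ℤ),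
      HomCert r ρ w v t c m g D h ∧ ∀ (x : ℕ → ℤ) (d : ℤ),
        (∑ k ∈ Finset.range r, x k • y k) - d ∈ P j ↔ MapsTo r c m D h x d := by
    intro j
    have := hP j
    obtain ⟨c, m, g, D, h, h1, h2⟩ := exists_homCert hS
      ((algebraMap (S ⧸ P j) (FractionRing (S ⧸ P j))).comp (Ideal.Quotient.mk (P j)))
    refine ⟨c, m, g, D, h, h1, fun x d => ?_⟩
    rw [← h2, ← sub_eq_zero, ← map_intCast ((algebraMap (S ⧸ P j) (FractionRing (S ⧸ P j))).comp
      (Ideal.Quotient.mk (P j))) d, ← map_sub, RingHom.comp_apply,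
      map_eq_zero_iff _ (IsFractionRing.injective (S ⧸ P j) _), Ideal.Quotient.eq_zero_iff_mem]
  choose c₀ m₀ g₀ D₀ h₀ hcert₀ using hcert
  -- the component of a minimal prime
  have hcomp : ∀ j, ∃ i : Fin ℓ, ∀ i', E i' - (if i' = i then 1 else 0) ∈ P j := by
    intro j
    have := hP j
    obtain ⟨i, hi⟩ : ∃ i, E i ∉ P j := by
      by_contra! hall
      refine (hP j).one_notMem ?_
      rw [← hE1.complete]
      exact Ideal.sum_mem _ fun i _ => hall i
    refine ⟨i, fun i' => ?_⟩
    split_ifs with h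
    · subst h
      refine ((hP j).mem_or_mem (x := E i') ?_).resolve_left hi
      rw [mul_sub, mul_one, (hE1.idem i').eq, sub_self]
      exact (P j).zero_mem
    · rw [sub_zero]
      refine ((hP j).mem_or_mem (x := E i) ?_).resolve_left hi
      have := hE1.ortho (Ne.symm h)
      simp only at this
      rw [this]
      exact (P j).zero_mem
  choose comp₀ hcomp₀ using hcomp
  -- an idempotent that lies in all minimal primes is zero
  have hsurj : ∀ i, ∃ j, comp₀ j = i := by
    intro i
    by_contra! hne
    refine (hE2 i).2.1 (eq_of_isNilpotent_sub_of_isIdempotentElem_of_commute (hE1.idem i) .zero ?_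
      (Commute.zero_right _))
    rw [sub_zero]
    refine hnil _ fun j => ?_
    simpa [Ne.symm (hne j)] using hcomp₀ j i
  -- values `0` and `1` of an element are those of an idempotent `e'`
  have hbits : ∀ z : Fin J → ℕ, (∀ j, z j < 2) →
      (∃ s : S, ∀ j, s - (z j : ℤ) ∈ P j) → ∀ j j', comp₀ j = comp₀ j' → z j = z j' := by
    rintro z hz ⟨s, hs⟩ j j' hjj
    have hsq : (s ^ 2 - s) ∈ nilradical S := by
      refine hnil _ fun j => ?_
      have hP2 : ((z j : ℤ) : S) ^ 2 = (z j : ℤ) := by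
        have := hz j
        interval_cases z j <;> simp
      have : s ^ 2 - s = (s - (z j : ℤ)) * (s + (z j : ℤ) - 1) := by
        linear_combination hP2
      rw [this]
      exact (P j).mul_mem_right _ (hs j)
    obtain ⟨e', he', hes⟩ := exists_isIdempotentElem_eq_of_ker_isNilpotent
      (Ideal.Quotient.mk (nilradical S))
      (fun x hx => by rwa [Ideal.mk_ker] at hx) (Ideal.Quotient.mk (nilradical S) s) ⟨s, rfl⟩ (by
        rw [IsIdempotentElem, ← map_mul, ← sub_eq_zero, ← map_sub, ← sq]
        exact Ideal.Quotient.eq_zero_iff_mem.2 hsq)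
    have hz' : ∀ j, e' - (z j : ℤ) ∈ P j := fun j => by
      have := (P j).add_mem (hnil' _ (Ideal.Quotient.eq.1 hes) j) (hs j)
      simpa using this
    have hval : ∀ j (q : ℕ), q < 2 → e' * E (comp₀ j) = q * E (comp₀ j) → z j = q := by
      intro j q hq hmul
      have h1 : E (comp₀ j) - 1 ∈ P j := by simpa using hcomp₀ j (comp₀ j)
      have h2 : ((z j : ℤ) : S) - q ∈ P j := by
        have : ((z j : ℤ) : S) - q = (q - e') * (E (comp₀ j) - 1) - (e' - (z j : ℤ)) := by
          linear_combination hmul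
        rw [this]
        exact (P j).sub_mem ((P j).mul_mem_left _ h1) (hz' j)
      have := hz j
      by_contra hne
      refine (hP j).one_notMem ?_
      interval_cases z j <;> interval_cases q
      · exact absurd rfl hne
      · simpa using (P j).neg_mem h2
      · simpa using h2
      · exact absurd rfl hne
    rcases (hE2 (comp₀ j)).mul_eq he' with h | h
    · rw [hval j 0 (by omega) (by simp [h]), hval j' 0 (by omega) (by simp [← hjj, h])]
    · rw [hval j 1 (by omega) (by simp [h]), hval j' 1 (by omega) (by simp [← hjj, h])]
  -- the arrays
  obtain ⟨c, hc⟩ := exists_look₁ J (extend fun j => (c₀ j : ℤ))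
  obtain ⟨m, hm⟩ := exists_look₁ J (extend fun j => (m₀ j : ℤ))
  obtain ⟨comp, hcm⟩ := exists_look₁ J (extend fun j => ((comp₀ j : ℕ) : ℤ))
  obtain ⟨D, hD⟩ := exists_look₁ J (extend D₀)
  obtain ⟨L, hL⟩ : ∃ L, ∀ j, m₀ j ≤ L :=
    ⟨∑ j, m₀ j, fun j => Finset.single_le_sum (fun _ _ => Nat.zero_le _) (Finset.mem_univ j)⟩
  obtain ⟨g, hg⟩ := exists_look₂ J (L + 1) fun j a => extend (fun j => g₀ j a) j
  obtain ⟨h, hh⟩ := exists_look₃ J r L fun j k a => extend (fun j => h₀ j k a) j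
  replace hc : ∀ j : Fin J, look c (j : ℕ) = c₀ j := fun j => by rw [hc j j.2, extend_coe]
  replace hm : ∀ j : Fin J, look m (j : ℕ) = m₀ j := fun j => by rw [hm j j.2, extend_coe]
  replace hcm : ∀ j : Fin J, look comp (j : ℕ) = (comp₀ j : ℕ) := fun j => by
    rw [hcm j j.2, extend_coe]
  replace hD : ∀ j : Fin J, look D (j : ℕ) = D₀ j := fun j => by rw [hD j j.2, extend_coe]
  have hh' : ∀ j : Fin J, ∀ k < r, ∀ a < m₀ j, h₀ j k a = look h ((j : ℕ), k, a) :=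
    fun j k hk a ha => by rw [hh j j.2 k hk a (lt_of_lt_of_le ha (hL j)), extend_coe]
  have hmaps : ∀ (j : Fin J) (x : ℕ → ℤ) (d : ℤ),
      (∑ k ∈ Finset.range r, x k • y k) - d ∈ P j ↔ MapsTo r (look c (j : ℕ)).toNat
        (look m (j : ℕ)).toNat (look D (j : ℕ)) (fun k a => look h ((j : ℕ), k, a)) x d := by
    intro j x d
    rw [(hcert₀ j).2, MapsTo.congr (hh' j), hc, hm, hD, Int.toNat_natCast, Int.toNat_natCast]
  refine ⟨fun i hi j hj => ?_, ?_, J, c, m, comp, g, D, h, fun j hj => ?_, fun j hj i hi => ?_,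
    fun i hi => ?_, fun b hb => ?_, ?_⟩
  · rw [hS.isRel_mul_sub_iff]
    by_cases hij : i = j
    · subst hij
      simpa [hE] using (hE1.idem ⟨i, hi⟩).eq
    · have := hE1.ortho (i := ⟨i, hi⟩) (j := ⟨j, hj⟩) (by simpa using hij)
      simpa [hij, hE] using this
  · rw [hS.isRel_iff]
    have := hE1.complete
    simp only [sub_smul, Finset.sum_sub_distrib, hS.one, Finset.sum_smul]
    rw [Finset.sum_comm, Finset.sum_range, sub_eq_zero]
    exact this
  · lift j to Fin J using hj
    rw [hc, hm, hD, Int.toNat_natCast, Int.toNat_natCast]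
    refine (hcert₀ j).1.congr (fun a ha => ?_) (hh' j)
    rw [hg j j.2 a (by have := hL j; omega), extend_coe]
  · lift j to Fin J using hj
    lift i to Fin ℓ using hi
    rw [← hmaps, hcm, Int.toNat_natCast]
    have := hcomp₀ j i
    simp only [Fin.ext_iff] at this
    split_ifs at this ⊢ <;> simpa [hE] using this
  · obtain ⟨j, hj⟩ := hsurj ⟨i, hi⟩
    exact ⟨j, j.2, by rw [hcm, hj]; simp⟩
  · by_cases hsep : ∃ x : ℕ → ℤ, ∀ j < J, MapsTo r (look c j).toNat (look m j).toNat (look D j)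
        (fun k a => look h (j, k, a)) x (bit b j)
    · left
      obtain ⟨x, hx⟩ := hsep
      intro j hj j' hj'
      lift j to Fin J using hj
      lift j' to Fin J using hj'
      rw [hcm, hcm, Int.toNat_natCast, Int.toNat_natCast, ← imp_iff_not_or, Fin.val_inj]
      exact hbits (fun j => bit b j) (fun j => Nat.mod_lt _ two_pos)
        ⟨_, fun j => (hmaps j x _).2 (hx j j.2)⟩ j j'
    · exact Or.inr (exists_sepCert hsep)
  -- the coordinate vectors of nilpotent elements form a finitely generated group
  · let N : Submodule ℤ (Fin r → ℤ) :=
      { carrier := {x | ∑ k, x k • y k ∈ nilradical S}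
        zero_mem' := by simp
        add_mem' := fun {a b} ha hb => by
          simp only [Set.mem_ofPred_eq, Pi.add_apply, add_smul, Finset.sum_add_distrib] at *
          exact add_mem ha hb
        smul_mem' := fun z a ha => by
          simp only [Set.mem_ofPred_eq, Pi.smul_apply, smul_assoc, ← Finset.smul_sum] at *
          exact zsmul_mem ha z }
    obtain ⟨T, s, hs⟩ := Submodule.fg_iff_exists_fin_generating_family.1
      (IsNoetherian.noetherian N)
    obtain ⟨ν, hν⟩ := exists_look₂ T r fun i k => extend (fun i => extend (s i) k) i
    replace hν : ∀ (i : Fin T) (k : Fin r), look ν ((i : ℕ), (k : ℕ)) = s i k := fun i k => by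
      rw [hν i i.2 k k.2, extend_coe, extend_coe]
    refine ⟨T, ν, fun x hx => ?_, fun i hi => ?_⟩
    · have hxN : (fun k : Fin r => x k) ∈ N := by
        change ∑ k : Fin r, x k • y k ∈ nilradical S
        rw [← Finset.sum_range (fun k => x k • y k)]
        refine hnil _ fun j => ?_
        have := (hmaps j x 0).2 fun a ha => by
          obtain ⟨z, hz⟩ := hx j j.2
          have := hz a ha
          rw [Finset.sum_congr rfl fun k _ => mul_comm _ _, this]
          simp [ha]
        simpa using this
      rw [← hs, Submodule.mem_span_range_iff_exists_fun] at hxN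
      obtain ⟨n, hn⟩ := hxN
      refine ⟨extend n, fun u hu => ?_⟩
      have := congrFun hn ⟨u, hu⟩
      simp only [Finset.sum_apply, Pi.smul_apply, smul_eq_mul] at this
      rw [← this, Finset.sum_range]
      exact Finset.sum_congr rfl fun i _ => by rw [extend_coe, ← hν i ⟨u, hu⟩]
    · rw [hS.nilCert_iff]
      have : s ⟨i, hi⟩ ∈ N := hs ▸ Submodule.subset_span ⟨_, rfl⟩
      rw [Finset.sum_range]
      simp only [hν ⟨i, hi⟩]
      exact this

end IdempotentCertificates

/-! ### Connected components of the spectrum and primitive idempotents -/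

section ConnectedComponents

open PrimeSpectrum

variable {P : Type*} [CommRing P] {J : Ideal P}

/-- A preconnected set of primes containing `J` does not distinguish `x` from `1` or from `0`, if
`x` is idempotent modulo `J`. -/
theorem preconnected_zeroLocus {C : Set (PrimeSpectrum P)} (hC : IsPreconnected C)
    (hCJ : C ⊆ zeroLocus (J : Set P)) {x : P} (hx : x * (1 - x) ∈ J) :
    (∀ p ∈ C, x ∈ p.asIdeal) ∨ ∀ p ∈ C, 1 - x ∈ p.asIdeal := by
  have := isPreconnected_iff_subset_of_disjoint_closed.1 hC (zeroLocus {x}) (zeroLocus {1 - x})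
    (isClosed_zeroLocus _) (isClosed_zeroLocus _) (fun p hp => by
      have := p.isPrime.mem_or_mem (hCJ hp hx)
      simpa [mem_zeroLocus] using this) (by
      rw [Set.eq_empty_iff_forall_notMem]
      rintro p ⟨-, h1, h2⟩
      simp only [mem_zeroLocus, Set.singleton_subset_iff, SetLike.mem_coe] at h1 h2
      exact p.isPrime.one_notMem (by simpa using add_mem h1 h2))
  simpa [Set.subset_def, mem_zeroLocus] using this

theorem isIdempotentElem_mk_iff {x : P} :
    IsIdempotentElem (Ideal.Quotient.mk J x) ↔ x * (1 - x) ∈ J := by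
  rw [IsIdempotentElem, ← map_mul, eq_comm, Ideal.Quotient.eq, mul_sub, mul_one]

/-- A polynomial that is idempotent modulo `J` and lies in the radicals of all primary components
lies in `J`. If it is below `q i`, it lies in the radicals outside the `i`-th group, while on the
`i`-th connected component it is constantly `0` or constantly `1`; hence it is `0` or `q i`. -/
theorem IsIdempotentStep.isCompletePrimitive {ν : ℕ} {q : Fin ν → P} (H : IsIdempotentStep J q) :
    IsCompletePrimitive fun i => Ideal.Quotient.mk J (q i) := by
  obtain ⟨k, Q, pt, c, hQ, hJ, hpt, hc, hcomp, hq⟩ := H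
  have hmem : ∀ x, x ∈ J ↔ ∀ a, x ∈ Q a := fun x => by rw [hJ, Ideal.mem_iInf]
  have hprimary : ∀ a {x y : P}, x * y ∈ Q a → x ∈ Q a ∨ y ∈ (Q a).radical := fun a =>
    (Ideal.isPrimary_iff.1 (hQ a)).2
  have hJpt : ∀ a, pt a ∈ zeroLocus (J : Set P) := fun a x hx => by
    rw [hpt]
    exact Ideal.le_radical ((hmem x).1 hx a)
  have hnil : ∀ x : P, IsIdempotentElem (Ideal.Quotient.mk J x) → (∀ a, x ∈ (pt a).asIdeal) →
      Ideal.Quotient.mk J x = 0 := by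
    intro x hx hxa
    rw [Ideal.Quotient.eq_zero_iff_mem, hmem]
    intro a
    have h1 : x * (1 - x) ∈ Q a := (hmem _).1 (isIdempotentElem_mk_iff.1 hx) a
    rcases hprimary a h1 with h | h
    · exact h
    · refine absurd ?_ (pt a).isPrime.one_notMem
      rw [← hpt] at h
      simpa using add_mem (hxa a) h
  have hortho : ∀ i j, i ≠ j → q i * q j ∈ J := by
    intro i j hij
    rw [hmem]
    intro a
    by_cases ha : c a = i
    · exact Ideal.mul_mem_left _ _ ((hq j).1 a (ha ▸ hij))
    · exact Ideal.mul_mem_right _ _ ((hq i).1 a ha)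
  have hE : CompleteOrthogonalIdempotents fun i => Ideal.Quotient.mk J (q i) := by
    rw [CompleteOrthogonalIdempotents.iff_ortho_complete]
    refine ⟨fun i j hij => ?_, ?_⟩
    · change Ideal.Quotient.mk J (q i) * Ideal.Quotient.mk J (q j) = 0
      rw [← map_mul, Ideal.Quotient.eq_zero_iff_mem]
      exact hortho i j hij
    · rw [← map_sum, ← map_one (Ideal.Quotient.mk J), Ideal.Quotient.eq, hmem]
      intro a
      rw [← Finset.add_sum_erase _ _ (Finset.mem_univ (c a)), add_sub_right_comm]
      refine add_mem ?_ (Ideal.sum_mem _ fun i hi => (hq i).1 a (Finset.ne_of_mem_erase hi).symm)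
      simpa using neg_mem ((hq (c a)).2 a rfl)
  refine ⟨hE, fun i => ⟨hE.idem i, fun h0 => ?_, fun e' e'' he' he'' hort hsum => ?_⟩⟩
  · obtain ⟨a, rfl⟩ := hc i
    have h1 := (hmem _).1 (Ideal.Quotient.eq_zero_iff_mem.1 h0) a
    exact (hQ a).ne_top ((Ideal.eq_top_iff_one _).2 (by simpa using add_mem h1 ((hq _).2 a rfl)))
  · obtain ⟨a, rfl⟩ := hc i
    replace hsum : Ideal.Quotient.mk J (q (c a)) = e' + e'' := hsum
    obtain ⟨x, rfl⟩ := Ideal.Quotient.mk_surjective e'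
    have hmul : Ideal.Quotient.mk J (x * q (c a)) = Ideal.Quotient.mk J x := by
      rw [map_mul, hsum, mul_add, hort, he'.eq, add_zero]
    have hoff : ∀ b, c b ≠ c a → q (c a) ∈ (pt b).asIdeal := fun b hb => by
      rw [hpt]
      exact Ideal.le_radical ((hq _).1 b hb)
    have hin : ∀ b, c b = c a → pt b ∈ connectedComponentIn (zeroLocus (J : Set P)) (pt a) :=
      fun b hb => (hcomp a b).1 hb.symm
    rcases preconnected_zeroLocus isPreconnected_connectedComponentIn
      (connectedComponentIn_subset _ (pt a)) (isIdempotentElem_mk_iff.1 he') with h | h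
    · left
      rw [← hmul]
      refine hnil _ (by rwa [hmul]) fun b => ?_
      by_cases hb : c b = c a
      · exact Ideal.mul_mem_right _ _ (h _ (hin b hb))
      · exact Ideal.mul_mem_left _ _ (hoff b hb)
    · right
      have : e'' = Ideal.Quotient.mk J (q (c a) * (1 - x)) := by
        rw [mul_sub, mul_one, mul_comm (q _) x, map_sub, hmul, hsum, add_sub_cancel_left]
      rw [this] at he'' ⊢
      refine hnil _ he'' fun b => ?_
      by_cases hb : c b = c a
      · exact Ideal.mul_mem_left _ _ (h _ (hin b hb))
      · exact Ideal.mul_mem_right _ _ (hoff b hb)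

/-- The closed set on which a primitive idempotent is `1` is connected. -/
theorem isPreconnected_of_isPrimitiveIdempotent {q : P}
    (hq : IsPrimitiveIdempotent (Ideal.Quotient.mk J q)) :
    IsPreconnected (zeroLocus ((J ⊔ Ideal.span {1 - q} : Ideal P) : Set P)) := by
  set I : Ideal P := J ⊔ Ideal.span {1 - q} with hI
  have hqI : 1 - q ∈ I := Ideal.mem_sup_right (Ideal.mem_span_singleton_self _)
  have hIJ : ∀ x ∈ I, x * q ∈ J := by
    intro x hx
    obtain ⟨u, hu, w, hw, rfl⟩ := Submodule.mem_sup.1 hx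
    obtain ⟨z, rfl⟩ := Ideal.mem_span_singleton'.1 hw
    have : (u + z * (1 - q)) * q = u * q + z * (q * (1 - q)) := by ring
    rw [this]
    exact add_mem (Ideal.mul_mem_right _ _ hu)
      (Ideal.mul_mem_left _ _ (isIdempotentElem_mk_iff.1 hq.1))
  have hmemI : ∀ x, x * q ∈ J → x ∈ I := by
    intro x hx
    have : x = x * q + x * (1 - q) := by ring
    rw [this]
    exact add_mem (Ideal.mem_sup_left hx) (Ideal.mul_mem_left _ _ hqI)
  -- a clopen subset comes from an idempotent, which is `0` or `1` since `q` is primitive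
  have : PreconnectedSpace (PrimeSpectrum (P ⧸ I)) := by
    rw [preconnectedSpace_iff_clopen]
    intro s hs
    obtain ⟨e, he, rfl⟩ := exists_idempotent_basicOpen_eq_of_isClopen hs
    obtain ⟨x, rfl⟩ := Ideal.Quotient.mk_surjective e
    have hx : IsIdempotentElem (Ideal.Quotient.mk J (x * q)) := by
      rw [isIdempotentElem_mk_iff] at he ⊢
      have : x * q * (1 - x * q) = x * (1 - x) * q + x ^ 2 * (q * (1 - q)) := by ring
      rw [this]
      exact add_mem (hIJ _ he) (Ideal.mul_mem_left _ _ (isIdempotentElem_mk_iff.1 hq.1))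
    have hxq : Ideal.Quotient.mk J (x * q) * Ideal.Quotient.mk J q =
        Ideal.Quotient.mk J (x * q) := by
      rw [map_mul, mul_assoc, hq.1.eq]
    rcases hq.mul_eq hx with h | h <;> rw [hxq] at h
    · left
      have : Ideal.Quotient.mk I x = 0 :=
        Ideal.Quotient.eq_zero_iff_mem.2 (hmemI x (Ideal.Quotient.eq_zero_iff_mem.1 h))
      simp [this]
    · right
      have : Ideal.Quotient.mk I x = 1 := by
        rw [← map_one (Ideal.Quotient.mk I), Ideal.Quotient.eq]
        refine hmemI _ ?_
        rw [sub_mul, one_mul]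
        exact Ideal.Quotient.eq.1 h
      simp [this]
  have hrange := range_comap_of_surjective _ (Ideal.Quotient.mk I) Ideal.Quotient.mk_surjective
  rw [Ideal.mk_ker] at hrange
  rw [← hrange]
  exact isPreconnected_range (by fun_prop)

/-- For any primary decomposition of `J`, each component contains all but one of the `q i`. The
closed set on which `q i` is `1` is connected, so that this grouping of the components is the one by
the connected components of the spectrum. -/
theorem IsIdempotentStep.of_isCompletePrimitive [IsNoetherianRing P] {ν : ℕ} {q : Fin ν → P}
    (H : IsCompletePrimitive fun i => Ideal.Quotient.mk J (q i)) : IsIdempotentStep J q := by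
  obtain ⟨hE, hprim⟩ := H
  obtain ⟨t, ht, htQ⟩ := Submodule.isLasker P P J
  let φ := t.equivFin
  let Q : Fin t.card → Ideal P := fun a => (φ.symm a).1
  have hQ : ∀ a, (Q a).IsPrimary := fun a => htQ (φ.symm a).2
  have hJ : J = ⨅ a, Q a := by
    rw [← ht, Finset.inf_id_eq_sInf, sInf_eq_iInf']
    exact (φ.symm.iInf_comp (g := fun a : t => (a : Ideal P))).symm
  have hprimary : ∀ a {x y : P}, x * y ∈ Q a → x ∈ Q a ∨ y ∈ (Q a).radical := fun a =>
    (Ideal.isPrimary_iff.1 (hQ a)).2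
  have hJQ : ∀ a, J ≤ Q a := fun a => hJ ▸ iInf_le _ a
  let pt : Fin t.card → PrimeSpectrum P := fun a => ⟨(Q a).radical, Ideal.isPrime_radical (hQ a)⟩
  have hJpt : ∀ a, pt a ∈ zeroLocus (J : Set P) := fun a x hx => Ideal.le_radical (hJQ a hx)
  have hidem : ∀ i, q i * (1 - q i) ∈ J := fun i => isIdempotentElem_mk_iff.1 (hE.idem i)
  have hortho : ∀ i j, i ≠ j → q i * q j ∈ J := fun i j hij => by
    rw [← Ideal.Quotient.eq_zero_iff_mem, map_mul]
    exact hE.ortho hij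
  have hone : ∑ i, q i - 1 ∈ J := by
    rw [← Ideal.Quotient.eq, map_sum, map_one]
    exact hE.complete
  have hex : ∀ a, ∃ i, q i ∉ (Q a).radical := by
    intro a
    by_contra! hall
    refine (pt a).isPrime.one_notMem ?_
    have := sub_mem (Ideal.sum_mem _ fun i (_ : i ∈ Finset.univ) => hall i)
      (Ideal.le_radical (hJQ a hone))
    simpa using this
  -- the group of a primary component: the index of the idempotent outside its radical
  choose c hc using hex
  have hcQ : ∀ a, 1 - q (c a) ∈ Q a := fun a =>
    (hprimary a (x := 1 - q (c a)) (y := q (c a))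
      (by rw [mul_comm]; exact hJQ a (hidem _))).resolve_right (hc a)
  have hoff : ∀ a i, c a ≠ i → q i ∈ Q a := fun a i hi =>
    (hprimary a (hJQ a (hortho i (c a) hi.symm))).resolve_right (hc a)
  refine ⟨t.card, Q, pt, c, hQ, hJ, fun a => rfl, fun i => ?_,
    fun a b => ⟨fun hab => ?_, fun h => ?_⟩,
    fun i => ⟨fun a ha => hoff a i ha, fun a ha => ha ▸ hcQ a⟩⟩
  · by_contra! hne
    refine (hprim i).2.1 (Ideal.Quotient.eq_zero_iff_mem.2 ?_)
    rw [hJ, Ideal.mem_iInf]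
    exact fun a => hoff a i (hne a)
  · have hmem : ∀ b, c a = c b →
        pt b ∈ zeroLocus ((J ⊔ Ideal.span {1 - q (c a)} : Ideal P) : Set P) := by
      intro b hb
      rw [mem_zeroLocus, SetLike.coe_subset_coe, sup_le_iff, Ideal.span_singleton_le_iff_mem]
      exact ⟨hJpt b, Ideal.le_radical (hb ▸ hcQ b)⟩
    exact (isPreconnected_of_isPrimitiveIdempotent (hprim (c a))).subset_connectedComponentIn
      (hmem a rfl) (zeroLocus_anti_mono (SetLike.coe_subset_coe.2 le_sup_left)) (hmem b hab)
  · by_contra hne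
    have ha : pt a ∈ connectedComponentIn (zeroLocus (J : Set P)) (pt a) :=
      mem_connectedComponentIn (hJpt a)
    rcases preconnected_zeroLocus isPreconnected_connectedComponentIn
      (connectedComponentIn_subset _ (pt a)) (hidem (c a)) with h' | h'
    · exact hc a (h' _ ha)
    · refine (pt b).isPrime.one_notMem ?_
      simpa using add_mem (h' _ h) (Ideal.le_radical (hoff b (c a) (Ne.symm hne)))

end ConnectedComponents

/-! ### The maximal ring of scalars -/

section ScalarRing

variable {N₁ N₂ M : Type u} [AddCommGroup N₁] [AddCommGroup N₂] [AddCommGroup M]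
  {f : N₁ →+ N₂ →+ M}

theorem IsFull.hom_ext (hf : IsFull f) {G : Type*} [AddCommGroup G] {γ γ' : M →+ G}
    (h : ∀ x y, γ (f x y) = γ' (f x y)) : γ = γ' := by
  refine AddMonoidHom.eq_of_eqOn_dense hf ?_
  rintro _ ⟨x, y, rfl⟩
  exact h x y

/-- The triples of endomorphisms of the three groups that act as scalars. -/
def scalarRing (f : N₁ →+ N₂ →+ M) :
    Subring (AddMonoid.End N₁ × AddMonoid.End N₂ × AddMonoid.End M) where
  carrier := {t | ∀ x y, f (t.1 x) y = t.2.2 (f x y) ∧ f x (t.2.1 y) = t.2.2 (f x y)}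
  mul_mem' := fun {s t} hs ht x y => by
    constructor
    · change f (s.1 (t.1 x)) y = s.2.2 (t.2.2 (f x y))
      rw [(hs _ _).1, (ht _ _).1]
    · change f x (s.2.1 (t.2.1 y)) = s.2.2 (t.2.2 (f x y))
      rw [(hs _ _).2, (ht _ _).2]
  one_mem' := fun x y => ⟨rfl, rfl⟩
  add_mem' := fun {s t} hs ht x y => by
    constructor
    · change f (s.1 x + t.1 x) y = s.2.2 (f x y) + t.2.2 (f x y)
      rw [map_add, AddMonoidHom.add_apply, (hs _ _).1, (ht _ _).1]
    · change f x (s.2.1 y + t.2.1 y) = s.2.2 (f x y) + t.2.2 (f x y)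
      rw [map_add, (hs _ _).2, (ht _ _).2]
  zero_mem' := fun x y => by
    constructor
    · change f 0 y = 0
      simp
    · change f x 0 = 0
      simp
  neg_mem' := fun {s} hs x y => by
    constructor
    · change f (-s.1 x) y = -s.2.2 (f x y)
      rw [map_neg, AddMonoidHom.neg_apply, (hs _ _).1]
    · change f x (-s.2.1 y) = -s.2.2 (f x y)
      rw [map_neg, (hs _ _).2]

/-- A scalar is determined by its action on the values of the bilinear map. -/
theorem scalarRing_ext (hf : IsFull f) (hn : IsNondegenerate f) {s t : scalarRing f}
    (h : ∀ x y, s.1.2.2 (f x y) = t.1.2.2 (f x y)) : s = t := by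
  refine Subtype.ext (Prod.ext ?_ (Prod.ext ?_ ?_))
  · refine DFunLike.ext _ _ fun x => sub_eq_zero.1 (hn.1 _ fun y => ?_)
    rw [map_sub, AddMonoidHom.sub_apply, (s.2 x y).1, (t.2 x y).1, h, sub_self]
  · refine DFunLike.ext _ _ fun y => sub_eq_zero.1 (hn.2 _ fun x => ?_)
    rw [map_sub, (s.2 x y).2, (t.2 x y).2, h, sub_self]
  · exact hf.hom_ext h

/-- One scalar can be moved to the first argument and the other to the second, where they act
independently. -/
theorem scalarRing_mul_comm (hf : IsFull f) (hn : IsNondegenerate f) (s t : scalarRing f) :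
    s * t = t * s := by
  refine scalarRing_ext hf hn fun x y => ?_
  change s.1.2.2 (t.1.2.2 (f x y)) = t.1.2.2 (s.1.2.2 (f x y))
  rw [← (t.2 x y).1, ← (s.2 _ y).2, (t.2 x _).1, (s.2 x y).2]

/-- A full non-degenerate bilinear map has a maximal ring of scalars, and every triple of
endomorphisms that acts as a scalar belongs to it. -/
theorem exists_isMaximalRingOfScalars_aux (hf : IsFull f) (hn : IsNondegenerate f) :
    ∃ (S : Type u) (_ : CommRing S) (_ : Module S N₁) (_ : Module S N₂) (_ : Module S M),
      IsMaximalRingOfScalars f S ∧ ∀ (α : N₁ →+ N₁) (β : N₂ →+ N₂) (γ : M →+ M),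
        (∀ x y, f (α x) y = γ (f x y) ∧ f x (β y) = γ (f x y)) →
          ∃ s : S, (∀ x : N₁, s • x = α x) ∧ (∀ y : N₂, s • y = β y) ∧ ∀ z : M, s • z = γ z := by
  let iC : CommRing (scalarRing f) :=
    { (inferInstance : Ring (scalarRing f)) with mul_comm := scalarRing_mul_comm hf hn }
  let ρ₁ : scalarRing f →+* AddMonoid.End N₁ := (RingHom.fst _ _).comp (scalarRing f).subtype
  let ρ₂ : scalarRing f →+* AddMonoid.End N₂ :=
    ((RingHom.fst _ _).comp (RingHom.snd _ _)).comp (scalarRing f).subtype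
  let ρM : scalarRing f →+* AddMonoid.End M :=
    ((RingHom.snd _ _).comp (RingHom.snd _ _)).comp (scalarRing f).subtype
  let i₁ : Module (scalarRing f) N₁ := Module.compHom N₁ ρ₁
  let i₂ : Module (scalarRing f) N₂ := Module.compHom N₂ ρ₂
  let iM : Module (scalarRing f) M := Module.compHom M ρM
  have hs : ∀ (s : scalarRing f) (x : N₁) (y : N₂),
      f (s • x) y = s • f x y ∧ f x (s • y) = s • f x y := fun s x y => s.2 x y
  refine ⟨scalarRing f, iC, i₁, i₂, iM,
    ⟨⟨⟨fun h => ?_⟩, ⟨fun h => ?_⟩, ⟨fun h => ?_⟩, fun r x y => ?_⟩, fun R _ _ _ _ hR => ?_⟩,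
    fun α β γ h => ?_⟩
  · exact scalarRing_ext hf hn fun x y =>
      ((hs _ x y).1.symm.trans (congrArg (f · y) (h x))).trans (hs _ x y).1
  · exact scalarRing_ext hf hn fun x y =>
      ((hs _ x y).2.symm.trans (congrArg (f x) (h y))).trans (hs _ x y).2
  · exact scalarRing_ext hf hn fun x y => h (f x y)
  · exact hs r x y
  · obtain ⟨hR₁, -, -, hR⟩ := hR
    let φ₀ : R →+* AddMonoid.End N₁ × AddMonoid.End N₂ × AddMonoid.End M :=
      (Module.toAddMonoidEnd R N₁).prod
        ((Module.toAddMonoidEnd R N₂).prod (Module.toAddMonoidEnd R M))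
    refine ⟨φ₀.codRestrict (scalarRing f) fun r x y => hR r x y, fun r r' hrr => ?_,
      fun _ _ => rfl, fun _ _ => rfl, fun _ _ => rfl⟩
    refine hR₁.eq_of_smul_eq_smul fun x => ?_
    exact DFunLike.congr_fun (congrArg (fun s : scalarRing f => s.1.1) hrr) x
  · exact ⟨⟨(α, β, γ), h⟩, fun _ => rfl, fun _ => rfl, fun _ => rfl⟩

theorem exists_isMaximalRingOfScalars (hf : IsFull f) (hn : IsNondegenerate f) :
    ∃ (S : Type u) (_ : CommRing S) (_ : Module S N₁) (_ : Module S N₂) (_ : Module S M),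
      IsMaximalRingOfScalars f S := by
  obtain ⟨S, i, i₁, i₂, iM, h, -⟩ := exists_isMaximalRingOfScalars_aux hf hn
  exact ⟨S, i, i₁, i₂, iM, h⟩

variable {S : Type u} [CommRing S] [Module S N₁] [Module S N₂] [Module S M]

/-- Every maximal ring of scalars contains all triples of endomorphisms that act as scalars. -/
theorem IsMaximalRingOfScalars.exists_smul (hS : IsMaximalRingOfScalars f S) (hf : IsFull f)
    (hn : IsNondegenerate f) (α : N₁ →+ N₁) (β : N₂ →+ N₂) (γ : M →+ M)
    (h : ∀ x y, f (α x) y = γ (f x y) ∧ f x (β y) = γ (f x y)) :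
    ∃ s : S, (∀ x : N₁, s • x = α x) ∧ (∀ y : N₂, s • y = β y) ∧ ∀ z : M, s • z = γ z := by
  obtain ⟨R, _, _, _, _, hR, hR'⟩ := exists_isMaximalRingOfScalars_aux hf hn
  obtain ⟨φ, -, h₁, h₂, hM⟩ := hS.2 R hR.1
  obtain ⟨s, hs₁, hs₂, hsM⟩ := hR' α β γ h
  exact ⟨φ s, fun x => by rw [h₁, hs₁], fun x => by rw [h₂, hs₂], fun x => by rw [hM, hsM]⟩

end ScalarRing

/-! ### The decomposition given by idempotent scalars -/

section Decomposition

/-- The projections of an internal direct sum onto its summands. -/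
theorem _root_.DirectSum.IsInternal.exists_proj {N : Type*} [AddCommGroup N] {k : ℕ}
    {A : Fin k → AddSubgroup N} (h : DirectSum.IsInternal A) :
    ∃ p : ∀ i, N →+ A i, (∀ i (x : A i), p i x = x) ∧ (∀ i j, j ≠ i → ∀ x : A j, p i x = 0) ∧
      ∀ x, ∑ i, (p i x : N) = x := by
  let e := AddEquiv.ofBijective (DirectSum.coeAddMonoidHom A) h
  have he : ∀ j (x : A j), e.symm x = DirectSum.of (fun i => A i) j x := fun j x => by
    rw [AddEquiv.symm_apply_eq]
    exact (DirectSum.coeAddMonoidHom_of A j x).symm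
  refine ⟨fun i => (DFinsupp.evalAddMonoidHom i).comp e.symm.toAddMonoidHom, fun i x => ?_,
    fun i j hij x => ?_, fun x => ?_⟩
  · change e.symm x i = x
    rw [he, DirectSum.of_eq_same]
  · change e.symm x i = 0
    rw [he, DirectSum.of_eq_of_ne _ _ _ hij.symm]
  · conv_rhs => rw [← e.apply_symm_apply x, ← DirectSum.sum_univ_of (e.symm x), map_sum]
    exact Finset.sum_congr rfl fun i _ => (DirectSum.coeAddMonoidHom_of A i _).symm

theorem smul_eq_self_of_mem {S N : Type*} [CommRing S] [AddCommGroup N] [Module S N] {ε : S}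
    (hε : IsIdempotentElem ε) {A : AddSubgroup N} (hA : (A : Set N) = Set.range fun x => ε • x)
    {x : N} (hx : x ∈ A) : ε • x = x := by
  obtain ⟨x, rfl⟩ : x ∈ Set.range fun x => ε • x := hA ▸ hx
  simp only [smul_smul, hε.eq]

theorem smul_mem_of_range {S N : Type*} [CommRing S] [AddCommGroup N] [Module S N] {ε : S}
    {A : AddSubgroup N} (hA : (A : Set N) = Set.range fun x => ε • x) (x : N) : ε • x ∈ A := by
  rw [← SetLike.mem_coe, hA]
  exact ⟨x, rfl⟩

theorem isInternal_of_idempotents {S N : Type*} [CommRing S] [AddCommGroup N] [Module S N]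
    {k : ℕ} {ε : Fin k → S} (hε : CompleteOrthogonalIdempotents ε) {A : Fin k → AddSubgroup N}
    (hA : ∀ i, (A i : Set N) = Set.range fun x => ε i • x) : DirectSum.IsInternal A := by
  have h0 : ∀ i j, i ≠ j → ∀ x : A j, ε i • (x : N) = 0 := fun i j hij x => by
    rw [← smul_eq_self_of_mem (hε.idem j) (hA j) x.2, smul_smul]
    have : ε i * ε j = 0 := hε.ortho hij
    rw [this, zero_smul]
  refine ⟨(injective_iff_map_eq_zero _).2 fun u hu => ?_, fun x => ?_⟩
  · have h : ∀ i, (DistribSMul.toAddMonoidHom N (ε i)).comp (DirectSum.coeAddMonoidHom A) =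
        (A i).subtype.comp (DFinsupp.evalAddMonoidHom i) := by
      intro i
      refine DirectSum.addHom_ext fun j x => ?_
      simp only [AddMonoidHom.comp_apply, DirectSum.coeAddMonoidHom_of,
        DistribSMul.toAddMonoidHom_apply, AddSubgroup.coe_subtype]
      by_cases hij : i = j
      · subst hij
        rw [smul_eq_self_of_mem (hε.idem i) (hA i) x.2]
        exact (congrArg Subtype.val (DirectSum.of_eq_same (β := fun i => A i) i x)).symm
      · rw [h0 i j hij]
        exact congrArg Subtype.val (DirectSum.of_eq_of_ne (β := fun i => A i) j i x hij).symm
    refine DFinsupp.ext fun i => Subtype.ext ?_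
    have := DFunLike.congr_fun (h i) u
    rw [AddMonoidHom.comp_apply, hu, map_zero] at this
    exact this.symm
  · refine ⟨∑ i, DirectSum.of (fun i => A i) i ⟨ε i • x, smul_mem_of_range (hA i) x⟩, ?_⟩
    rw [map_sum]
    simp only [DirectSum.coeAddMonoidHom_of]
    rw [← Finset.sum_smul, hε.complete, one_smul]

/-- The projection of `N` onto a direct summand of the subgroup `ε N`. -/
theorem exists_summand_proj {S N : Type*} [CommRing S] [AddCommGroup N] [Module S N] {ε : S}
    (hε : IsIdempotentElem ε) {A : AddSubgroup N} (hA : (A : Set N) = Set.range fun x => ε • x)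
    {k : ℕ} {A' : Fin k → AddSubgroup A} (h : DirectSum.IsInternal A') :
    ∃ p : ∀ i, N →+ A' i, (∀ i x, p i (ε • x) = p i x) ∧ (∀ i (x : A' i), p i (x : A) = x) ∧
      (∀ i j, j ≠ i → ∀ x : A' j, p i (x : A) = 0) ∧ ∀ x : A, ∑ i, (p i x : A) = x := by
  obtain ⟨p, h1, h2, h3⟩ := h.exists_proj
  let ρ : N →+ A := (DistribSMul.toAddMonoidHom N ε).codRestrict A (smul_mem_of_range hA)
  have hρ : ∀ x : A, ρ x = x := fun x => Subtype.ext (smul_eq_self_of_mem hε hA x.2)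
  have hρ' : ∀ x : N, ρ (ε • x) = ρ x := fun x => Subtype.ext
    (smul_eq_self_of_mem hε hA (smul_mem_of_range hA x))
  refine ⟨fun i => (p i).comp ρ, fun i x => ?_, fun i x => ?_, fun i j hij x => ?_, fun x => ?_⟩
  · rw [AddMonoidHom.comp_apply, AddMonoidHom.comp_apply, hρ']
  · rw [AddMonoidHom.comp_apply, hρ, h1]
  · rw [AddMonoidHom.comp_apply, hρ, h2 i j hij]
  · simp only [AddMonoidHom.comp_apply, hρ, h3]

variable {N₁ N₂ M : Type u} [AddCommGroup N₁] [AddCommGroup N₂] [AddCommGroup M]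
  {f : N₁ →+ N₂ →+ M} {S : Type u} [CommRing S] [Module S N₁] [Module S N₂] [Module S M]

/-- The restriction of `f` to `ε N₁ × ε N₂` is directly indecomposable if `ε` is primitive: the
projections onto a direct factor form a scalar below `ε`. -/
theorem isDirectlyIndecomposable_of_isPrimitiveIdempotent (hS : IsMaximalRingOfScalars f S)
    (hf : IsFull f) (hn : IsNondegenerate f) {ε : S} (hε : IsPrimitiveIdempotent ε)
    {A : AddSubgroup N₁} {B : AddSubgroup N₂} {C : AddSubgroup M}
    (hA : (A : Set N₁) = Set.range fun x => ε • x) (hB : (B : Set N₂) = Set.range fun x => ε • x)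
    (hC : (C : Set M) = Set.range fun x => ε • x) {F : A →+ B →+ C}
    (hF : ∀ x y, (F x y : M) = f x y) : IsDirectlyIndecomposable F := by
  rintro ⟨k, A', B', C', g, hk, ⟨hA', hB', hC', hg⟩, hnt⟩
  obtain ⟨⟨hfaith, -, -, hsc⟩, -⟩ := id hS
  obtain ⟨p, hpε, hp1, hp0, hps⟩ := exists_summand_proj hε.1 hA hA'
  obtain ⟨q, hqε, hq1, hq0, hqs⟩ := exists_summand_proj hε.1 hB hB'
  obtain ⟨o, hoε, ho1, ho0, hos⟩ := exists_summand_proj hε.1 hC hC'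
  -- an argument in the `i`-th factor sees only the `i`-th component of the other argument
  have hgl : ∀ i (x : A' i) (y : B), F x y = g i x (q i y) := by
    intro i x y
    have := hg (Pi.single i x) fun j => q j y
    rw [hqs, Finset.sum_eq_single i, Finset.sum_eq_single i] at this
    · simpa using this
    · intro j _ hj
      simp [Pi.single_eq_of_ne hj]
    · simp
    · intro j _ hj
      simp [Pi.single_eq_of_ne hj]
    · simp
  have hgr : ∀ i (x : A) (y : B' i), F x y = g i (p i x) y := by
    intro i x y
    have := hg (fun j => p j x) (Pi.single i y)
    rw [hps, Finset.sum_eq_single i, Finset.sum_eq_single i] at this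
    · simpa using this
    · intro j _ hj
      simp [Pi.single_eq_of_ne hj]
    · simp
    · intro j _ hj
      simp [Pi.single_eq_of_ne hj]
    · simp
  have hgo : ∀ i (x : A) (y : B), o i (F x y) = g i (p i x) (q i y) := by
    intro i x y
    have h1 : F x y = ∑ j, (g j (p j x) (q j y) : C) := by
      rw [← hg, hps, hqs]
    rw [h1, AddSubgroup.val_finsetSum, map_sum, Finset.sum_eq_single i, ho1]
    · intro j _ hj
      exact ho0 i j hj _
    · simp
  have hidA : ∀ x : A, ε • (x : N₁) = x := fun x => smul_eq_self_of_mem hε.1 hA x.2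
  have hidB : ∀ x : B, ε • (x : N₂) = x := fun x => smul_eq_self_of_mem hε.1 hB x.2
  have hidC : ∀ x : C, ε • (x : M) = x := fun x => smul_eq_self_of_mem hε.1 hC x.2
  let i₀ : Fin k := ⟨0, by omega⟩
  let i₁ : Fin k := ⟨1, by omega⟩
  have hne : i₁ ≠ i₀ := by simp [i₀, i₁]
  have hFx : ∀ (x : A) (y : N₂), f x y = F x ⟨ε • y, smul_mem_of_range hB y⟩ := fun x y => by
    rw [hF, (hsc _ _ _).2, ← (hsc _ _ _).1, hidA]
  have hFy : ∀ (x : N₁) (y : B), f x y = F ⟨ε • x, smul_mem_of_range hA x⟩ y := fun x y => by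
    rw [hF, (hsc _ _ _).1, ← (hsc _ _ _).2, hidB]
  have hFxy : ∀ (x : N₁) (y : N₂), ε • f x y =
      F ⟨ε • x, smul_mem_of_range hA x⟩ ⟨ε • y, smul_mem_of_range hB y⟩ := fun x y => by
    rw [← hFx, (hsc _ _ _).1]
  -- the scalar given by the projections onto the first factor
  obtain ⟨s, hs₁, hs₂, hsM⟩ := hS.exists_smul hf hn
    (A.subtype.comp ((A' i₀).subtype.comp (p i₀))) (B.subtype.comp ((B' i₀).subtype.comp (q i₀)))
    (C.subtype.comp ((C' i₀).subtype.comp (o i₀))) fun x y => by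
      simp only [AddMonoidHom.comp_apply, AddSubgroup.coe_subtype]
      rw [hFx, hFy, hgl, hgr, ← hoε, hFxy, hgo, hpε, hqε]
      exact ⟨rfl, rfl⟩
  simp only [AddMonoidHom.comp_apply, AddSubgroup.coe_subtype] at hs₁ hs₂ hsM
  have hsε : s * ε = s := hfaith.eq_of_smul_eq_smul fun x : N₁ => by
    rw [mul_smul, hs₁, hs₁, hpε]
  have hss : IsIdempotentElem s := hfaith.eq_of_smul_eq_smul fun x : N₁ => by
    rw [mul_smul, hs₁ x, hs₁, hp1]
  -- if `s = 0`, then the first factor is trivial; if `s = ε`, then the second one is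
  rcases hε.mul_eq hss with h | h <;> rw [hsε] at h <;> subst h
  · refine hnt i₀ ⟨⟨fun x y => ?_⟩, ⟨fun x y => ?_⟩, ⟨fun x y => ?_⟩⟩ <;>
      refine Subtype.ext (Subtype.ext ?_)
    · rw [← hp1 _ x, ← hp1 _ y, ← hs₁, ← hs₁, zero_smul, zero_smul]
    · rw [← hq1 _ x, ← hq1 _ y, ← hs₂, ← hs₂, zero_smul, zero_smul]
    · rw [← ho1 _ x, ← ho1 _ y, ← hsM, ← hsM, zero_smul, zero_smul]
  · refine hnt i₁ ⟨⟨fun x y => ?_⟩, ⟨fun x y => ?_⟩, ⟨fun x y => ?_⟩⟩ <;>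
      refine Subtype.ext (Subtype.ext ?_)
    · rw [← hidA x, ← hidA y, hs₁, hs₁, hp0 _ _ hne, hp0 _ _ hne]
    · rw [← hidB x, ← hidB y, hs₂, hs₂, hq0 _ _ hne, hq0 _ _ hne]
    · rw [← hidC x, ← hidC y, hsM, hsM, ho0 _ _ hne, ho0 _ _ hne]

/-- The subgroups cut out by the primitive idempotents of the maximal ring of scalars form the
canonical decomposition. -/
theorem exists_isCanonicalDecomposition (hS : IsMaximalRingOfScalars f S)
    (hf : IsFull f) (hn : IsNondegenerate f) {k : ℕ} {ε : Fin k → S} (hε : IsCompletePrimitive ε)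
    {A : Fin k → AddSubgroup N₁} {B : Fin k → AddSubgroup N₂} {C : Fin k → AddSubgroup M}
    (hA : ∀ i, (A i : Set N₁) = Set.range fun x => ε i • x)
    (hB : ∀ i, (B i : Set N₂) = Set.range fun x => ε i • x)
    (hC : ∀ i, (C i : Set M) = Set.range fun x => ε i • x) :
    ∃ F : ∀ i, A i →+ B i →+ C i, (∀ i x y, (F i x y : M) = f x y) ∧
      IsCanonicalDecomposition f S ε A B C F ∧
      ∀ i, IsFull (F i) ∧ IsNondegenerate (F i) ∧ ¬ IsTrivialMap (F i) ∧
        IsDirectlyIndecomposable (F i) := by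
  obtain ⟨⟨hfaith, -, -, hsc⟩, -⟩ := id hS
  have hidA : ∀ i (x : A i), ε i • (x : N₁) = x := fun i x =>
    smul_eq_self_of_mem (hε.1.idem i) (hA i) x.2
  have hidB : ∀ i (x : B i), ε i • (x : N₂) = x := fun i x =>
    smul_eq_self_of_mem (hε.1.idem i) (hB i) x.2
  have hfmem : ∀ i (x : A i) (y : N₂), f x y ∈ C i := fun i x y => by
    rw [← hidA, (hsc _ _ _).1]
    exact smul_mem_of_range (hC i) _
  have hfl : ∀ i (x : A i) (y : N₂), f x (ε i • y) = f x y := fun i x y => by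
    rw [(hsc _ _ _).2, ← (hsc _ _ _).1, hidA]
  have hfr : ∀ i (x : N₁) (y : B i), f (ε i • x) y = f x y := fun i x y => by
    rw [(hsc _ _ _).1, ← (hsc _ _ _).2, hidB]
  let F : ∀ i, A i →+ B i →+ C i := fun i => AddMonoidHom.mk' (fun x =>
    AddMonoidHom.mk' (fun y => ⟨f x y, hfmem i x y⟩) fun y y' => Subtype.ext (by simp))
    fun x x' => AddMonoidHom.ext fun y => Subtype.ext (by simp)
  have hF : ∀ i x y, (F i x y : M) = f x y := fun i x y => rfl
  refine ⟨F, hF, ⟨hε, hA, hB, hC, fun i x y x' y' hx hy => ?_, isInternal_of_idempotents hε.1 hA,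
    isInternal_of_idempotents hε.1 hB, isInternal_of_idempotents hε.1 hC, fun x y => ?_⟩,
    fun i => ⟨?_, ⟨fun x hx => ?_, fun y hy => ?_⟩, fun h => ?_,
      isDirectlyIndecomposable_of_isPrimitiveIdempotent hS hf hn (hε.2 i) (hA i) (hB i) (hC i)
        (hF i)⟩⟩
  · rw [hF, hy, hfl, hx, (hsc _ _ _).1]
  · simp only [hF]
    rw [map_sum]
    refine Finset.sum_congr rfl fun i _ => ?_
    rw [map_sum, AddMonoidHom.finsetSum_apply, Finset.sum_eq_single i]
    · intro j _ hj
      rw [← hfr, ← hidA j (x j), smul_smul]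
      have : ε i * ε j = 0 := hε.1.ortho hj.symm
      rw [this, zero_smul, map_zero, AddMonoidHom.zero_apply]
    · simp
  -- the values of `F i` include `ε i • f x y`, and multiplication by `ε i` maps `M` onto `C i`
  · refine eq_top_iff.2 fun z _ => ?_
    have hz : ∀ w : M, (⟨ε i • w, smul_mem_of_range (hC i) w⟩ : C i) ∈
        AddSubgroup.closure {z | ∃ x y, F i x y = z} := by
      intro w
      have hw : w ∈ AddSubgroup.closure {z : M | ∃ x y, f x y = z} := by
        rw [show AddSubgroup.closure {z : M | ∃ x y, f x y = z} = ⊤ from hf]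
        trivial
      let ρ : M →+ C i :=
        (DistribSMul.toAddMonoidHom M (ε i)).codRestrict (C i) (smul_mem_of_range (hC i))
      change ρ w ∈ _
      rw [← AddSubgroup.mem_comap]
      refine (AddSubgroup.closure_le _).2 ?_ hw
      rintro _ ⟨x, y, rfl⟩
      refine AddSubgroup.subset_closure ⟨⟨ε i • x, smul_mem_of_range (hA i) x⟩,
        ⟨ε i • y, smul_mem_of_range (hB i) y⟩, Subtype.ext ?_⟩
      rw [hF]
      change f (ε i • x) (ε i • y) = ε i • f x y
      rw [hfl i ⟨ε i • x, smul_mem_of_range (hA i) x⟩, (hsc _ _ _).1]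
    have := hz z
    simp only [smul_eq_self_of_mem (hε.1.idem i) (hC i) z.2] at this
    exact this
  · refine Subtype.ext (hn.1 _ fun y => ?_)
    rw [← hfl]
    exact congrArg Subtype.val (hx ⟨ε i • y, smul_mem_of_range (hB i) y⟩)
  · refine Subtype.ext (hn.2 _ fun x => ?_)
    rw [← hfr]
    exact congrArg Subtype.val (hy ⟨ε i • x, smul_mem_of_range (hA i) x⟩)
  · refine (hε.2 i).2.1 (hfaith.eq_of_smul_eq_smul fun x : N₁ => ?_)
    rw [zero_smul]
    exact congrArg Subtype.val (h.1.elim ⟨ε i • x, smul_mem_of_range (hA i) x⟩ 0)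

end Decomposition

/-! ### Matrices of scalars, and the systems of linear equations -/

section Matrices

/-- The matrix `A` describes the action of `s` on the generators `a`. -/
def Represents {S N : Type*} [CommRing S] [AddCommGroup N] [Module S N] {h : ℕ} (a : Fin h → N)
    (s : S) (A : Matrix (Fin h) (Fin h) ℤ) : Prop :=
  ∀ i, s • a i = ∑ j, A i j • a j

section

variable {S N : Type*} [CommRing S] [AddCommGroup N] [Module S N] {h : ℕ} {a : Fin h → N}

theorem Represents.zero : Represents a (0 : S) 0 := fun i => by simp

theorem Represents.one : Represents a (1 : S) 1 := fun i => by simp [Matrix.one_apply]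

theorem Represents.add {s t : S} {A B : Matrix (Fin h) (Fin h) ℤ} (hs : Represents a s A)
    (ht : Represents a t B) : Represents a (s + t) (A + B) := fun i => by
  simp only [add_smul, hs i, ht i, Matrix.add_apply, Finset.sum_add_distrib]

theorem Represents.zsmul {s : S} {A : Matrix (Fin h) (Fin h) ℤ} (hs : Represents a s A) (n : ℤ) :
    Represents a (n • s) (n • A) := fun i => by
  rw [smul_assoc, hs i, Finset.smul_sum]
  exact Finset.sum_congr rfl fun j _ => by rw [Matrix.smul_apply, smul_assoc]

theorem Represents.sum {ι : Type*} (σ : Finset ι) {s : ι → S} {A : ι → Matrix (Fin h) (Fin h) ℤ}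
    (hs : ∀ i, Represents a (s i) (A i)) : Represents a (∑ i ∈ σ, s i) (∑ i ∈ σ, A i) := by
  classical
  induction σ using Finset.induction_on with
  | empty => simpa using Represents.zero
  | insert i σ hi ih =>
    rw [Finset.sum_insert hi, Finset.sum_insert hi]
    exact (hs i).add ih

/-- Matrices of coefficients multiply in the opposite order, which does not matter for scalars. -/
theorem Represents.mul {s t : S} {A B : Matrix (Fin h) (Fin h) ℤ} (hs : Represents a s A)
    (ht : Represents a t B) : Represents a (s * t) (A * B) := fun i => by
  rw [mul_comm, mul_smul, hs i, Finset.smul_sum]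
  simp only [smul_comm t, ht _, Finset.smul_sum, Matrix.mul_apply, Finset.sum_smul]
  rw [Finset.sum_comm]
  simp only [mul_smul]

theorem Represents.pow {s : S} {A : Matrix (Fin h) (Fin h) ℤ} (hs : Represents a s A) (n : ℕ) :
    Represents a (s ^ n) (A ^ n) := by
  induction n with
  | zero => simpa using Represents.one
  | succ n ih =>
    rw [pow_succ, pow_succ]
    exact ih.mul hs

theorem Represents.prod_ofFn {r : ℕ} {s : Fin r → S} {A : Fin r → Matrix (Fin h) (Fin h) ℤ}
    (hs : ∀ i, Represents a (s i) (A i)) : Represents a (∏ i, s i) (List.ofFn A).prod := by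
  induction r with
  | zero => simpa using Represents.one
  | succ r ih =>
    rw [Fin.prod_univ_succ, List.ofFn_succ, List.prod_cons]
    exact (hs 0).mul (ih fun i => hs i.succ)

theorem Represents.evalMat {r : ℕ} {g : Fin r → S} {A : Fin r → Matrix (Fin h) (Fin h) ℤ}
    (hg : ∀ k, Represents a (g k) (A k)) (w : PolyTerms r) :
    Represents a (MvPolynomial.aeval (R := ℤ) g w.toPoly) (w.evalMat A) := by
  induction w with
  | nil => simpa [PolyTerms.toPoly, PolyTerms.evalMat] using Represents.zero
  | cons c w ih =>
    simp only [PolyTerms.toPoly, PolyTerms.evalMat, List.map_cons, List.sum_cons, map_add] at ih ⊢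
    refine Represents.add ?_ ih
    rw [map_mul, MvPolynomial.aeval_C, map_prod, ← Algebra.smul_def]
    simp only [map_pow, MvPolynomial.aeval_X]
    exact (Represents.prod_ofFn fun k => (hg k).pow (c.1 k)).zsmul c.2

theorem Represents.smul_congr {s t : S} {A : Matrix (Fin h) (Fin h) ℤ} (hs : Represents a s A)
    (ht : Represents a t A) (ha : ∀ x : N, ∃ c : Fin h → ℤ, x = ∑ i, c i • a i) (x : N) :
    s • x = t • x := by
  obtain ⟨c, rfl⟩ := ha x
  simp only [Finset.smul_sum, smul_comm _ (c _) (a _), hs _, ht _]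

theorem exists_represents (ha : ∀ x : N, ∃ c : Fin h → ℤ, x = ∑ i, c i • a i) (s : S) :
    ∃ A, Represents a s A := by
  choose A hA using fun i => ha (s • a i)
  exact ⟨A, hA⟩

end

section Generators

variable {ι : Type*} [Fintype ι] {N G : Type*} [AddCommGroup N] [AddCommGroup G] {v : ι → N}

theorem hom_ext_of_generators (hv : ∀ x : N, ∃ c : ι → ℤ, x = ∑ i, c i • v i) {α β : N →+ G}
    (h : ∀ i, α (v i) = β (v i)) : α = β := by
  ext x
  obtain ⟨c, rfl⟩ := hv x
  simp only [map_sum, map_zsmul, h]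

theorem exists_hom_of_generators (hv : ∀ x : N, ∃ c : ι → ℤ, x = ∑ i, c i • v i) (g : ι → G)
    (h : ∀ c : ι → ℤ, ∑ i, c i • v i = 0 → ∑ i, c i • g i = 0) :
    ∃ α : N →+ G, ∀ i, α (v i) = g i := by
  classical
  let φ : (ι → ℤ) →ₗ[ℤ] N := Fintype.linearCombination ℤ v
  let ψ : (ι → ℤ) →ₗ[ℤ] G := Fintype.linearCombination ℤ g
  have hφ : Function.Surjective φ := fun x => by
    obtain ⟨c, rfl⟩ := hv x
    exact ⟨c, by simp [φ, Fintype.linearCombination_apply]⟩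
  have hker : LinearMap.ker φ ≤ LinearMap.ker ψ := fun c hc => by
    simp only [LinearMap.mem_ker, φ, ψ, Fintype.linearCombination_apply] at hc ⊢
    exact h c hc
  refine ⟨(((LinearMap.ker φ).liftQ ψ hker).comp
    (φ.quotKerEquivOfSurjective hφ).symm.toLinearMap).toAddMonoidHom, fun i => ?_⟩
  have h1 : φ (Pi.single i 1) = v i := by simp [φ]
  have h2 : ψ (Pi.single i 1) = g i := by simp [ψ]
  have h3 : (φ.quotKerEquivOfSurjective hφ).symm (v i) =
      (LinearMap.ker φ).mkQ (Pi.single i 1) := by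
    rw [LinearEquiv.symm_apply_eq, ← h1]
    rfl
  change ((LinearMap.ker φ).liftQ ψ hker) ((φ.quotKerEquivOfSurjective hφ).symm (v i)) = g i
  rw [h3, ← h2]
  rfl

theorem sum_smul_eq_zero_of_mem_span {κ : Type*} {z : κ → ι → ℤ} {g : ι → G}
    (h : ∀ k, ∑ i, z k i • g i = 0) {c : ι → ℤ} (hc : c ∈ Submodule.span ℤ (Set.range z)) :
    ∑ i, c i • g i = 0 := by
  have : Submodule.span ℤ (Set.range z) ≤ LinearMap.ker (Fintype.linearCombination ℤ g) := by
    rw [Submodule.span_le]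
    rintro _ ⟨k, rfl⟩
    simpa [Fintype.linearCombination_apply] using h k
  simpa [Fintype.linearCombination_apply] using this hc

end Generators

variable {N₁ N₂ M : Type u} [AddCommGroup N₁] [AddCommGroup N₂] [AddCommGroup M] {I : Input}
  {a : Fin I.n → N₁} {a' : Fin I.p → N₂} {b : Fin I.m → M} {f : N₁ →+ N₂ →+ M}

theorem Relations.Presents.exists_hom {n : ℕ} {P : Relations n} {N : Type*} [AddCommGroup N]
    {a : Fin n → N} (hP : P.Presents a) (x : Matrix (Fin n) (Fin n) ℤ)
    (hx : ∀ k, P.IsZero fun j => ∑ i, x i j * P.rel k i) :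
    ∃ α : N →+ N, ∀ i, α (a i) = ∑ j, x i j • a j := by
  refine exists_hom_of_generators hP.1 _ fun c hc => ?_
  refine sum_smul_eq_zero_of_mem_span (fun k => ?_) ((hP.2 c).1 hc)
  have := (hP.2 _).2 (hx k)
  simp only [Finset.sum_smul] at this
  rw [Finset.sum_comm] at this
  rw [← this]
  refine Finset.sum_congr rfl fun i _ => ?_
  rw [Finset.smul_sum]
  exact Finset.sum_congr rfl fun j _ => by rw [smul_smul, mul_comm]

theorem Input.Describes.map_sum_sum (hI : I.Describes a a' b f) (u : Fin I.n → ℤ)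
    (v : Fin I.p → ℤ) : f (∑ i, u i • a i) (∑ j, v j • a' j) =
      ∑ κ, (∑ i, ∑ j, u i * v j * I.s i j κ) • b κ := by
  simp only [map_sum, AddMonoidHom.finsetSum_apply, map_zsmul, AddMonoidHom.zsmul_apply,
    hI.2.2.2, Finset.smul_sum, Finset.sum_smul, mul_smul]
  rw [Finset.sum_comm]
  conv_rhs =>
    rw [Finset.sum_comm]
    enter [2, i]
    rw [Finset.sum_comm]
  refine Finset.sum_congr rfl fun i _ => Finset.sum_congr rfl fun j _ => ?_
  exact Finset.sum_congr rfl fun κ _ => by rw [smul_comm]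

theorem Input.Describes.map_sum_left (hI : I.Describes a a' b f) (u : Fin I.n → ℤ) (l : Fin I.p) :
    f (∑ i, u i • a i) (a' l) = ∑ κ, (∑ i, u i * I.s i l κ) • b κ := by
  have := hI.map_sum_sum u (Pi.single l 1)
  simpa [Pi.single_apply, ite_mul, ite_smul] using this

theorem Input.Describes.map_sum_right (hI : I.Describes a a' b f) (k : Fin I.n)
    (v : Fin I.p → ℤ) : f (a k) (∑ j, v j • a' j) = ∑ κ, (∑ j, v j * I.s k j κ) • b κ := by
  have := hI.map_sum_sum (Pi.single k 1) v
  simpa [Pi.single_apply, ite_mul, ite_smul] using this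

theorem Input.Describes.mem_symSystem (hI : I.Describes a a' b f) (x : I.Tup) :
    x ∈ I.symSystem ↔ ∀ k l, f (∑ i, x.1 k i • a i) (a' l) = f (a k) (∑ j, x.2 l j • a' j) := by
  refine forall_congr' fun k => forall_congr' fun l => ?_
  rw [← hI.2.2.1.2, hI.map_sum_left, hI.map_sum_right]
  conv_rhs => rw [← sub_eq_zero, ← Finset.sum_sub_distrib]
  simp only [sub_smul]

theorem Input.Describes.mem_cenSystem (hI : I.Describes a a' b f) {q : ℕ} (δ : Fin q → I.Tup)
    (x : I.Tup) : x ∈ I.cenSystem δ ↔ ∀ π k l, f (∑ i, x.1 k i • a i) (∑ j, (δ π).2 l j • a' j) =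
      f (∑ i, (δ π).1 k i • a i) (∑ j, x.2 l j • a' j) := by
  refine forall_congr' fun π => forall_congr' fun k => forall_congr' fun l => ?_
  rw [← hI.2.2.1.2, hI.map_sum_sum, hI.map_sum_sum]
  conv_rhs => rw [← sub_eq_zero, ← Finset.sum_sub_distrib]
  simp only [sub_smul, mul_comm ((δ π).1 k _)]

theorem Input.Describes.mem_valueSystem (hI : I.Describes a a' b f)
    (x : Matrix (Fin I.n) (Fin I.p) ℤ) :
    x ∈ I.valueSystem ↔ ∑ i, ∑ j, x i j • f (a i) (a' j) = 0 := by
  have : ∑ i, ∑ j, x i j • f (a i) (a' j) = ∑ i, f (a i) (∑ j, x i j • a' j) := by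
    simp only [map_sum, map_zsmul]
  rw [this]
  simp only [hI.map_sum_right]
  rw [Finset.sum_comm]
  simp only [← Finset.sum_smul]
  rw [hI.2.2.1.2]
  rfl

theorem Input.Describes.mem_wellDefSystem (hI : I.Describes a a' b f) {q : ℕ}
    (z : Fin q → Matrix (Fin I.n) (Fin I.p) ℤ) (x : I.Tup) :
    x ∈ I.wellDefSystem z ↔
      ∀ k, ∑ i, ∑ j, z k i j • f (∑ l, x.1 i l • a l) (a' j) = 0 := by
  refine forall_congr' fun k => ?_
  have : ∑ i, ∑ j, z k i j • f (∑ l, x.1 i l • a l) (a' j) =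
      ∑ i, f (∑ l, x.1 i l • a l) (∑ j, z k i j • a' j) := by
    simp only [map_sum, map_zsmul]
  rw [this]
  simp only [hI.map_sum_sum]
  rw [Finset.sum_comm]
  simp only [← Finset.sum_smul]
  rw [hI.2.2.1.2]

/-- If `f` is full, then its values on generators generate `M`. -/
theorem Input.Describes.exists_sum_value (hI : I.Describes a a' b f) (hf : IsFull f) (z : M) :
    ∃ c : Fin I.n × Fin I.p → ℤ, z = ∑ ij, c ij • f (a ij.1) (a' ij.2) := by
  have hz : z ∈ AddSubgroup.closure {z : M | ∃ x y, f x y = z} := by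
    rw [show AddSubgroup.closure {z : M | ∃ x y, f x y = z} = ⊤ from hf]
    trivial
  induction hz using AddSubgroup.closure_induction with
  | mem z hz =>
    obtain ⟨x, y, rfl⟩ := hz
    obtain ⟨u, rfl⟩ := hI.1.1 x
    obtain ⟨v, rfl⟩ := hI.2.1.1 y
    refine ⟨fun ij => v ij.2 * u ij.1, ?_⟩
    rw [Fintype.sum_prod_type]
    simp only [map_sum, map_zsmul, AddMonoidHom.finsetSum_apply, AddMonoidHom.zsmul_apply,
      Finset.smul_sum, mul_smul]
    rw [Finset.sum_comm]
  | zero => exact ⟨0, by simp⟩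
  | add x y _ _ hx hy =>
    obtain ⟨c, rfl⟩ := hx
    obtain ⟨c', rfl⟩ := hy
    exact ⟨c + c', by simp [add_smul, Finset.sum_add_distrib]⟩
  | neg x _ hx =>
    obtain ⟨c, rfl⟩ := hx
    exact ⟨-c, by simp⟩

variable {S : Type u} [CommRing S] [Module S N₁] [Module S N₂] [Module S M]

/-- The solutions of the linear systems are the matrix pairs that describe the action of a scalar.
The first system makes them endomorphisms `α`, `β` of `N₁`, `N₂`, the symmetry gives
`f (α x) y = f x (β y)`, and compatibility with the relations among the values of `f` makes
`f x y ↦ f (α x) y` a well defined endomorphism `γ` of `M`. -/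
theorem mem_scalarSystem_iff (hI : I.Describes a a' b f) (hf : IsFull f) (hn : IsNondegenerate f)
    (hS : IsMaximalRingOfScalars f S) {q q' : ℕ} {δ : Fin q → I.Tup}
    (hδ : ∀ π, δ π ∈ I.endSystem ∩ I.symSystem) {z : Fin q' → Matrix (Fin I.n) (Fin I.p) ℤ}
    (hz : (Submodule.span ℤ (Set.range z) : Set (Matrix (Fin I.n) (Fin I.p) ℤ)) = I.valueSystem)
    (x : I.Tup) : x ∈ I.endSystem ∩ I.symSystem ∩ I.cenSystem δ ∩ I.wellDefSystem z ↔
      ∃ s : S, Represents a s x.1 ∧ Represents a' s x.2 := by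
  have hzv : ∀ k, ∑ i, ∑ j, z k i j • f (a i) (a' j) = 0 := fun k =>
    (hI.mem_valueSystem _).1 (hz ▸ Submodule.subset_span ⟨k, rfl⟩)
  constructor
  · rintro ⟨⟨⟨⟨h₁, h₂⟩, hsym⟩, -⟩, hw⟩
    rw [hI.mem_symSystem] at hsym
    rw [hI.mem_wellDefSystem] at hw
    obtain ⟨α, hα⟩ := hI.1.exists_hom x.1 h₁
    obtain ⟨β, hβ⟩ := hI.2.1.exists_hom x.2 h₂
    obtain ⟨γ, hγ⟩ := exists_hom_of_generators (hI.exists_sum_value hf)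
      (fun ij => f (α (a ij.1)) (a' ij.2)) fun c hc => by
        have hc' : (Matrix.of fun i j => c (i, j) : Matrix (Fin I.n) (Fin I.p) ℤ) ∈
            Submodule.span ℤ (Set.range z) := by
          rw [← SetLike.mem_coe, hz, hI.mem_valueSystem]
          simpa [Fintype.sum_prod_type] using hc
        obtain ⟨n, hn⟩ := (Submodule.mem_span_range_iff_exists_fun ℤ).1 hc'
        have hcn : ∀ ij, c ij = ∑ k, n k * z k ij.1 ij.2 := fun ij => by
          have := congrArg (fun A : Matrix (Fin I.n) (Fin I.p) ℤ => A ij.1 ij.2) hn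
          simpa [Matrix.sum_apply] using this.symm
        have : ∑ ij, c ij • f (α (a ij.1)) (a' ij.2) =
            ∑ k, n k • ∑ i, ∑ j, z k i j • f (α (a i)) (a' j) := by
          simp only [hcn, Finset.sum_smul, mul_smul, ← Fintype.sum_prod_type' fun i j =>
            z _ i j • f (α (a i)) (a' j), Finset.smul_sum]
          rw [Finset.sum_comm]
        rw [this]
        refine Finset.sum_eq_zero fun k _ => ?_
        simp only [hα, hw k, smul_zero]
    -- both identities of a scalar hold on generators, hence everywhere
    have h1 : f.comp α = f.compr₂ γ := by
      refine hom_ext_of_generators hI.1.1 fun i => hom_ext_of_generators hI.2.1.1 fun j => ?_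
      exact (hγ (i, j)).symm
    have h2 : f.compl₂ β = f.compr₂ γ := by
      refine hom_ext_of_generators hI.1.1 fun i => hom_ext_of_generators hI.2.1.1 fun j => ?_
      change f (a i) (β (a' j)) = γ (f (a i) (a' j))
      rw [hγ (i, j), hα, hβ, hsym]
    obtain ⟨s, hs₁, hs₂, -⟩ := hS.exists_smul hf hn α β γ fun x y =>
      ⟨DFunLike.congr_fun (DFunLike.congr_fun h1 x) y,
        DFunLike.congr_fun (DFunLike.congr_fun h2 x) y⟩
    exact ⟨s, fun i => by rw [hs₁, hα], fun i => by rw [hs₂, hβ]⟩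
  · rintro ⟨s, hs₁, hs₂⟩
    have hsc := hS.1.2.2.2
    -- a scalar maps relations to relations
    have hrel : ∀ {h : ℕ} {P : Relations h} {N : Type u} [AddCommGroup N] [Module S N]
        {c : Fin h → N} {A : Matrix (Fin h) (Fin h) ℤ}, P.Presents c → Represents c s A → ∀ k,
          P.IsZero fun j => ∑ i, A i j * P.rel k i := by
      intro h P N _ _ c A hP hA k
      rw [← hP.2]
      have h0 : ∑ i, P.rel k i • c i = 0 := (hP.2 _).2 (Submodule.subset_span ⟨k, rfl⟩)
      rw [← smul_zero s, ← h0, Finset.smul_sum]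
      simp only [smul_comm s, hA _, Finset.sum_smul, Finset.smul_sum]
      rw [Finset.sum_comm]
      exact Finset.sum_congr rfl fun i _ => Finset.sum_congr rfl fun j _ => by
        rw [smul_smul, mul_comm]
    refine ⟨⟨⟨⟨hrel hI.1 hs₁, hrel hI.2.1 hs₂⟩, ?_⟩, ?_⟩, ?_⟩
    · rw [hI.mem_symSystem]
      intro k l
      rw [← hs₁ k, ← hs₂ l, (hsc _ _ _).1, (hsc _ _ _).2]
    · rw [hI.mem_cenSystem]
      intro π k l
      rw [← hs₁ k, ← hs₂ l, (hsc _ _ _).1, (hsc _ _ _).2, (hI.mem_symSystem _).1 (hδ π).2]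
    · rw [hI.mem_wellDefSystem]
      intro k
      simp only [← hs₁ _, (hsc _ _ _).1]
      rw [← smul_zero s, ← hzv k]
      simp only [Finset.smul_sum]
      exact Finset.sum_congr rfl fun i _ => Finset.sum_congr rfl fun j _ => by rw [smul_comm]

end Matrices

/-! ### The presentation of the maximal ring of scalars -/

section Presentation

/-- The elements `g k` generate the additive group of the ring, with relations generated by the
rows of `w`; the vectors `v` and `t i j` represent `1` and the products `g i * g j`. Unlike for
`IsPresented`, the indices belong to finite types. -/
structure IsRingPresentation {S : Type*} [CommRing S] {r ρ : ℕ} (g : Fin r → S)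
    (w : Fin ρ → Fin r → ℤ) (v : Fin r → ℤ) (t : Fin r → Fin r → Fin r → ℤ) : Prop where
  gen : ∀ s, ∃ x : Fin r → ℤ, s = ∑ k, x k • g k
  rel : ∀ x : Fin r → ℤ, ∑ k, x k • g k = 0 ↔ x ∈ Submodule.span ℤ (Set.range w)
  one : ∑ k, v k • g k = 1
  mul : ∀ i j, g i * g j = ∑ k, t i j k • g k

section

variable {S : Type*} [CommRing S] {r ρ : ℕ} {g : Fin r → S} {w : Fin ρ → Fin r → ℤ}
  {v : Fin r → ℤ} {t : Fin r → Fin r → Fin r → ℤ}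

open MvPolynomial

theorem aeval_linear (g : Fin r → S) (x : Fin r → ℤ) :
    aeval (R := ℤ) g (∑ k, C (x k) * X k) = ∑ k, x k • g k := by
  simp [Algebra.smul_def]

theorem IsRingPresentation.aeval_surjective (h : IsRingPresentation g w v t) :
    Function.Surjective (aeval (R := ℤ) g) := fun s => by
  obtain ⟨x, rfl⟩ := h.gen s
  exact ⟨_, aeval_linear g x⟩

/-- Modulo the ideal of the presentation every polynomial is congruent to a linear form. -/
theorem exists_linear_sub_mem (v : Fin r → ℤ) (w : Fin ρ → Fin r → ℤ)
    (t : Fin r → Fin r → Fin r → ℤ) (p : MvPolynomial (Fin r) ℤ) :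
    ∃ x : Fin r → ℤ, p - ∑ k, C (x k) * X k ∈ presIdeal v w t := by
  have hone : (∑ k, C (v k) * X k) - 1 ∈ presIdeal v w t :=
    Ideal.subset_span (Or.inl (Or.inl rfl))
  have hmul : ∀ i j, X i * X j - ∑ k, C (t i j k) * X k ∈ presIdeal v w t := fun i j =>
    Ideal.subset_span (Or.inr ⟨(i, j), rfl⟩)
  induction p using MvPolynomial.induction_on with
  | C z =>
    refine ⟨fun k => z * v k, ?_⟩
    have : C z - ∑ k, C (z * v k) * X k = -(C z * ((∑ k, C (v k) * X k) - 1)) := by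
      rw [mul_sub, Finset.mul_sum]
      simp only [map_mul, mul_assoc]
      ring
    rw [this]
    exact neg_mem (Ideal.mul_mem_left _ _ hone)
  | add p q hp hq =>
    obtain ⟨x, hx⟩ := hp
    obtain ⟨y, hy⟩ := hq
    refine ⟨x + y, ?_⟩
    have := add_mem hx hy
    rw [sub_add_sub_comm, ← Finset.sum_add_distrib] at this
    simpa only [Pi.add_apply, map_add, add_mul] using this
  | mul_X p i hp =>
    obtain ⟨x, hx⟩ := hp
    refine ⟨fun k => ∑ j, x j * t j i k, ?_⟩
    have : p * X i - ∑ k, C (∑ j, x j * t j i k) * X k = (p - ∑ k, C (x k) * X k) * X i +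
        ∑ j, C (x j) * (X j * X i - ∑ k, C (t j i k) * X k) := by
      simp only [mul_sub, sub_mul, Finset.sum_sub_distrib, Finset.mul_sum, Finset.sum_mul, map_sum,
        map_mul, mul_assoc]
      rw [Finset.sum_comm (s := Finset.univ) (t := Finset.univ)
        (f := fun k j => C (x j) * (C (t j i k) * X k))]
      ring
    rw [this]
    exact add_mem (Ideal.mul_mem_right _ _ hx)
      (Ideal.sum_mem _ fun j _ => Ideal.mul_mem_left _ _ (hmul j i))

/-- A polynomial in the kernel is congruent to a linear form in the kernel, that is, to a relation
among the additive generators. -/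
theorem IsRingPresentation.ker_aeval (h : IsRingPresentation g w v t) :
    RingHom.ker (aeval (R := ℤ) g) = presIdeal v w t := by
  have hle : presIdeal v w t ≤ RingHom.ker (aeval (R := ℤ) g) := by
    rw [presIdeal, Ideal.span_le]
    rintro _ ((rfl | ⟨l, rfl⟩) | ⟨⟨i, j⟩, rfl⟩)
    · rw [SetLike.mem_coe, RingHom.mem_ker, map_sub, aeval_linear, h.one, map_one, sub_self]
    · rw [SetLike.mem_coe, RingHom.mem_ker, aeval_linear, h.rel]
      exact Submodule.subset_span ⟨l, rfl⟩
    · rw [SetLike.mem_coe, RingHom.mem_ker, map_sub, aeval_linear, map_mul, aeval_X, aeval_X, h.mul,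
        sub_self]
  refine le_antisymm (fun p hp => ?_) hle
  obtain ⟨x, hx⟩ := exists_linear_sub_mem v w t p
  have hx0 : x ∈ Submodule.span ℤ (Set.range w) := by
    have := hle hx
    rw [RingHom.mem_ker] at hp this
    rwa [map_sub, aeval_linear, hp, zero_sub, neg_eq_zero, h.rel] at this
  obtain ⟨n, rfl⟩ := (Submodule.mem_span_range_iff_exists_fun ℤ).1 hx0
  have hlin : ∑ k, C ((∑ l, n l • w l) k) * X k =
      ∑ l, C (n l) * (∑ k, C (w l k) * X k : MvPolynomial (Fin r) ℤ) := by
    simp only [Finset.sum_apply, Pi.smul_apply, smul_eq_mul, map_sum, map_mul, Finset.sum_mul,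
      Finset.mul_sum, mul_assoc]
    rw [Finset.sum_comm]
  have hmem : ∑ l, C (n l) * (∑ k, C (w l k) * X k : MvPolynomial (Fin r) ℤ) ∈ presIdeal v w t :=
    Ideal.sum_mem _ fun l _ => Ideal.mul_mem_left _ _ (Ideal.subset_span (Or.inl (Or.inr ⟨l, rfl⟩)))
  rw [hlin] at hx
  simpa using add_mem hx hmem

end

theorem IsPrimitiveIdempotent.map_equiv {A B : Type*} [CommRing A] [CommRing B] (φ : A ≃+* B)
    {e : A} (he : IsPrimitiveIdempotent e) : IsPrimitiveIdempotent (φ e) := by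
  refine ⟨he.1.map φ, fun h => he.2.1 (by simpa using h), fun e' e'' he' he'' h0 h => ?_⟩
  have := he.2.2 (φ.symm e') (φ.symm e'') (he'.map φ.symm) (he''.map φ.symm)
    (by rw [← map_mul, h0, map_zero]) (by rw [← map_add, ← h, φ.symm_apply_apply])
  simpa using this

theorem IsCompletePrimitive.map_equiv {A B : Type*} [CommRing A] [CommRing B] (φ : A ≃+* B)
    {k : ℕ} {e : Fin k → A} (he : IsCompletePrimitive e) : IsCompletePrimitive fun i => φ (e i) :=
  ⟨he.1.map φ.toRingHom, fun i => (he.2 i).map_equiv φ⟩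

/-- The isomorphism of `P / J` with the presented ring carries the classes of the polynomials to
their values. -/
theorem IsRingPresentation.isIdempotentStep_iff {S : Type*} [CommRing S] {r ρ : ℕ} {g : Fin r → S}
    {w : Fin ρ → Fin r → ℤ} {v : Fin r → ℤ} {t : Fin r → Fin r → Fin r → ℤ}
    (h : IsRingPresentation g w v t) {ℓ : ℕ} {q : Fin ℓ → MvPolynomial (Fin r) ℤ} :
    IsIdempotentStep (presIdeal v w t) q ↔
      IsCompletePrimitive fun i => MvPolynomial.aeval (R := ℤ) g (q i) := by
  let φ : (MvPolynomial (Fin r) ℤ ⧸ presIdeal v w t) ≃+* S :=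
    (Ideal.quotEquivOfEq h.ker_aeval.symm).trans
      (RingHom.quotientKerEquivOfSurjective h.aeval_surjective)
  have hφ : ∀ p, φ (Ideal.Quotient.mk _ p) = MvPolynomial.aeval (R := ℤ) g p := fun p => rfl
  constructor
  · intro H
    exact H.isCompletePrimitive.map_equiv φ
  · intro H
    refine .of_isCompletePrimitive ?_
    convert! H.map_equiv φ.symm using 2 with i
    rw [← hφ, φ.symm_apply_apply]

variable {N₁ N₂ M : Type u} [AddCommGroup N₁] [AddCommGroup N₂] [AddCommGroup M] {I : Input}
  {a : Fin I.n → N₁} {a' : Fin I.p → N₂} {b : Fin I.m → M} {f : N₁ →+ N₂ →+ M}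
  {S : Type u} [CommRing S] [Module S N₁] [Module S N₂] [Module S M]

theorem isZero_sub_iff {h : ℕ} {P : Relations h} {N : Type*} [AddCommGroup N] [Module S N]
    {c : Fin h → N} (hP : P.Presents c) {s t : S} {A B : Matrix (Fin h) (Fin h) ℤ}
    (hs : Represents c s A) (ht : Represents c t B) (k : Fin h) :
    (P.IsZero fun j => A k j - B k j) ↔ s • c k = t • c k := by
  rw [← hP.2, hs k, ht k, ← sub_eq_zero (b := ∑ j, B k j • c j), ← Finset.sum_sub_distrib]
  simp only [sub_smul]

theorem IsRingOfScalars.eq_iff (hS : IsRingOfScalars f S) (hI : I.Describes a a' b f) {s t : S} :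
    ((∀ k, s • a k = t • a k) ∧ ∀ k, s • a' k = t • a' k) ↔ s = t := by
  refine ⟨fun h => hS.1.eq_of_smul_eq_smul fun x : N₁ => ?_, fun h => by simp [h]⟩
  obtain ⟨c, rfl⟩ := hI.1.1 x
  simp only [Finset.smul_sum, smul_comm _ (c _) (a _), h.1]

theorem mem_relationSystem_iff (hI : I.Describes a a' b f) (hS : IsRingOfScalars f S) {r : ℕ}
    {d : Fin r → I.Tup} {g : Fin r → S} (h₁ : ∀ k, Represents a (g k) (d k).1)
    (h₂ : ∀ k, Represents a' (g k) (d k).2) (x : Fin r → ℤ) :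
    x ∈ I.relationSystem d ↔ ∑ k, x k • g k = 0 := by
  rw [← hS.eq_iff hI]
  refine and_congr (forall_congr' fun k => ?_) (forall_congr' fun k => ?_)
  · rw [← isZero_sub_iff hI.1 (Represents.sum _ fun i => (h₁ i).zsmul (x i)) .zero]
    simp [Matrix.sum_apply, -zsmul_eq_mul]
  · rw [← isZero_sub_iff hI.2.1 (Represents.sum _ fun i => (h₂ i).zsmul (x i)) .zero]
    simp [Matrix.sum_apply, -zsmul_eq_mul]

theorem mem_oneSystem_iff (hI : I.Describes a a' b f) (hS : IsRingOfScalars f S) {r : ℕ}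
    {d : Fin r → I.Tup} {g : Fin r → S} (h₁ : ∀ k, Represents a (g k) (d k).1)
    (h₂ : ∀ k, Represents a' (g k) (d k).2) (x : Fin r → ℤ) :
    x ∈ I.oneSystem d ↔ ∑ k, x k • g k = 1 := by
  rw [← hS.eq_iff hI]
  refine and_congr (forall_congr' fun k => ?_) (forall_congr' fun k => ?_)
  · rw [← isZero_sub_iff hI.1 (Represents.sum _ fun i => (h₁ i).zsmul (x i)) .one]
    simp [Matrix.sum_apply, -zsmul_eq_mul]
  · rw [← isZero_sub_iff hI.2.1 (Represents.sum _ fun i => (h₂ i).zsmul (x i)) .one]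
    simp [Matrix.sum_apply, -zsmul_eq_mul]

theorem mem_mulSystem_iff (hI : I.Describes a a' b f) (hS : IsRingOfScalars f S) {r : ℕ}
    {d : Fin r → I.Tup} {g : Fin r → S} (h₁ : ∀ k, Represents a (g k) (d k).1)
    (h₂ : ∀ k, Represents a' (g k) (d k).2) (i j : Fin r) (x : Fin r → ℤ) :
    x ∈ I.mulSystem d i j ↔ g i * g j = ∑ k, x k • g k := by
  rw [← hS.eq_iff hI, mul_comm (g i)]
  refine and_congr (forall_congr' fun k => ?_) (forall_congr' fun k => ?_)
  · rw [← isZero_sub_iff hI.1 ((h₁ j).mul (h₁ i))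
      (Represents.sum _ fun i => (h₁ i).zsmul (x i))]
    simp [Matrix.sum_apply, Matrix.mul_apply, -zsmul_eq_mul]
  · rw [← isZero_sub_iff hI.2.1 ((h₂ j).mul (h₂ i))
      (Represents.sum _ fun i => (h₂ i).zsmul (x i))]
    simp [Matrix.sum_apply, Matrix.mul_apply, -zsmul_eq_mul]

theorem IsZBasis.mem {V : Type*} [AddCommGroup V] {k : ℕ} {b : Fin k → V} {X : Set V}
    (h : IsZBasis b X) (i : Fin k) : b i ∈ X :=
  h.2 ▸ Submodule.subset_span (Set.mem_range_self i)

/-- The data of a run satisfy the linear conditions, that is, all conditions of `Run.IsValid` but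
the one on the polynomials `e`. -/
def Run.IsLinear (R : Run I) : Prop :=
  IsZBasis R.δ (I.endSystem ∩ I.symSystem) ∧
  IsZBasis R.z I.valueSystem ∧
  IsZBasis R.d (I.endSystem ∩ I.symSystem ∩ I.cenSystem R.δ ∩ I.wellDefSystem R.z) ∧
  IsZBasis R.w (I.relationSystem R.d) ∧
  R.v ∈ I.oneSystem R.d ∧
  ∀ i j, R.t i j ∈ I.mulSystem R.d i j

/-- The tuples `d` describe additive generators of the maximal ring of scalars. -/
theorem exists_scalar_generators (hI : I.Describes a a' b f) (hf : IsFull f)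
    (hn : IsNondegenerate f) (hS : IsMaximalRingOfScalars f S) {q q' r : ℕ} {δ : Fin q → I.Tup}
    (hδ : IsZBasis δ (I.endSystem ∩ I.symSystem)) {z : Fin q' → Matrix (Fin I.n) (Fin I.p) ℤ}
    (hz : IsZBasis z I.valueSystem) {d : Fin r → I.Tup}
    (hd : IsZBasis d (I.endSystem ∩ I.symSystem ∩ I.cenSystem δ ∩ I.wellDefSystem z)) :
    ∃ g : Fin r → S, (∀ k, Represents a (g k) (d k).1) ∧ (∀ k, Represents a' (g k) (d k).2) ∧
      ∀ s, ∃ x : Fin r → ℤ, s = ∑ k, x k • g k := by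
  have hmem := mem_scalarSystem_iff hI hf hn hS hδ.mem hz.2
  choose g h₁ h₂ using fun k => (hmem (d k)).1 (hd.mem k)
  refine ⟨g, h₁, h₂, fun s => ?_⟩
  obtain ⟨A, hA⟩ := exists_represents hI.1.1 s
  obtain ⟨A', hA'⟩ := exists_represents hI.2.1.1 s
  have hx : (A, A') ∈ Submodule.span ℤ (Set.range d) := by
    rw [← SetLike.mem_coe, hd.2, hmem]
    exact ⟨s, hA, hA'⟩
  obtain ⟨x, hx⟩ := (Submodule.mem_span_range_iff_exists_fun ℤ).1 hx
  refine ⟨x, hS.1.1.eq_of_smul_eq_smul (hA.smul_congr ?_ hI.1.1)⟩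
  have : A = ∑ k, x k • (d k).1 := by
    have := congrArg Prod.fst hx
    simpa [Prod.fst_sum] using this.symm
  rw [this]
  exact Represents.sum _ fun i => (h₁ i).zsmul (x i)

theorem Run.IsLinear.exists_isRingPresentation {R : Run I} (hR : R.IsLinear)
    (hI : I.Describes a a' b f) (hf : IsFull f) (hn : IsNondegenerate f)
    (hS : IsMaximalRingOfScalars f S) :
    ∃ g : Fin R.r → S, (∀ k, Represents a (g k) (R.d k).1) ∧
      (∀ k, Represents a' (g k) (R.d k).2) ∧ IsRingPresentation g R.w R.v R.t := by
  obtain ⟨hδ, hz, hd, hw, hv, ht⟩ := hR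
  obtain ⟨g, h₁, h₂, hgen⟩ := exists_scalar_generators hI hf hn hS hδ hz hd
  refine ⟨g, h₁, h₂, hgen, fun x => ?_, (mem_oneSystem_iff hI hS.1 h₁ h₂ _).1 hv, fun i j =>
    (mem_mulSystem_iff hI hS.1 h₁ h₂ i j _).1 (ht i j)⟩
  rw [← mem_relationSystem_iff hI hS.1 h₁ h₂, ← hw.2, SetLike.mem_coe]

theorem coe_closure_range_smul {N : Type*} [AddCommGroup N] [Module S N] {ι : Type*} {c : ι → N}
    (hc : AddSubgroup.closure (Set.range c) = ⊤) (ε : S) :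
    (AddSubgroup.closure (Set.range fun j => ε • c j) : Set N) = Set.range fun x => ε • x := by
  have : (Set.range fun j => ε • c j) = DistribSMul.toAddMonoidHom N ε '' Set.range c := by
    rw [← Set.range_comp]
    rfl
  rw [this, ← AddMonoidHom.map_closure, hc, ← AddMonoidHom.range_eq_map]
  rfl

theorem closure_range_eq_top {N : Type*} [AddCommGroup N] {ι : Type*} [Fintype ι] {c : ι → N}
    (hc : ∀ x : N, ∃ n : ι → ℤ, x = ∑ i, n i • c i) : AddSubgroup.closure (Set.range c) = ⊤ := by
  refine eq_top_iff.2 fun x _ => ?_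
  obtain ⟨n, rfl⟩ := hc x
  exact AddSubgroup.sum_mem _ fun i _ =>
    AddSubgroup.zsmul_mem _ (AddSubgroup.subset_closure (Set.mem_range_self i)) _

/-- The results of a run are correct: the values of the polynomials `e` are the primitive
idempotents `ε` of the maximal ring of scalars, and the rows of the matrices `E`, `E'` are the
coordinates of generators of `ε N₁` and `ε N₂`. -/
theorem Run.IsValid.correct {R : Run I} (hR : R.IsValid) (hI : I.Describes a a' b f)
    (hf : IsFull f) (hn : IsNondegenerate f) (hS : IsMaximalRingOfScalars f S) :
    ∃ g : Fin R.r → S,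
      (∀ k i, g k • a i = ∑ j, (R.d k).1 i j • a j) ∧
      (∀ k i, g k • a' i = ∑ j, (R.d k).2 i j • a' j) ∧
      AddSubgroup.closure (Set.range g) = ⊤ ∧
      Function.Surjective (MvPolynomial.aeval (R := ℤ) g) ∧
      RingHom.ker (MvPolynomial.aeval (R := ℤ) g) = R.ideal ∧
      (∀ i j k, f (R.gen₁ a i j) (R.gen₂ a' i k) = ∑ κ, R.outS i j k κ • b κ) ∧
      ∃ F : ∀ i, R.out₁ a i →+ R.out₂ a' i →+ R.outM a a' f i,
        (∀ i x y, (F i x y : M) = f x y) ∧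
        IsCanonicalDecomposition f S
          (fun i => MvPolynomial.aeval (R := ℤ) g (R.e i).toPoly)
          (R.out₁ a) (R.out₂ a') (R.outM a a' f) F ∧
        ∀ i, IsFull (F i) ∧ IsNondegenerate (F i) ∧ ¬ IsTrivialMap (F i) ∧
          IsDirectlyIndecomposable (F i) := by
  obtain ⟨hδ, hz, hd, hw, hv, ht, he⟩ := hR
  have hlin : R.IsLinear := ⟨hδ, hz, hd, hw, hv, ht⟩
  obtain ⟨g, h₁, h₂, hg⟩ := hlin.exists_isRingPresentation hI hf hn hS
  refine ⟨g, h₁, h₂, closure_range_eq_top hg.gen, hg.aeval_surjective, hg.ker_aeval,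
    fun i j k => hI.map_sum_sum _ _, ?_⟩
  have hε := hg.isIdempotentStep_iff.1 he
  have hgen₁ : ∀ i j, R.gen₁ a i j = MvPolynomial.aeval (R := ℤ) g (R.e i).toPoly • a j :=
    fun i j => (Represents.evalMat h₁ (R.e i) j).symm
  have hgen₂ : ∀ i j, R.gen₂ a' i j = MvPolynomial.aeval (R := ℤ) g (R.e i).toPoly • a' j :=
    fun i j => (Represents.evalMat h₂ (R.e i) j).symm
  refine exists_isCanonicalDecomposition hS hf hn hε (fun i => ?_) (fun i => ?_) (fun i => ?_)
  · simp only [Run.out₁, funext (hgen₁ i)]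
    exact coe_closure_range_smul (closure_range_eq_top hI.1.1) _
  · simp only [Run.out₂, funext (hgen₂ i)]
    exact coe_closure_range_smul (closure_range_eq_top hI.2.1.1) _
  · have hid := hε.1.idem i
    have : ∀ j k, f (R.gen₁ a i j) (R.gen₂ a' i k) =
        MvPolynomial.aeval (R := ℤ) g (R.e i).toPoly • f (a j) (a' k) := fun j k => by
      rw [hgen₁, hgen₂, (hS.1.2.2.2 _ _ _).1, (hS.1.2.2.2 _ _ _).2, smul_smul, hid.eq]
    simp only [Run.outM, this]
    exact coe_closure_range_smul
      (c := fun jk : Fin I.n × Fin I.p => f (a jk.1) (a' jk.2))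
      (closure_range_eq_top (hI.exists_sum_value hf)) _

end Presentation

/-! ### Certificates for bases of solutions -/

section BasisCertificates

theorem Relations.isZero_iff {h : ℕ} (P : Relations h) {c : Fin h → ℤ} {w : ℕ → ℕ → ℤ}
    {x : ℕ → ℤ} (hw : ∀ l j, w (l : Fin P.num) (j : Fin h) = P.rel l j)
    (hx : ∀ j : Fin h, x j = c j) : P.IsZero c ↔ IsRel h P.num w x := by
  rw [Relations.IsZero, Submodule.mem_span_range_iff_exists_fun, isRel_iff_exists]
  constructor
  · rintro ⟨z, rfl⟩
    refine ⟨extend z, fun k hk => ?_⟩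
    rw [hx ⟨k, hk⟩, Finset.sum_range]
    simp only [Finset.sum_apply, Pi.smul_apply, smul_eq_mul]
    exact Finset.sum_congr rfl fun l _ => by rw [extend_coe, ← hw]
  · rintro ⟨z, hz⟩
    refine ⟨fun l => z l, funext fun j => ?_⟩
    rw [← hx, hz j j.2, Finset.sum_range]
    simp only [Finset.sum_apply, Pi.smul_apply, smul_eq_mul, hw]

theorem solves_iff {N Q : ℕ} {dim num : ℕ → ℕ} {A rel : ℕ → ℕ → ℕ → ℤ} {x : ℕ → ℤ} :
    Solves N Q dim num A rel x ↔ ∀ q < Q, IsRel (dim q) (num q) (rel q) fun j =>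
      ∑ v ∈ Finset.range N, A q j v * x v := by
  simp only [isRel_iff_exists]
  rfl

/-- Labels of the equations of a linear system. -/
abbrev EqLabel : Type := ℕ × ℕ × ℕ × ℕ

/-- The vectors `b 0, …, b (T - 1)` form a basis of the solutions `x` of the system that consists
of the conditions "`(∑ᵥ A q j v * x v)_j` is an integer combination of the relations `rel q`" with
labels `q` in the list `eqs`. -/
def BasisCert (N : ℕ) (eqs : List EqLabel) (dim num : EqLabel → ℕ) (A rel : EqLabel → ℕ → ℕ → ℤ)
    (T : ℕ) (b : ℕ → ℕ → ℤ) : Prop :=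
  (∀ i < T, ∀ q < eqs.length, IsRel (dim (eqs.getD q 0)) (num (eqs.getD q 0))
    (rel (eqs.getD q 0)) fun j => ∑ v ∈ Finset.range N, A (eqs.getD q 0) j v * b i v) ∧
  IndepOn T N b ∧
  Spanned N eqs.length (fun q => dim (eqs.getD q 0)) (fun q => num (eqs.getD q 0))
    (fun q => A (eqs.getD q 0)) (fun q => rel (eqs.getD q 0)) T b

theorem Semi.basisCert {α : Type} [Primcodable α] {N : α → ℕ} {eqs : α → List EqLabel}
    {dim num : α → EqLabel → ℕ} {A rel : α → EqLabel → ℕ → ℕ → ℤ} {T : α → ℕ}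
    {b : α → ℕ → ℕ → ℤ} (hN : Primrec N) (heqs : Primrec eqs)
    (hdim : Primrec fun x : α × EqLabel => dim x.1 x.2)
    (hnum : Primrec fun x : α × EqLabel => num x.1 x.2)
    (hA : Primrec fun x : α × EqLabel × ℕ × ℕ => A x.1 x.2.1 x.2.2.1 x.2.2.2)
    (hrel : Primrec fun x : α × EqLabel × ℕ × ℕ => rel x.1 x.2.1 x.2.2.1 x.2.2.2)
    (hT : Primrec T) (hb : Primrec fun x : α × ℕ × ℕ => b x.1 x.2.1 x.2.2) :
    Semi fun a => BasisCert (N a) (eqs a) (dim a) (num a) (A a) (rel a) (T a) (b a) := by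
  unfold BasisCert
  refine and ?_ (and ?_ ?_)
  · refine ball (by fun_prop) ?_
    refine ball (by fun_prop) ?_
    exact isRel (by fun_prop) (by fun_prop) (by fun_prop) (by fun_prop)
  · exact indepOn (by fun_prop) (by fun_prop) (by fun_prop)
  · exact spanned (by fun_prop) (by fun_prop) (by fun_prop) (by fun_prop) (by fun_prop)
      (by fun_prop) (by fun_prop) (by fun_prop)

theorem forall_getD_iff {κ : Type*} (L : List κ) (d : κ) (p : κ → Prop) :
    (∀ q < L.length, p (L.getD q d)) ↔ ∀ k ∈ L, p k := by
  rw [List.forall_mem_iff_getElem]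
  refine forall_congr' fun q => forall_congr' fun hq => ?_
  rw [List.getD_eq_getElem _ _ hq]

variable {V : Type*} [AddCommGroup V] {N : ℕ} (e : V ≃ₗ[ℤ] (Fin N → ℤ)) {eqs : List EqLabel}
  {dim num : EqLabel → ℕ} {A rel : EqLabel → ℕ → ℕ → ℤ} {X : Set V}

/-- With `V` identified with `ℤ ^ N`, to be a basis of the solutions of a system of label-indexed
equations is the conjunction of being solutions, of independence, and of spanning. -/
theorem isZBasis_iff_basisCert
    (hX : ∀ x, x ∈ X ↔ ∀ q ∈ eqs, IsRel (dim q) (num q) (rel q) fun j =>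
      ∑ v : Fin N, A q j v * e x v) {T : ℕ} {B : Fin T → V} {b : ℕ → ℕ → ℤ}
    (hb : ∀ i u, b (i : Fin T) (u : Fin N) = e (B i) u) :
    IsZBasis B X ↔ BasisCert N eqs dim num A rel T b := by
  have hX' : ∀ (x : V) (y : ℕ → ℤ), (∀ u : Fin N, y u = e x u) → (x ∈ X ↔
      Solves N eqs.length (fun q => dim (eqs.getD q 0)) (fun q => num (eqs.getD q 0))
        (fun q => A (eqs.getD q 0)) (fun q => rel (eqs.getD q 0)) y) := by
    intro x y hy
    rw [hX, solves_iff, ← forall_getD_iff eqs 0]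
    simp only [Finset.sum_range, hy]
  have h1 : (∀ i, B i ∈ X) ↔ ∀ i < T, ∀ q < eqs.length, IsRel (dim (eqs.getD q 0))
      (num (eqs.getD q 0)) (rel (eqs.getD q 0)) fun j =>
        ∑ v ∈ Finset.range N, A (eqs.getD q 0) j v * b i v := by
    rw [Fin.forall_iff]
    exact forall_congr' fun i => forall_congr' fun hi => by rw [hX' _ _ (hb ⟨i, hi⟩), solves_iff]
  have hsum : ∀ (n : Fin T → ℤ) (u : Fin N), e (∑ i, n i • B i) u =
      ∑ i ∈ Finset.range T, extend n i * b i u := by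
    intro n u
    rw [Finset.sum_range]
    simp [hb]
  have h2 : LinearIndependent ℤ B ↔ IndepOn T N b := by
    rw [Fintype.linearIndependent_iff]
    constructor
    · intro h n hn i hi
      refine h (fun i => n i) (e.injective (funext fun u => ?_)) ⟨i, hi⟩
      rw [hsum, map_zero, Pi.zero_apply, ← hn u u.2]
      exact Finset.sum_congr rfl fun i hi => by rw [extend_of_lt _ (by simpa using hi)]
    · intro h n hn i
      rw [← extend_coe n i]
      refine h (extend n) (fun u hu => ?_) i i.2
      have := hsum n ⟨u, hu⟩
      rw [hn, map_zero] at this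
      exact this.symm
  have h3 : X ⊆ Submodule.span ℤ (Set.range B) ↔ Spanned N eqs.length
      (fun q => dim (eqs.getD q 0)) (fun q => num (eqs.getD q 0)) (fun q => A (eqs.getD q 0))
      (fun q => rel (eqs.getD q 0)) T b := by
    constructor
    · intro h y hy
      have hx := h ((hX' (e.symm fun u => y u) y (by simp)).2 hy)
      obtain ⟨n, hn⟩ := (Submodule.mem_span_range_iff_exists_fun ℤ).1 hx
      refine ⟨extend n, fun u hu => ?_⟩
      rw [← hsum n ⟨u, hu⟩, hn]
      simp
    · intro h x hx
      obtain ⟨n, hn⟩ := h (extend (e x)) ((hX' x _ fun u => extend_coe _ u).1 hx)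
      refine (Submodule.mem_span_range_iff_exists_fun ℤ).2 ⟨fun i => n i,
        e.injective (funext fun u => ?_)⟩
      rw [hsum, ← extend_coe (e x) u, hn u u.2]
      exact Finset.sum_congr rfl fun i hi => by rw [extend_of_lt _ (by simpa using hi)]
  -- the solutions form a subgroup
  have h4 : (∀ i, B i ∈ X) → (Submodule.span ℤ (Set.range B) : Set V) ⊆ X := by
    intro hB x hx
    obtain ⟨n, rfl⟩ := (Submodule.mem_span_range_iff_exists_fun ℤ).1 hx
    rw [hX' _ (fun u => ∑ i ∈ Finset.range T, extend n i * b i u) fun u => (hsum n u).symm]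
    intro q hq
    choose y hy using fun i => (hX' _ _ (hb i)).1 (hB i) q hq
    refine ⟨fun l => ∑ i, n i * y i l, fun j hj => ?_⟩
    simp only [Finset.sum_mul, mul_assoc, Finset.sum_range (n := T), extend_coe]
    rw [Finset.sum_comm]
    simp only [← Finset.mul_sum, ← hy _ j hj]
    simp only [Finset.mul_sum]
    rw [Finset.sum_comm]
    exact Finset.sum_congr rfl fun i _ => Finset.sum_congr rfl fun v _ => by ring
  unfold BasisCert
  rw [← h1, ← h2, ← h3]
  exact ⟨fun h => ⟨h.mem, h.1, h.2.symm.subset⟩, fun h => ⟨h.2.1, (h4 h.1).antisymm h.2.2⟩⟩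

/-- The solutions of a homogeneous linear system over finitely presented groups have a basis. -/
theorem exists_isZBasis
    (hX : ∀ x, x ∈ X ↔ ∀ q ∈ eqs, IsRel (dim q) (num q) (rel q) fun j =>
      ∑ v : Fin N, A q j v * e x v) : ∃ (T : ℕ) (B : Fin T → V), IsZBasis B X := by
  simp only [isRel_iff_exists] at hX
  let W : Submodule ℤ V :=
    { carrier := X
      zero_mem' := by
        rw [hX]
        exact fun q _ => ⟨0, fun k _ => by simp⟩
      add_mem' := fun {x y} hx hy => by
        rw [hX] at hx hy ⊢
        intro q hq
        obtain ⟨z, hz⟩ := hx q hq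
        obtain ⟨z', hz'⟩ := hy q hq
        refine ⟨z + z', fun k hk => ?_⟩
        simp only [map_add, Pi.add_apply, mul_add, add_mul, Finset.sum_add_distrib, hz k hk,
          hz' k hk]
      smul_mem' := fun n x hx => by
        rw [hX] at hx ⊢
        intro q hq
        obtain ⟨z, hz⟩ := hx q hq
        refine ⟨n • z, fun k hk => ?_⟩
        simp only [map_smul, Pi.smul_apply, smul_eq_mul, mul_left_comm _ n, mul_assoc,
          ← Finset.mul_sum, hz k hk] }
  have : Module.Free ℤ V := Module.Free.of_equiv e.symm
  have : Module.Finite ℤ V := Module.Finite.equiv e.symm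
  obtain ⟨T, B⟩ := Submodule.basisOfPid (Module.Free.chooseBasis ℤ V) W
  refine ⟨T, fun i => B i, B.linearIndependent.map' W.subtype (Submodule.ker_subtype W), ?_⟩
  have : Set.range (fun i => (B i : V)) = W.subtype '' Set.range B := by
    rw [← Set.range_comp]
    rfl
  rw [this, Submodule.span_image, B.span_eq, Submodule.map_top, Submodule.range_subtype]
  rfl

end BasisCertificates

/-! ### Access to the encoded input and to the data of a run -/

section Encoding

/-- The entry `(i, j)` of an encoded matrix. -/
def entry₂ (A : MatCode) (i j : ℕ) : ℤ := (A.getD i []).getD j 0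

/-- The entry `(i, j, k)` of an encoded tensor. -/
def entry₃ (A : TensorCode) (i j k : ℕ) : ℤ := entry₂ (A.getD i []) j k

/-- The number of generators of `N₁`, `N₂` or `M`, for `T = 0`, `T = 1` or `T ≥ 2`. -/
def codeDim (c : InputCode) (T : ℕ) : ℕ :=
  if T = 0 then c.1.1 else if T = 1 then c.1.2.1 else c.1.2.2

/-- The relations of `N₁`, `N₂` or `M`, for `T = 0`, `T = 1` or `T ≥ 2`. -/
def codeRels (c : InputCode) (T : ℕ) : MatCode :=
  if T = 0 then c.2.1 else if T = 1 then c.2.2.1 else c.2.2.2.1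

/-- The number of relations of `N₁`, `N₂` or `M`, for `T = 0`, `T = 1` or `T ≥ 2`. -/
def codeNum (c : InputCode) (T : ℕ) : ℕ := (codeRels c T).length

/-- The `j`-th coefficient of the `l`-th relation of `N₁`, `N₂` or `M`. -/
def codeRel (c : InputCode) (T l j : ℕ) : ℤ := entry₂ (codeRels c T) l j

/-- The structure constants. -/
def codeS (c : InputCode) (i j κ : ℕ) : ℤ := entry₃ c.2.2.2.2 i j κ

/-- The sizes of the arrays that form a run, stored in the list `D`: those of `δ`, `z`, `d`, `w`,
`e` for `i = 0, …, 4`. -/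
def rawSize (D : List ℤ) (i : ℕ) : ℕ := (look D (0, i, 0, 0)).toNat

/-- The entries of the array with number `T ≥ 1` stored in the list `D`. The numbers `1` and `2`
stand for the two components of the tuples `δ`, `3` and `4` for those of the tuples `d`, the numbers
from `5` to `8` for `z`, `w`, `v`, `t`, and `9` for the coefficients of the polynomials `e`. -/
def rawEntry (D : List ℤ) (T i j k : ℕ) : ℤ := look D (T, i, j, k)

/-- The label (component, row, column) of the entry with number `v` of a pair of square matrices of
sizes `n` and `p`. The condition says that `v < n * n`. -/
def tupKey (n p v : ℕ) : ℕ × ℕ × ℕ :=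
  if v + 1 - n * n = 0 then (0, v / n, v % n) else (1, (v - n * n) / p, (v - n * n) % p)

section

variable {α : Type} [Primcodable α]

@[fun_prop]
theorem primrec_entry₂ {A : α → MatCode} {i j : α → ℕ} (hA : Primrec A) (hi : Primrec i)
    (hj : Primrec j) : Primrec fun a => entry₂ (A a) (i a) (j a) := by
  unfold entry₂
  fun_prop

@[fun_prop]
theorem primrec_entry₃ {A : α → TensorCode} {i j k : α → ℕ} (hA : Primrec A) (hi : Primrec i)
    (hj : Primrec j) (hk : Primrec k) : Primrec fun a => entry₃ (A a) (i a) (j a) (k a) := by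
  unfold entry₃
  fun_prop

@[fun_prop]
theorem primrec_codeDim {c : α → InputCode} {T : α → ℕ} (hc : Primrec c) (hT : Primrec T) :
    Primrec fun a => codeDim (c a) (T a) := by
  unfold codeDim
  fun_prop

@[fun_prop]
theorem primrec_codeRels {c : α → InputCode} {T : α → ℕ} (hc : Primrec c) (hT : Primrec T) :
    Primrec fun a => codeRels (c a) (T a) := by
  unfold codeRels
  fun_prop

@[fun_prop]
theorem primrec_codeNum {c : α → InputCode} {T : α → ℕ} (hc : Primrec c) (hT : Primrec T) :
    Primrec fun a => codeNum (c a) (T a) := by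
  unfold codeNum
  fun_prop

@[fun_prop]
theorem primrec_codeRel {c : α → InputCode} {T l j : α → ℕ} (hc : Primrec c) (hT : Primrec T)
    (hl : Primrec l) (hj : Primrec j) : Primrec fun a => codeRel (c a) (T a) (l a) (j a) := by
  unfold codeRel
  fun_prop

@[fun_prop]
theorem primrec_codeS {c : α → InputCode} {i j κ : α → ℕ} (hc : Primrec c) (hi : Primrec i)
    (hj : Primrec j) (hκ : Primrec κ) : Primrec fun a => codeS (c a) (i a) (j a) (κ a) := by
  unfold codeS
  fun_prop

@[fun_prop]
theorem primrec_rawSize {D : α → List ℤ} {i : α → ℕ} (hD : Primrec D) (hi : Primrec i) :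
    Primrec fun a => rawSize (D a) (i a) := by
  unfold rawSize
  fun_prop

@[fun_prop]
theorem primrec_rawEntry {D : α → List ℤ} {T i j k : α → ℕ} (hD : Primrec D) (hT : Primrec T)
    (hi : Primrec i) (hj : Primrec j) (hk : Primrec k) :
    Primrec fun a => rawEntry (D a) (T a) (i a) (j a) (k a) := by
  unfold rawEntry
  fun_prop

@[fun_prop]
theorem primrec_tupKey {n p v : α → ℕ} (hn : Primrec n) (hp : Primrec p) (hv : Primrec v) :
    Primrec fun a => tupKey (n a) (p a) (v a) := by
  unfold tupKey
  fun_prop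

end

theorem entry₂_matCode {h k : ℕ} (x : Fin h → Fin k → ℤ) (i : Fin h) (j : Fin k) :
    entry₂ (matCode x) i j = x i j := by
  simp [entry₂, matCode, vecCode, List.getD]

theorem entry₃_tensorCode {g h k : ℕ} (x : Fin g → Fin h → Fin k → ℤ) (i : Fin g) (j : Fin h)
    (l : Fin k) : entry₃ (tensorCode x) i j l = x i j l := by
  have : (tensorCode x).getD i [] = matCode (x i) := by simp [tensorCode, List.getD]
  rw [entry₃, this, entry₂_matCode]

theorem codeS_code (I : Input) (i : Fin I.n) (j : Fin I.p) (κ : Fin I.m) :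
    codeS I.code i j κ = I.s i j κ := entry₃_tensorCode _ _ _ _

theorem codeRel_zero (I : Input) (l : Fin I.rel₁.num) (j : Fin I.n) :
    codeRel I.code 0 l j = I.rel₁.rel l j := entry₂_matCode _ _ _

theorem codeRel_one (I : Input) (l : Fin I.rel₂.num) (j : Fin I.p) :
    codeRel I.code 1 l j = I.rel₂.rel l j := entry₂_matCode _ _ _

theorem codeRel_of_two_le (I : Input) {T : ℕ} (hT : 2 ≤ T) (l : Fin I.relM.num) (j : Fin I.m) :
    codeRel I.code T l j = I.relM.rel l j := by
  obtain ⟨T, rfl⟩ := Nat.exists_eq_add_of_le' hT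
  exact entry₂_matCode _ _ _

theorem codeNum_zero (I : Input) : codeNum I.code 0 = I.rel₁.num := List.length_ofFn

theorem codeNum_one (I : Input) : codeNum I.code 1 = I.rel₂.num := List.length_ofFn

theorem codeNum_of_two_le (I : Input) {T : ℕ} (hT : 2 ≤ T) : codeNum I.code T = I.relM.num := by
  obtain ⟨T, rfl⟩ := Nat.exists_eq_add_of_le' hT
  exact List.length_ofFn

theorem codeDim_of_two_le (I : Input) {T : ℕ} (hT : 2 ≤ T) : codeDim I.code T = I.m := by
  obtain ⟨T, rfl⟩ := Nat.exists_eq_add_of_le' hT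
  rfl

/-- The vector `x` represents zero in `N₁`, `N₂` or `M`, for `T = 0`, `T = 1` or `T ≥ 2`. -/
def CodeZero (c : InputCode) (T : ℕ) (x : ℕ → ℤ) : Prop :=
  IsRel (codeDim c T) (codeNum c T) (codeRel c T) x

theorem isZero_rel₁_iff (I : Input) {c : Fin I.n → ℤ} {x : ℕ → ℤ} (hx : ∀ j : Fin I.n, x j = c j) :
    I.rel₁.IsZero c ↔ CodeZero I.code 0 x := by
  rw [CodeZero, codeNum_zero, Relations.isZero_iff _ (codeRel_zero I) hx]
  rfl

theorem isZero_rel₂_iff (I : Input) {c : Fin I.p → ℤ} {x : ℕ → ℤ} (hx : ∀ j : Fin I.p, x j = c j) :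
    I.rel₂.IsZero c ↔ CodeZero I.code 1 x := by
  rw [CodeZero, codeNum_one, Relations.isZero_iff _ (codeRel_one I) hx]
  rfl

theorem isZero_relM_iff (I : Input) {T : ℕ} (hT : 2 ≤ T) {c : Fin I.m → ℤ} {x : ℕ → ℤ}
    (hx : ∀ j : Fin I.m, x j = c j) : I.relM.IsZero c ↔ CodeZero I.code T x := by
  rw [CodeZero, codeNum_of_two_le I hT, codeDim_of_two_le I hT,
    Relations.isZero_iff _ (codeRel_of_two_le I hT) hx]

/-- The numbering of the entries of pairs of square matrices. -/
def tupIndex (n p : ℕ) : Fin (n * n + p * p) ≃ (Fin n × Fin n) ⊕ (Fin p × Fin p) :=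
  finSumFinEquiv.symm.trans (Equiv.sumCongr finProdFinEquiv.symm finProdFinEquiv.symm)

/-- Pairs of square matrices as vectors. -/
def tupEquiv (I : Input) : I.Tup ≃ₗ[ℤ] (Fin (I.n * I.n + I.p * I.p) → ℤ) :=
  LinearEquiv.trans
    { toFun := fun x => Sum.elim (fun ij => x.1 ij.1 ij.2) (fun ij => x.2 ij.1 ij.2)
      invFun := fun y =>
        (Matrix.of fun i j => y (Sum.inl (i, j)), Matrix.of fun i j => y (Sum.inr (i, j)))
      map_add' := fun x y => by ext (_ | _) <;> rfl
      map_smul' := fun n x => by ext (_ | _) <;> rfl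
      left_inv := fun x => rfl
      right_inv := fun y => by ext (_ | _) <;> rfl }
    (LinearEquiv.funCongrLeft ℤ ℤ (tupIndex I.n I.p))

theorem tupKey_inl (n p : ℕ) (i j : Fin n) :
    tupKey n p ((tupIndex n p).symm (Sum.inl (i, j))) = (0, (i : ℕ), (j : ℕ)) := by
  have h1 : (((tupIndex n p).symm (Sum.inl (i, j)) : Fin _) : ℕ) = j + n * i := rfl
  have h2 : (j : ℕ) + n * i < n * n := (finProdFinEquiv (i, j)).2
  have hn : 0 < n := i.pos
  rw [h1, tupKey, if_pos (by omega), Nat.add_mul_div_left _ _ hn, Nat.div_eq_of_lt j.2,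
    Nat.add_mul_mod_self_left, Nat.mod_eq_of_lt j.2, zero_add]

theorem tupKey_inr (n p : ℕ) (i j : Fin p) :
    tupKey n p ((tupIndex n p).symm (Sum.inr (i, j))) = (1, (i : ℕ), (j : ℕ)) := by
  have h1 : (((tupIndex n p).symm (Sum.inr (i, j)) : Fin _) : ℕ) = n * n + (j + p * i) := rfl
  have hp : 0 < p := i.pos
  rw [h1, tupKey, if_neg (by omega), Nat.add_sub_cancel_left, Nat.add_mul_div_left _ _ hp,
    Nat.div_eq_of_lt j.2, Nat.add_mul_mod_self_left, Nat.mod_eq_of_lt j.2, zero_add]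

theorem tupEquiv_inl (I : Input) (x : I.Tup) (i j : Fin I.n) :
    tupEquiv I x ((tupIndex I.n I.p).symm (Sum.inl (i, j))) = x.1 i j := by
  change Sum.elim (fun ij : Fin I.n × Fin I.n => x.1 ij.1 ij.2)
    (fun ij : Fin I.p × Fin I.p => x.2 ij.1 ij.2)
    (tupIndex _ _ ((tupIndex I.n I.p).symm (Sum.inl (i, j)))) = _
  rw [Equiv.apply_symm_apply, Sum.elim_inl]

theorem tupEquiv_inr (I : Input) (x : I.Tup) (i j : Fin I.p) :
    tupEquiv I x ((tupIndex I.n I.p).symm (Sum.inr (i, j))) = x.2 i j := by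
  change Sum.elim (fun ij : Fin I.n × Fin I.n => x.1 ij.1 ij.2)
    (fun ij : Fin I.p × Fin I.p => x.2 ij.1 ij.2)
    (tupIndex _ _ ((tupIndex I.n I.p).symm (Sum.inr (i, j)))) = _
  rw [Equiv.apply_symm_apply, Sum.elim_inr]

theorem sum_tupKey_mul (I : Input) (C : ℕ × ℕ × ℕ → ℤ) (x : I.Tup) :
    ∑ v, C (tupKey I.n I.p (v : Fin (I.n * I.n + I.p * I.p))) * tupEquiv I x v =
      (∑ i : Fin I.n, ∑ j : Fin I.n, C (0, i, j) * x.1 i j) +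
        ∑ i : Fin I.p, ∑ j : Fin I.p, C (1, i, j) * x.2 i j := by
  rw [← (tupIndex I.n I.p).symm.sum_comp, Fintype.sum_sum_type, Fintype.sum_prod_type,
    Fintype.sum_prod_type]
  simp only [tupKey_inl, tupKey_inr, tupEquiv_inl, tupEquiv_inr]

theorem tupEquiv_apply_of_key (I : Input) (x : I.Tup) (C : ℕ × ℕ × ℕ → ℤ)
    (h₁ : ∀ i j : Fin I.n, C (0, i, j) = x.1 i j) (h₂ : ∀ i j : Fin I.p, C (1, i, j) = x.2 i j)
    (v : Fin (I.n * I.n + I.p * I.p)) : C (tupKey I.n I.p v) = tupEquiv I x v := by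
  obtain ⟨k, rfl⟩ := (tupIndex I.n I.p).symm.surjective v
  rcases k with ⟨i, j⟩ | ⟨i, j⟩
  · rw [tupKey_inl, h₁, tupEquiv_inl]
  · rw [tupKey_inr, h₂, tupEquiv_inr]

/-- Matrices as vectors. -/
def matEquiv (n p : ℕ) : Matrix (Fin n) (Fin p) ℤ ≃ₗ[ℤ] (Fin (n * p) → ℤ) :=
  LinearEquiv.trans
    { toFun := fun x ij => x ij.1 ij.2
      invFun := fun y => Matrix.of fun i j => y (i, j)
      map_add' := fun _ _ => rfl
      map_smul' := fun _ _ => rfl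
      left_inv := fun _ => rfl
      right_inv := fun _ => rfl }
    (LinearEquiv.funCongrLeft ℤ ℤ finProdFinEquiv.symm)

/-- The run whose data are stored in the list `D`; the polynomials `e` are linear forms. -/
def toRun (I : Input) (D : List ℤ) : Run I where
  numδ := rawSize D 0
  δ := fun π => (Matrix.of fun i j => rawEntry D 1 π i j, Matrix.of fun i j => rawEntry D 2 π i j)
  numz := rawSize D 1
  z := fun k => Matrix.of fun i j => rawEntry D 5 k i j
  r := rawSize D 2
  d := fun k => (Matrix.of fun i j => rawEntry D 3 k i j, Matrix.of fun i j => rawEntry D 4 k i j)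
  ρ := rawSize D 3
  w := fun l k => rawEntry D 6 l k 0
  v := fun k => rawEntry D 7 k 0 0
  t := fun i j k => rawEntry D 8 i j k
  ℓ := rawSize D 4
  e := fun i => List.ofFn fun k => (Pi.single k 1, rawEntry D 9 i k 0)

/-! ### The linear systems in terms of the encoded data -/

/-- The labels of the equations that define the systems `endSystem` and `symSystem`. The first
component of a label tells the system and, through `codeDim` and the like, the group in which the
equation holds: `0` and `1` stand for the two parts of `endSystem`, `2` for `symSystem`, `3` for
`cenSystem`, and `4` for `wellDefSystem`. -/
def tupEqs (c : InputCode) : List EqLabel :=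
  (List.range (codeNum c 0)).map (fun k => (0, k, 0, 0)) ++
    ((List.range (codeNum c 1)).map (fun k => (1, k, 0, 0)) ++
      (List.range (codeDim c 0)).flatMap fun k =>
        (List.range (codeDim c 1)).map fun l => (2, k, l, 0))

/-- The labels of all equations for the generators of the maximal ring of scalars. -/
def scalarEqs (c : InputCode) (numδ numz : ℕ) : List EqLabel :=
  tupEqs c ++
    (((List.range numδ).flatMap fun π => (List.range (codeDim c 0)).flatMap fun k =>
        (List.range (codeDim c 1)).map fun l => (3, k, l, π)) ++
      (List.range numz).map fun k => (4, k, 0, 0))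

/-- The coefficient of the variable with label `k` (component, row, column) in the `j`-th coordinate
of the equation with label `q`. -/
def tupCoef (c : InputCode) (D : List ℤ) (q : EqLabel) (j : ℕ) (k : ℕ × ℕ × ℕ) : ℤ :=
  if q.1 = 0 then
    if k.1 = 0 then if k.2.2 = j then codeRel c 0 q.2.1 k.2.1 else 0 else 0
  else if q.1 = 1 then
    if k.1 = 1 then if k.2.2 = j then codeRel c 1 q.2.1 k.2.1 else 0 else 0
  else if q.1 = 2 then
    if k.1 = 0 then if k.2.1 = q.2.1 then codeS c k.2.2 q.2.2.1 j else 0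
    else if k.2.1 = q.2.2.1 then -codeS c q.2.1 k.2.2 j else 0
  else if q.1 = 3 then
    if k.1 = 0 then
      if k.2.1 = q.2.1 then ∑ h ∈ Finset.range (codeDim c 1),
        rawEntry D 2 q.2.2.2 q.2.2.1 h * codeS c k.2.2 h j else 0
    else if k.2.1 = q.2.2.1 then -∑ h ∈ Finset.range (codeDim c 0),
      rawEntry D 1 q.2.2.2 q.2.1 h * codeS c h k.2.2 j else 0
  else if k.1 = 0 then ∑ h ∈ Finset.range (codeDim c 1),
      rawEntry D 5 q.2.1 k.2.1 h * codeS c k.2.2 h j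
    else 0

section

variable {α : Type} [Primcodable α]

@[fun_prop]
theorem primrec_tupEqs {c : α → InputCode} (hc : Primrec c) : Primrec fun a => tupEqs (c a) := by
  unfold tupEqs
  fun_prop

@[fun_prop]
theorem primrec_scalarEqs {c : α → InputCode} {m n : α → ℕ} (hc : Primrec c) (hm : Primrec m)
    (hn : Primrec n) : Primrec fun a => scalarEqs (c a) (m a) (n a) := by
  unfold scalarEqs
  fun_prop

set_option maxHeartbeats 1000000 in
@[fun_prop]
theorem primrec_tupCoef {c : α → InputCode} {D : α → List ℤ} {q : α → EqLabel} {j : α → ℕ}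
    {k : α → ℕ × ℕ × ℕ} (hc : Primrec c) (hD : Primrec D) (hq : Primrec q) (hj : Primrec j)
    (hk : Primrec k) : Primrec fun a => tupCoef (c a) (D a) (q a) (j a) (k a) := by
  unfold tupCoef
  fun_prop

end

end Encoding

section Systems

variable (I : Input) (D : List ℤ) (x : I.Tup)

/-- The pair of matrices `x` satisfies the equation with label `q`. -/
def TupSolves (q : EqLabel) : Prop :=
  CodeZero I.code q.1 fun j => ∑ v : Fin (I.n * I.n + I.p * I.p),
    tupCoef I.code D q j (tupKey I.n I.p v) * tupEquiv I x v

theorem tupSolves_zero (k : Fin I.rel₁.num) :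
    I.rel₁.IsZero (fun j => ∑ i, x.1 i j * I.rel₁.rel k i) ↔ TupSolves I D x (0, k, 0, 0) := by
  refine isZero_rel₁_iff I fun j => ?_
  rw [sum_tupKey_mul I (tupCoef I.code D _ j)]
  simp [tupCoef, Fin.val_inj, codeRel_zero, mul_comm]

theorem tupSolves_one (k : Fin I.rel₂.num) :
    I.rel₂.IsZero (fun j => ∑ i, x.2 i j * I.rel₂.rel k i) ↔ TupSolves I D x (1, k, 0, 0) := by
  refine isZero_rel₂_iff I fun j => ?_
  rw [sum_tupKey_mul I (tupCoef I.code D _ j)]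
  simp [tupCoef, Fin.val_inj, codeRel_one, mul_comm]

theorem tupSolves_two (k : Fin I.n) (l : Fin I.p) :
    I.relM.IsZero (fun κ => (∑ i, x.1 k i * I.s i l κ) - ∑ j, x.2 l j * I.s k j κ) ↔
      TupSolves I D x (2, k, l, 0) := by
  refine isZero_relM_iff I le_rfl fun κ => ?_
  rw [sum_tupKey_mul I (tupCoef I.code D _ κ)]
  simp [tupCoef, Fin.val_inj, codeS_code, mul_comm, sub_eq_add_neg]

theorem tupSolves_three (π : Fin (toRun I D).numδ) (k : Fin I.n) (l : Fin I.p) :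
    I.relM.IsZero (fun κ =>
      (∑ i, ∑ j, x.1 k i * ((toRun I D).δ π).2 l j * I.s i j κ) -
        ∑ i, ∑ j, x.2 l j * ((toRun I D).δ π).1 k i * I.s i j κ) ↔
      TupSolves I D x (3, k, l, π) := by
  refine isZero_relM_iff I (by simp) fun κ => ?_
  rw [sum_tupKey_mul I (tupCoef I.code D _ κ)]
  have h0 : codeDim I.code 0 = I.n := rfl
  have h1 : codeDim I.code 1 = I.p := rfl
  simp only [tupCoef, h0, h1, Finset.sum_range, toRun]
  simp [Fin.val_inj, codeS_code, sub_eq_add_neg, Finset.sum_mul]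
  rw [Finset.sum_comm (f := fun i j => x.2 l j * _ * _)]
  congr 1
  · exact Finset.sum_congr rfl fun _ _ => Finset.sum_congr rfl fun _ _ => by ring
  · exact congrArg _ <| Finset.sum_congr rfl fun _ _ => Finset.sum_congr rfl fun _ _ => by ring

theorem tupSolves_four (k : Fin (toRun I D).numz) :
    I.relM.IsZero (fun κ => ∑ i, ∑ l, ∑ j, x.1 i l * (toRun I D).z k i j * I.s l j κ) ↔
      TupSolves I D x (4, k, 0, 0) := by
  refine isZero_relM_iff I (by simp) fun κ => ?_
  rw [sum_tupKey_mul I (tupCoef I.code D _ κ)]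
  have h1 : codeDim I.code 1 = I.p := rfl
  simp only [tupCoef, h1, Finset.sum_range, toRun]
  simp [codeS_code, Finset.sum_mul]
  exact Finset.sum_congr rfl fun _ _ => Finset.sum_congr rfl fun _ _ =>
    Finset.sum_congr rfl fun _ _ => by ring

theorem mem_endSystem_inter_symSystem_iff :
    x ∈ I.endSystem ∩ I.symSystem ↔ ∀ q ∈ tupEqs I.code, TupSolves I D x q := by
  have h0 : codeDim I.code 0 = I.n := rfl
  have h1 : codeDim I.code 1 = I.p := rfl
  simp only [Set.mem_inter_iff, Input.endSystem, Input.symSystem, Set.mem_ofPred_eq,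
    tupSolves_zero I D, tupSolves_one I D, tupSolves_two I D, tupEqs, List.forall_mem_append,
    List.forall_mem_map, List.mem_flatMap, List.mem_range, codeNum_zero, codeNum_one, h0, h1,
    Fin.forall_iff, and_assoc, forall_exists_index, and_imp]
  refine and_congr Iff.rfl (and_congr Iff.rfl ⟨fun h q k hk hq => ?_, fun h k hk l hl => ?_⟩)
  · obtain ⟨l, hl, rfl⟩ := List.mem_map.1 hq
    exact h k hk l (by simpa using hl)
  · exact h _ k hk (List.mem_map.2 ⟨l, by simpa using hl, rfl⟩)

theorem mem_scalarSystem_iff_tupSolves :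
    x ∈ I.endSystem ∩ I.symSystem ∩ I.cenSystem (toRun I D).δ ∩ I.wellDefSystem (toRun I D).z ↔
      ∀ q ∈ scalarEqs I.code (rawSize D 0) (rawSize D 1), TupSolves I D x q := by
  have h0 : codeDim I.code 0 = I.n := rfl
  have h1 : codeDim I.code 1 = I.p := rfl
  rw [Set.inter_assoc, Set.mem_inter_iff, mem_endSystem_inter_symSystem_iff I D, scalarEqs,
    List.forall_mem_append, List.forall_mem_append]
  refine and_congr Iff.rfl ?_
  simp only [Set.mem_inter_iff, Input.cenSystem, Input.wellDefSystem, Set.mem_ofPred_eq,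
    tupSolves_three I D, tupSolves_four I D]
  refine and_congr ⟨fun h q hq => ?_, fun h π k l => h _ ?_⟩
    ⟨fun h q hq => ?_, fun h k => h _ ?_⟩
  · simp only [List.mem_flatMap, List.mem_map, List.mem_range, h0, h1] at hq
    obtain ⟨π, hπ, k, hk, l, hl, rfl⟩ := hq
    exact h ⟨π, hπ⟩ ⟨k, hk⟩ ⟨l, hl⟩
  · simp only [List.mem_flatMap, List.mem_map, List.mem_range, h0, h1]
    exact ⟨π, π.2, k, k.2, l, l.2, rfl⟩
  · simp only [List.mem_map, List.mem_range] at hq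
    obtain ⟨k, hk, rfl⟩ := hq
    exact h ⟨k, hk⟩
  · simp only [List.mem_map, List.mem_range]
    exact ⟨k, k.2, rfl⟩

theorem mem_valueSystem_iff_codeZero (x : Matrix (Fin I.n) (Fin I.p) ℤ) :
    x ∈ I.valueSystem ↔ ∀ q ∈ [((2, 0, 0, 0) : EqLabel)], CodeZero I.code q.1 fun j =>
      ∑ v : Fin (I.n * I.p), codeS I.code (v / I.p) (v % I.p) j * matEquiv I.n I.p x v := by
  simp only [List.forall_mem_singleton]
  refine isZero_relM_iff I le_rfl fun κ => ?_
  rw [← finProdFinEquiv.sum_comp, Fintype.sum_prod_type]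
  refine Finset.sum_congr rfl fun i _ => Finset.sum_congr rfl fun j _ => ?_
  have hp : 0 < I.p := j.pos
  have h1 : ((finProdFinEquiv (i, j) : Fin _) : ℕ) = j + I.p * i := rfl
  have h2 : matEquiv I.n I.p x (finProdFinEquiv (i, j)) = x i j := by
    change x (finProdFinEquiv.symm (finProdFinEquiv (i, j))).1
      (finProdFinEquiv.symm (finProdFinEquiv (i, j))).2 = x i j
    rw [Equiv.symm_apply_apply]
  rw [h2, h1, Nat.add_mul_div_left _ _ hp, Nat.div_eq_of_lt j.2,
    Nat.add_mul_mod_self_left, Nat.mod_eq_of_lt j.2, zero_add, codeS_code, mul_comm]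

/-- The labels of the equations of the system `relationSystem`. -/
def relationEqs (c : InputCode) : List EqLabel :=
  (List.range (codeDim c 0)).map (fun k => (0, k, 0, 0)) ++
    (List.range (codeDim c 1)).map fun k => (1, k, 0, 0)

@[fun_prop]
theorem primrec_relationEqs {α : Type} [Primcodable α] {c : α → InputCode} (hc : Primrec c) :
    Primrec fun a => relationEqs (c a) := by
  unfold relationEqs
  fun_prop

theorem mem_relationSystem_iff_codeZero (x : Fin (toRun I D).r → ℤ) :
    x ∈ I.relationSystem (toRun I D).d ↔ ∀ q ∈ relationEqs I.code, CodeZero I.code q.1 fun j =>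
      ∑ v : Fin (toRun I D).r, rawEntry D (3 + q.1) v q.2.1 j * x v := by
  have h0 : codeDim I.code 0 = I.n := rfl
  have h1 : codeDim I.code 1 = I.p := rfl
  simp only [relationEqs, List.forall_mem_append, List.forall_mem_map, List.mem_range, h0, h1]
  refine and_congr (Fin.forall_iff.trans ?_) (Fin.forall_iff.trans ?_)
  · refine forall_congr' fun k => forall_congr' fun hk => isZero_rel₁_iff I fun j => ?_
    exact Finset.sum_congr rfl fun _ _ => mul_comm _ _
  · refine forall_congr' fun k => forall_congr' fun hk => isZero_rel₂_iff I fun j => ?_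
    exact Finset.sum_congr rfl fun _ _ => mul_comm _ _

theorem forall_lt_two {p : ℕ → Prop} : (∀ T < 2, p T) ↔ p 0 ∧ p 1 := by
  constructor
  · exact fun h => ⟨h 0 (by simp), h 1 (by simp)⟩
  · rintro ⟨h0, h1⟩ T hT
    interval_cases T <;> assumption

/-- The condition on the coefficients `v` of the unit. -/
def OneCert (c : InputCode) (D : List ℤ) : Prop :=
  ∀ T < 2, ∀ k < codeDim c T, CodeZero c T fun j =>
    (∑ i ∈ Finset.range (rawSize D 2), rawEntry D 7 i 0 0 * rawEntry D (3 + T) i k j) -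
      if k = j then 1 else 0

/-- The condition on the structure constants `t` of the multiplication. -/
def MulCert (c : InputCode) (D : List ℤ) : Prop :=
  ∀ i < rawSize D 2, ∀ j < rawSize D 2, ∀ T < 2, ∀ k < codeDim c T, CodeZero c T fun h =>
    (∑ l ∈ Finset.range (codeDim c T), rawEntry D (3 + T) j k l * rawEntry D (3 + T) i l h) -
      ∑ κ ∈ Finset.range (rawSize D 2), rawEntry D 8 i j κ * rawEntry D (3 + T) κ k h

theorem mem_oneSystem_iff_oneCert :
    (toRun I D).v ∈ I.oneSystem (toRun I D).d ↔ OneCert I.code D := by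
  have h0 : codeDim I.code 0 = I.n := rfl
  have h1 : codeDim I.code 1 = I.p := rfl
  simp only [OneCert, forall_lt_two, h0, h1]
  refine and_congr (Fin.forall_iff.trans ?_) (Fin.forall_iff.trans ?_)
  · refine forall_congr' fun k => forall_congr' fun hk => isZero_rel₁_iff I fun j => ?_
    simp [toRun, Finset.sum_range, Matrix.one_apply, Fin.ext_iff]
    rfl
  · refine forall_congr' fun k => forall_congr' fun hk => isZero_rel₂_iff I fun j => ?_
    simp [toRun, Finset.sum_range, Matrix.one_apply, Fin.ext_iff]
    rfl

theorem mem_mulSystem_iff_mulCert :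
    (∀ i j, (toRun I D).t i j ∈ I.mulSystem (toRun I D).d i j) ↔ MulCert I.code D := by
  have h0 : codeDim I.code 0 = I.n := rfl
  have h1 : codeDim I.code 1 = I.p := rfl
  simp only [MulCert, forall_lt_two, h0, h1]
  refine Fin.forall_iff.trans (forall_congr' fun i => forall_congr' fun hi => Fin.forall_iff.trans
    (forall_congr' fun j => forall_congr' fun hj => and_congr (Fin.forall_iff.trans ?_)
      (Fin.forall_iff.trans ?_)))
  · refine forall_congr' fun k => forall_congr' fun hk => isZero_rel₁_iff I fun j => ?_
    simp [toRun, Finset.sum_range]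
    rfl
  · refine forall_congr' fun k => forall_congr' fun hk => isZero_rel₂_iff I fun j => ?_
    simp [toRun, Finset.sum_range]
    rfl

/-- The condition on the tuples stored under the numbers `τ + 1` and `τ + 2`: they form a basis of
the solutions of the system with equations `eqs`. -/
def TupCert (c : InputCode) (D : List ℤ) (eqs : List EqLabel) (T τ : ℕ) : Prop :=
  BasisCert (c.1.1 * c.1.1 + c.1.2.1 * c.1.2.1) eqs (fun q => codeDim c q.1)
    (fun q => codeNum c q.1) (fun q j v => tupCoef c D q j (tupKey c.1.1 c.1.2.1 v))
    (fun q => codeRel c q.1) T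
    fun i v => rawEntry D (τ + 1 + (tupKey c.1.1 c.1.2.1 v).1) i (tupKey c.1.1 c.1.2.1 v).2.1
      (tupKey c.1.1 c.1.2.1 v).2.2

end Systems

/-! ### Certificates for runs -/

section RunCertificates

/-- The condition on the matrices `z`: they form a basis of the relations among the values. -/
def ValueCert (c : InputCode) (D : List ℤ) : Prop :=
  BasisCert (c.1.1 * c.1.2.1) [((2, 0, 0, 0) : EqLabel)] (fun q => codeDim c q.1)
    (fun q => codeNum c q.1) (fun _ j v => codeS c (v / c.1.2.1) (v % c.1.2.1) j)
    (fun q => codeRel c q.1) (rawSize D 1)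
    fun k v => rawEntry D 5 k (v / c.1.2.1) (v % c.1.2.1)

/-- The condition on the vectors `w`: they form a basis of the relations among the tuples `d`. -/
def RelationCert (c : InputCode) (D : List ℤ) : Prop :=
  BasisCert (rawSize D 2) (relationEqs c) (fun q => codeDim c q.1) (fun q => codeNum c q.1)
    (fun q j v => rawEntry D (3 + q.1) v q.2.1 j) (fun q => codeRel c q.1) (rawSize D 3)
    fun l k => rawEntry D 6 l k 0

/-- The condition on the polynomials `e`: they represent the primitive idempotents. -/
def RawIdemCert (D : List ℤ) : Prop :=
  IdemCert (rawSize D 2) (rawSize D 3) (fun l k => rawEntry D 6 l k 0)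
    (fun k => rawEntry D 7 k 0 0) (fun i j k => rawEntry D 8 i j k) (rawSize D 4)
    fun i k => rawEntry D 9 i k 0

/-- The list `D` holds the data of a valid run on the input with code `c`. -/
def RawCert (c : InputCode) (D : List ℤ) : Prop :=
  TupCert c D (tupEqs c) (rawSize D 0) 0 ∧ ValueCert c D ∧
    TupCert c D (scalarEqs c (rawSize D 0) (rawSize D 1)) (rawSize D 2) 2 ∧ RelationCert c D ∧
      OneCert c D ∧ MulCert c D ∧ RawIdemCert D

namespace Semi

variable {α : Type} [Primcodable α] {c : α → InputCode} {D : α → List ℤ}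

theorem codeZero {T : α → ℕ} {x : α → ℕ → ℤ} (hc : Primrec c) (hT : Primrec T)
    (hx : Primrec fun y : α × ℕ => x y.1 y.2) : Semi fun a => CodeZero (c a) (T a) (x a) := by
  unfold CodeZero
  exact isRel (by fun_prop) (by fun_prop) (by fun_prop) (by fun_prop)

theorem tupCert (hc : Primrec c) (hD : Primrec D) {eqs : α → List EqLabel} {T : α → ℕ} (τ : ℕ)
    (heqs : Primrec eqs) (hT : Primrec T) :
    Semi fun a => TupCert (c a) (D a) (eqs a) (T a) τ := by
  unfold TupCert
  exact basisCert (by fun_prop) (by fun_prop) (by fun_prop) (by fun_prop) (by fun_prop)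
    (by fun_prop) (by fun_prop) (by fun_prop)

theorem valueCert (hc : Primrec c) (hD : Primrec D) : Semi fun a => ValueCert (c a) (D a) := by
  unfold ValueCert
  exact basisCert (by fun_prop) (by fun_prop) (by fun_prop) (by fun_prop) (by fun_prop)
    (by fun_prop) (by fun_prop) (by fun_prop)

theorem relationCert (hc : Primrec c) (hD : Primrec D) :
    Semi fun a => RelationCert (c a) (D a) := by
  unfold RelationCert
  exact basisCert (by fun_prop) (by fun_prop) (by fun_prop) (by fun_prop) (by fun_prop)
    (by fun_prop) (by fun_prop) (by fun_prop)

theorem oneCert (hc : Primrec c) (hD : Primrec D) : Semi fun a => OneCert (c a) (D a) := by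
  unfold OneCert
  refine ball (by fun_prop) ?_
  refine ball (by fun_prop) ?_
  exact codeZero (by fun_prop) (by fun_prop) (by fun_prop)

theorem codeZero_mul {i j T k : α → ℕ} (hc : Primrec c) (hD : Primrec D) (hi : Primrec i)
    (hj : Primrec j) (hT : Primrec T) (hk : Primrec k) :
    Semi fun a => CodeZero (c a) (T a) fun h =>
      (∑ l ∈ Finset.range (codeDim (c a) (T a)),
        rawEntry (D a) (3 + T a) (j a) (k a) l * rawEntry (D a) (3 + T a) (i a) l h) -
      ∑ κ ∈ Finset.range (rawSize (D a) 2),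
        rawEntry (D a) 8 (i a) (j a) κ * rawEntry (D a) (3 + T a) κ (k a) h :=
  codeZero (by fun_prop) (by fun_prop) (by fun_prop)

theorem mulCert (hc : Primrec c) (hD : Primrec D) : Semi fun a => MulCert (c a) (D a) := by
  unfold MulCert
  refine ball (by fun_prop) ?_
  refine ball (by fun_prop) ?_
  refine ball (by fun_prop) ?_
  refine ball (by fun_prop) ?_
  exact codeZero_mul (by fun_prop) (by fun_prop) (by fun_prop) (by fun_prop) (by fun_prop)
    (by fun_prop)

theorem rawIdemCert (hD : Primrec D) : Semi fun a => RawIdemCert (D a) := by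
  unfold RawIdemCert
  exact idemCert (by fun_prop) (by fun_prop) (by fun_prop) (by fun_prop) (by fun_prop)
    (by fun_prop) (by fun_prop)

theorem rawCert (hc : Primrec c) (hD : Primrec D) : Semi fun a => RawCert (c a) (D a) := by
  unfold RawCert
  refine and (tupCert hc hD 0 (by fun_prop) (by fun_prop)) (and (valueCert hc hD)
    (and (tupCert hc hD 2 (by fun_prop) (by fun_prop)) (and (relationCert hc hD)
      (and (oneCert hc hD) (and (mulCert hc hD) (rawIdemCert hD))))))

end Semi

variable (I : Input) (D : List ℤ)

theorem isZBasis_δ_iff : IsZBasis (toRun I D).δ (I.endSystem ∩ I.symSystem) ↔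
    TupCert I.code D (tupEqs I.code) (rawSize D 0) 0 :=
  isZBasis_iff_basisCert (tupEquiv I) (mem_endSystem_inter_symSystem_iff I D) fun π =>
    tupEquiv_apply_of_key I ((toRun I D).δ π) (fun k => rawEntry D (0 + 1 + k.1) π k.2.1 k.2.2)
      (fun _ _ => rfl) fun _ _ => rfl

theorem isZBasis_z_iff : IsZBasis (toRun I D).z I.valueSystem ↔ ValueCert I.code D :=
  isZBasis_iff_basisCert (matEquiv I.n I.p) (mem_valueSystem_iff_codeZero I) fun _ _ => rfl

theorem isZBasis_d_iff : IsZBasis (toRun I D).d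
      (I.endSystem ∩ I.symSystem ∩ I.cenSystem (toRun I D).δ ∩ I.wellDefSystem (toRun I D).z) ↔
    TupCert I.code D (scalarEqs I.code (rawSize D 0) (rawSize D 1)) (rawSize D 2) 2 :=
  isZBasis_iff_basisCert (tupEquiv I) (mem_scalarSystem_iff_tupSolves I D) fun π =>
    tupEquiv_apply_of_key I ((toRun I D).d π) (fun k => rawEntry D (2 + 1 + k.1) π k.2.1 k.2.2)
      (fun _ _ => rfl) fun _ _ => rfl

theorem isZBasis_w_iff : IsZBasis (toRun I D).w (I.relationSystem (toRun I D).d) ↔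
    RelationCert I.code D :=
  isZBasis_iff_basisCert (LinearEquiv.refl ℤ _) (mem_relationSystem_iff_codeZero I D)
    fun _ _ => rfl

theorem rawCert_iff_isLinear : RawCert I.code D ↔ (toRun I D).IsLinear ∧ RawIdemCert D := by
  simp only [RawCert, Run.IsLinear, isZBasis_δ_iff, isZBasis_z_iff, isZBasis_d_iff,
    isZBasis_w_iff, mem_oneSystem_iff_oneCert, mem_mulSystem_iff_mulCert, and_assoc]

/-- Passage from finite index types to natural numbers; only the entries within range matter. -/
theorem IsRingPresentation.isPresented {S : Type*} [CommRing S] {r ρ : ℕ} {g : Fin r → S}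
    {w : Fin ρ → Fin r → ℤ} {v : Fin r → ℤ} {t : Fin r → Fin r → Fin r → ℤ}
    (h : IsRingPresentation g w v t) {y : ℕ → S} (hy : ∀ k : Fin r, y k = g k)
    {w' : ℕ → ℕ → ℤ} (hw : ∀ (l : Fin ρ) (k : Fin r), w' l k = w l k) {v' : ℕ → ℤ}
    (hv : ∀ k : Fin r, v' k = v k) {t' : ℕ → ℕ → ℕ → ℤ}
    (ht : ∀ i j k : Fin r, t' i j k = t i j k) : IsPresented y r ρ w' v' t' where
  gen s := by
    obtain ⟨x, rfl⟩ := h.gen s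
    refine ⟨extend x, ?_⟩
    simp only [Finset.sum_range, extend_coe, hy]
  rel x := by
    simp only [Finset.sum_range, hy, h.rel, Submodule.mem_span_range_iff_exists_fun]
    constructor
    · rintro ⟨z, hz⟩
      refine ⟨extend z, fun k hk => ?_⟩
      have := congrFun hz ⟨k, hk⟩
      simp only [Finset.sum_apply, Pi.smul_apply, smul_eq_mul, ← hw] at this
      simpa using this.symm
    · rintro ⟨z, hz⟩
      refine ⟨fun l => z l, funext fun k => ?_⟩
      simp only [Finset.sum_apply, Pi.smul_apply, smul_eq_mul, ← hw]
      exact (hz k k.2).symm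
  one := by simpa only [Finset.sum_range, hy, hv] using h.one
  mul i hi j hj := by
    simpa only [Finset.sum_range, hy, ht, ← hy ⟨i, hi⟩, ← hy ⟨j, hj⟩, ← ht ⟨i, hi⟩ ⟨j, hj⟩]
      using h.mul ⟨i, hi⟩ ⟨j, hj⟩

/-- A linear form as a list of terms. -/
def linearTerms {r : ℕ} (x : Fin r → ℤ) : PolyTerms r := List.ofFn fun k => (Pi.single k 1, x k)

theorem toPoly_linearTerms {r : ℕ} (x : Fin r → ℤ) :
    (linearTerms x).toPoly = ∑ k, MvPolynomial.C (x k) * MvPolynomial.X k := by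
  rw [PolyTerms.toPoly, linearTerms, List.map_ofFn, List.sum_ofFn]
  refine Finset.sum_congr rfl fun k _ => ?_
  simp only [Function.comp_apply]
  rw [Finset.prod_eq_single k (fun j _ hj => by rw [Pi.single_eq_of_ne hj, pow_zero]) (by simp),
    Pi.single_eq_same, pow_one]

variable {I D} {N₁ N₂ M : Type u} [AddCommGroup N₁] [AddCommGroup N₂] [AddCommGroup M]
  {a : Fin I.n → N₁} {a' : Fin I.p → N₂} {b : Fin I.m → M} {f : N₁ →+ N₂ →+ M}

/-- For an input that describes a full non-degenerate bilinear map the certificates characterize the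
valid runs. -/
theorem rawCert_iff_isValid (hI : I.Describes a a' b f) (hf : IsFull f) (hn : IsNondegenerate f) :
    RawCert I.code D ↔ (toRun I D).IsValid := by
  obtain ⟨S, _, _, _, _, hS⟩ := exists_isMaximalRingOfScalars hf hn
  have key : (toRun I D).IsLinear → (RawIdemCert D ↔
      IsIdempotentStep (toRun I D).ideal fun i => ((toRun I D).e i).toPoly) := by
    intro h
    obtain ⟨g, -, -, hg⟩ := h.exists_isRingPresentation hI hf hn hS
    rw [Run.ideal, hg.isIdempotentStep_iff]
    have hy := hg.isPresented
      (y := fun k => if h : k < (toRun I D).r then g ⟨k, h⟩ else 0) (fun k => by simp)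
      (w' := fun l k => rawEntry D 6 l k 0) (fun _ _ => rfl)
      (v' := fun k => rawEntry D 7 k 0 0) (fun _ => rfl)
      (t' := fun i j k => rawEntry D 8 i j k) (fun _ _ _ => rfl)
    have he : (fun i : Fin (rawSize D 4) => ∑ k ∈ Finset.range (rawSize D 2), rawEntry D 9 i k 0 •
          if h : k < (toRun I D).r then g ⟨k, h⟩ else 0) =
        fun i => MvPolynomial.aeval (R := ℤ) g ((toRun I D).e i).toPoly := by
      funext i
      change _ = MvPolynomial.aeval (R := ℤ) g (linearTerms fun k => rawEntry D 9 i k 0).toPoly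
      rw [toPoly_linearTerms, aeval_linear, Finset.sum_range]
      exact Finset.sum_congr rfl fun k _ => congrArg _ (dif_pos k.2)
    constructor
    · intro H
      exact he ▸ IdemCert.isCompletePrimitive hy H
    · intro H
      exact IdemCert.of_isCompletePrimitive hy (he ▸ H)
  rw [rawCert_iff_isLinear]
  constructor
  · rintro ⟨h, h'⟩
    obtain ⟨h1, h2, h3, h4, h5, h6⟩ := h
    exact ⟨h1, h2, h3, h4, h5, h6, (key ⟨h1, h2, h3, h4, h5, h6⟩).1 h'⟩
  · rintro ⟨h1, h2, h3, h4, h5, h6, h7⟩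
    exact ⟨⟨h1, h2, h3, h4, h5, h6⟩, (key ⟨h1, h2, h3, h4, h5, h6⟩).2 h7⟩

end RunCertificates

/-! ### The code of a run in terms of its data -/

section Output

/-- The code of the vector with entries `x 0, …, x (k - 1)`. -/
def vecOut (k : ℕ) (x : ℕ → ℤ) : VecCode := (List.range k).map x

/-- The code of the matrix of size `h × k` with entries `x i j`. -/
def matOut (h k : ℕ) (x : ℕ → ℕ → ℤ) : MatCode := (List.range h).map fun i => vecOut k (x i)

/-- The code of the array of size `g × h × k` with entries `x i j l`. -/
def tensorOut (g h k : ℕ) (x : ℕ → ℕ → ℕ → ℤ) : TensorCode :=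
  (List.range g).map fun i => matOut h k (x i)

theorem ofFn_eq_map_range {β : Type*} {n : ℕ} {F : Fin n → β} (G : ℕ → β) (h : ∀ i, F i = G i) :
    List.ofFn F = (List.range n).map G := by
  refine List.ext_getElem (by simp) fun i h1 h2 => ?_
  simp [h]

theorem vecCode_eq {k : ℕ} {F : Fin k → ℤ} (G : ℕ → ℤ) (h : ∀ i, F i = G i) :
    vecCode F = vecOut k G := ofFn_eq_map_range G h

theorem matCode_eq {h k : ℕ} {F : Fin h → Fin k → ℤ} (G : ℕ → ℕ → ℤ) (H : ∀ i j, F i j = G i j) :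
    matCode F = matOut h k G :=
  ofFn_eq_map_range (fun i => vecOut k (G i)) fun i => vecCode_eq (G i) (H i)

theorem tensorCode_eq {g h k : ℕ} {F : Fin g → Fin h → Fin k → ℤ} (G : ℕ → ℕ → ℕ → ℤ)
    (H : ∀ i j l, F i j l = G i j l) : tensorCode F = tensorOut g h k G :=
  ofFn_eq_map_range (fun i => matOut h k (G i)) fun i => matCode_eq (G i) (H i)

section

variable {α : Type} [Primcodable α]

@[fun_prop]
theorem primrec_vecOut {k : α → ℕ} {x : α → ℕ → ℤ} (hk : Primrec k)
    (hx : Primrec fun y : α × ℕ => x y.1 y.2) : Primrec fun a => vecOut (k a) (x a) := by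
  unfold vecOut
  fun_prop

@[fun_prop]
theorem primrec_matOut {h k : α → ℕ} {x : α → ℕ → ℕ → ℤ} (hh : Primrec h) (hk : Primrec k)
    (hx : Primrec fun y : α × ℕ × ℕ => x y.1 y.2.1 y.2.2) :
    Primrec fun a => matOut (h a) (k a) (x a) := by
  unfold matOut
  fun_prop

@[fun_prop]
theorem primrec_tensorOut {g h k : α → ℕ} {x : α → ℕ → ℕ → ℕ → ℤ} (hg : Primrec g)
    (hh : Primrec h) (hk : Primrec k)
    (hx : Primrec fun y : α × ℕ × ℕ × ℕ => x y.1 y.2.1 y.2.2.1 y.2.2.2) :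
    Primrec fun a => tensorOut (g a) (h a) (k a) (x a) := by
  unfold tensorOut
  fun_prop

end

/-- The `T`-th component of the value at the tuples `d` of the `i`-th linear form `e`. -/
def outE (D : List ℤ) (T i j k : ℕ) : ℤ :=
  ∑ κ ∈ Finset.range (rawSize D 2), rawEntry D 9 i κ 0 * rawEntry D (3 + T) κ j k

/-- The structure constants of the `i`-th factor. -/
def outConst (c : InputCode) (D : List ℤ) (i j k κ : ℕ) : ℤ :=
  ∑ x ∈ Finset.range (codeDim c 0), ∑ y ∈ Finset.range (codeDim c 1),
    outE D 0 i j x * outE D 1 i k y * codeS c x y κ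

@[fun_prop]
theorem primrec_outE {α : Type} [Primcodable α] {D : α → List ℤ} {T i j k : α → ℕ}
    (hD : Primrec D) (hT : Primrec T) (hi : Primrec i) (hj : Primrec j) (hk : Primrec k) :
    Primrec fun a => outE (D a) (T a) (i a) (j a) (k a) := by
  unfold outE
  fun_prop

@[fun_prop]
theorem primrec_outConst {α : Type} [Primcodable α] {c : α → InputCode} {D : α → List ℤ}
    {i j k κ : α → ℕ} (hc : Primrec c) (hD : Primrec D) (hi : Primrec i) (hj : Primrec j)
    (hk : Primrec k) (hκ : Primrec κ) :
    Primrec fun a => outConst (c a) (D a) (i a) (j a) (k a) (κ a) := by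
  unfold outConst
  fun_prop

/-- The code of a list of tuples. -/
def tupOut (c : InputCode) (k : ℕ) (x y : ℕ → ℕ → ℕ → ℤ) : List (MatCode × MatCode) :=
  (List.range k).map fun π =>
    (matOut (codeDim c 0) (codeDim c 0) (x π), matOut (codeDim c 1) (codeDim c 1) (y π))

/-- The code of the `i`-th linear form `e`. -/
def formOut (D : List ℤ) (i : ℕ) : List (List ℕ × ℤ) :=
  (List.range (rawSize D 2)).map fun k =>
    ((List.range (rawSize D 2)).map fun j => if j = k then 1 else 0, rawEntry D 9 i k 0)

/-- The code of the `i`-th factor. -/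
def factorOut (c : InputCode) (D : List ℤ) (i : ℕ) : MatCode × MatCode × TensorCode :=
  (matOut (codeDim c 0) (codeDim c 0) (outE D 0 i), matOut (codeDim c 1) (codeDim c 1) (outE D 1 i),
    tensorOut (codeDim c 0) (codeDim c 1) (codeDim c 2) (outConst c D i))

/-- The code of the run whose data are stored in the list `D`. -/
def runOut (c : InputCode) (D : List ℤ) : RunCode :=
  ((tupOut c (rawSize D 0) (rawEntry D 1) (rawEntry D 2),
      tensorOut (rawSize D 1) (codeDim c 0) (codeDim c 1) (rawEntry D 5),
      tupOut c (rawSize D 2) (rawEntry D 3) (rawEntry D 4)),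
    (matOut (rawSize D 3) (rawSize D 2) fun l k => rawEntry D 6 l k 0,
      vecOut (rawSize D 2) fun k => rawEntry D 7 k 0 0,
      tensorOut (rawSize D 2) (rawSize D 2) (rawSize D 2) (rawEntry D 8)),
    (List.range (rawSize D 4)).map (formOut D), (List.range (rawSize D 4)).map (factorOut c D))

section

variable {α : Type} [Primcodable α] {c : α → InputCode} {D : α → List ℤ}

@[fun_prop]
theorem primrec_tupOut {k : α → ℕ} {x y : α → ℕ → ℕ → ℕ → ℤ} (hc : Primrec c) (hk : Primrec k)
    (hx : Primrec fun z : α × ℕ × ℕ × ℕ => x z.1 z.2.1 z.2.2.1 z.2.2.2)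
    (hy : Primrec fun z : α × ℕ × ℕ × ℕ => y z.1 z.2.1 z.2.2.1 z.2.2.2) :
    Primrec fun a => tupOut (c a) (k a) (x a) (y a) := by
  unfold tupOut
  fun_prop

@[fun_prop]
theorem primrec_formOut {i : α → ℕ} (hD : Primrec D) (hi : Primrec i) :
    Primrec fun a => formOut (D a) (i a) := by
  unfold formOut
  fun_prop

@[fun_prop]
theorem primrec_factorOut {i : α → ℕ} (hc : Primrec c) (hD : Primrec D) (hi : Primrec i) :
    Primrec fun a => factorOut (c a) (D a) (i a) := by
  unfold factorOut
  fun_prop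

theorem primrec_runOut (hc : Primrec c) (hD : Primrec D) :
    Primrec fun a => runOut (c a) (D a) := by
  unfold runOut
  fun_prop

end

theorem prod_ofFn_pow_single {G : Type*} [Monoid G] {r : ℕ} (A : Fin r → G) (k : Fin r) :
    (List.ofFn fun j => A j ^ (Pi.single k 1 : Fin r → ℕ) j).prod = A k := by
  induction r with
  | zero => exact k.elim0
  | succ r ih =>
    rw [List.ofFn_succ, List.prod_cons]
    cases k using Fin.cases with
    | zero =>
      have : (fun i : Fin r => A i.succ ^ (Pi.single 0 1 : Fin (r + 1) → ℕ) i.succ) =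
          fun _ => 1 := by
        funext i
        rw [Pi.single_eq_of_ne (Fin.succ_ne_zero i), pow_zero]
      rw [this, Pi.single_eq_same]
      simp
    | succ k =>
      have : (fun i : Fin r => A i.succ ^ (Pi.single k.succ 1 : Fin (r + 1) → ℕ) i.succ) =
          fun i => A i.succ ^ (Pi.single k 1 : Fin r → ℕ) i := by
        funext i
        simp [Pi.single_apply]
      rw [this, ih fun i => A i.succ, Pi.single_eq_of_ne (Fin.succ_ne_zero k).symm, pow_zero,
        one_mul]

theorem evalMat_linearTerms {r h : ℕ} (x : Fin r → ℤ) (A : Fin r → Matrix (Fin h) (Fin h) ℤ) :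
    (linearTerms x).evalMat A = ∑ k, x k • A k := by
  rw [PolyTerms.evalMat, linearTerms, List.map_ofFn, List.sum_ofFn]
  exact Finset.sum_congr rfl fun k _ => congrArg _ (prod_ofFn_pow_single A k)

theorem polyCode_linearTerms {r : ℕ} (x : Fin r → ℤ) : polyCode (linearTerms x) =
    List.ofFn fun k => (List.ofFn (Pi.single k 1 : Fin r → ℕ), x k) := by
  rw [polyCode, linearTerms, List.map_ofFn]
  rfl

variable (I : Input) (D : List ℤ)

theorem toRun_E (i : Fin (toRun I D).ℓ) (j k : Fin I.n) :
    (toRun I D).E i j k = outE D 0 i j k := by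
  have : (toRun I D).E i = ∑ κ : Fin (rawSize D 2), rawEntry D 9 i κ 0 • ((toRun I D).d κ).1 :=
    evalMat_linearTerms (fun κ => rawEntry D 9 i κ 0) _
  rw [this, outE, Finset.sum_range]
  simp [Matrix.sum_apply, toRun]

theorem toRun_E' (i : Fin (toRun I D).ℓ) (j k : Fin I.p) :
    (toRun I D).E' i j k = outE D 1 i j k := by
  have : (toRun I D).E' i = ∑ κ : Fin (rawSize D 2), rawEntry D 9 i κ 0 • ((toRun I D).d κ).2 :=
    evalMat_linearTerms (fun κ => rawEntry D 9 i κ 0) _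
  rw [this, outE, Finset.sum_range]
  simp [Matrix.sum_apply, toRun]

theorem toRun_outS (i : Fin (toRun I D).ℓ) (j : Fin I.n) (k : Fin I.p) (κ : Fin I.m) :
    (toRun I D).outS i j k κ = outConst I.code D i j k κ := by
  have h0 : codeDim I.code 0 = I.n := rfl
  have h1 : codeDim I.code 1 = I.p := rfl
  simp only [Run.outS, outConst, toRun_E, toRun_E', h0, h1, Finset.sum_range, codeS_code]

/-- The code of a run, its decomposition included, is primitive recursive in the stored data. -/
theorem code_toRun : (toRun I D).code = runOut I.code D := by
  have hE : ∀ i, polyCode ((toRun I D).e i) = formOut D i := by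
    intro i
    refine (polyCode_linearTerms _).trans (ofFn_eq_map_range _ fun k => ?_)
    refine Prod.ext (ofFn_eq_map_range _ fun j => ?_) rfl
    simp [Pi.single_apply, Fin.ext_iff]
  have hF : ∀ i, (matCode ((toRun I D).E i), matCode ((toRun I D).E' i),
      tensorCode ((toRun I D).outS i)) = factorOut I.code D i := fun i =>
    Prod.ext (matCode_eq _ (toRun_E I D i)) <| Prod.ext (matCode_eq _ (toRun_E' I D i))
      (tensorCode_eq _ (toRun_outS I D i))
  refine Prod.ext (Prod.ext ?_ (Prod.ext ?_ ?_)) (Prod.ext (Prod.ext ?_ (Prod.ext ?_ ?_))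
    (Prod.ext ?_ ?_))
  · exact ofFn_eq_map_range _ fun i => Prod.ext (matCode_eq _ fun _ _ => rfl)
      (matCode_eq _ fun _ _ => rfl)
  · exact tensorCode_eq _ fun _ _ _ => rfl
  · exact ofFn_eq_map_range _ fun i => Prod.ext (matCode_eq _ fun _ _ => rfl)
      (matCode_eq _ fun _ _ => rfl)
  · exact matCode_eq _ fun _ _ => rfl
  · exact vecCode_eq _ fun _ => rfl
  · exact tensorCode_eq _ fun _ _ _ => rfl
  · exact ofFn_eq_map_range _ hE
  · exact ofFn_eq_map_range _ hF

end Output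

/-! ### Existence of a valid run, and the search for it -/

section Existence

/-- The entries of an array, extended by zero. -/
def extend₃ {g h k : ℕ} (F : Fin g → Fin h → Fin k → ℤ) (i j l : ℕ) : ℤ :=
  extend (fun i' => extend (fun j' => extend (F i' j') l) j) i

@[simp]
theorem extend₃_coe {g h k : ℕ} (F : Fin g → Fin h → Fin k → ℤ) (i : Fin g) (j : Fin h)
    (l : Fin k) : extend₃ F i j l = F i j l := by
  simp [extend₃]

variable {I : Input}

/-- Every run whose polynomials are linear forms is stored in some list. -/
theorem exists_toRun_eq (R : Run I) {ε : Fin R.ℓ → Fin R.r → ℤ}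
    (hε : R.e = fun i => linearTerms (ε i)) : ∃ D, toRun I D = R := by
  obtain ⟨numδ, δ, numz, z, r, d, ρ, w, v, t, ℓ, e⟩ := R
  -- `N` exceeds all indices that occur, and all arrays are extended by zero
  let N := I.n + I.p + numδ + numz + r + ρ + ℓ + 10
  let F : ℕ × ℕ × ℕ × ℕ → ℤ := fun q =>
    match q.1 with
    | 0 => match q.2.1 with
      | 0 => numδ
      | 1 => numz
      | 2 => r
      | 3 => ρ
      | _ => ℓ
    | 1 => extend₃ (fun π => (δ π).1) q.2.1 q.2.2.1 q.2.2.2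
    | 2 => extend₃ (fun π => (δ π).2) q.2.1 q.2.2.1 q.2.2.2
    | 3 => extend₃ (fun π => (d π).1) q.2.1 q.2.2.1 q.2.2.2
    | 4 => extend₃ (fun π => (d π).2) q.2.1 q.2.2.1 q.2.2.2
    | 5 => extend₃ z q.2.1 q.2.2.1 q.2.2.2
    | 6 => extend (fun l => extend (w l) q.2.2.1) q.2.1
    | 7 => extend v q.2.1
    | 8 => extend₃ t q.2.1 q.2.2.1 q.2.2.2
    | _ => extend (fun l => extend (ε l) q.2.2.1) q.2.1
  obtain ⟨D, hD⟩ := exists_look (Finset.range 10 ×ˢ Finset.range N ×ˢ Finset.range N ×ˢ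
    Finset.range N) F
  have hD' : ∀ T i j k, T < 10 → i < N → j < N → k < N → rawEntry D T i j k = F (T, i, j, k) := by
    intro T i j k hT hi hj hk
    exact hD _ (by simp [hT, hi, hj, hk])
  have hs : ∀ i < 10, rawSize D i = (F (0, i, 0, 0)).toNat := fun i hi => by
    rw [← hD' 0 i 0 0 (by simp) (by omega) (by omega) (by omega)]
    rfl
  obtain rfl : rawSize D 0 = numδ := hs 0 (by simp)
  obtain rfl : rawSize D 1 = numz := hs 1 (by simp)
  obtain rfl : rawSize D 2 = r := hs 2 (by simp)
  obtain rfl : rawSize D 3 = ρ := hs 3 (by simp)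
  obtain rfl : rawSize D 4 = ℓ := hs 4 (by simp)
  refine ⟨D, ?_⟩
  have hδ : (toRun I D).δ = δ := by
    refine funext fun π : Fin (rawSize D 0) => ?_
    refine Prod.ext (Matrix.ext fun i j => ?_) (Matrix.ext fun i j => ?_)
    · exact (hD' 1 π i j (by simp) (by omega) (by omega) (by omega)).trans (extend₃_coe _ π i j)
    · exact (hD' 2 π i j (by simp) (by omega) (by omega) (by omega)).trans (extend₃_coe _ π i j)
  have hd : (toRun I D).d = d := by
    refine funext fun π : Fin (rawSize D 2) => ?_
    refine Prod.ext (Matrix.ext fun i j => ?_) (Matrix.ext fun i j => ?_)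
    · exact (hD' 3 π i j (by simp) (by omega) (by omega) (by omega)).trans (extend₃_coe _ π i j)
    · exact (hD' 4 π i j (by simp) (by omega) (by omega) (by omega)).trans (extend₃_coe _ π i j)
  have hz : (toRun I D).z = z := by
    refine funext fun π : Fin (rawSize D 1) => ?_
    ext i j
    exact (hD' 5 π i j (by simp) (by omega) (by omega) (by omega)).trans (extend₃_coe z π i j)
  have hw : (toRun I D).w = w := by
    refine funext fun l : Fin (rawSize D 3) => funext fun k : Fin (rawSize D 2) => ?_
    refine (hD' 6 l k 0 (by simp) (by omega) (by omega) (by omega)).trans ?_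
    simp [F]
  have hv : (toRun I D).v = v := by
    refine funext fun k : Fin (rawSize D 2) => ?_
    refine (hD' 7 k 0 0 (by simp) (by omega) (by omega) (by omega)).trans ?_
    simp [F]
  have ht : (toRun I D).t = t := by
    refine funext fun i : Fin (rawSize D 2) => funext fun j : Fin (rawSize D 2) =>
      funext fun k : Fin (rawSize D 2) => ?_
    exact (hD' 8 i j k (by simp) (by omega) (by omega) (by omega)).trans (extend₃_coe t i j k)
  have he : (toRun I D).e = e := by
    refine Eq.trans (funext fun i : Fin (rawSize D 4) => ?_) hε.symm
    refine congrArg linearTerms (funext fun k : Fin (rawSize D 2) => ?_)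
    refine (hD' 9 i k 0 (by simp) (by omega) (by omega) (by omega)).trans ?_
    simp [F]
  rw [← hδ, ← hd, ← hz, ← hw, ← hv, ← ht]
  exact congrArg (Run.mk _ _ _ _ _ _ _ _ _ _ _) he

variable {N₁ N₂ M : Type u} [AddCommGroup N₁] [AddCommGroup N₂] [AddCommGroup M]
  {a : Fin I.n → N₁} {a' : Fin I.p → N₂} {b : Fin I.m → M} {f : N₁ →+ N₂ →+ M}

/-- Every input that describes a full non-degenerate bilinear map has a valid run, with polynomials
that are linear forms. -/
theorem exists_isValid (hI : I.Describes a a' b f) (hf : IsFull f) (hn : IsNondegenerate f) :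
    ∃ D, (toRun I D).IsValid := by
  obtain ⟨S, _, _, _, _, hS⟩ := exists_isMaximalRingOfScalars hf hn
  obtain ⟨numδ, δ, hδ⟩ := exists_isZBasis (dim := fun q => codeDim I.code q.1)
      (num := fun q => codeNum I.code q.1) (rel := fun q => codeRel I.code q.1)
      (A := fun q j v => tupCoef I.code [] q j (tupKey I.n I.p v))
      (tupEquiv I) (mem_endSystem_inter_symSystem_iff I [])
  obtain ⟨numz, z, hz⟩ := exists_isZBasis (dim := fun q => codeDim I.code q.1)
      (num := fun q => codeNum I.code q.1) (rel := fun q => codeRel I.code q.1)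
      (A := fun _ j v => codeS I.code (v / I.p) (v % I.p) j) (matEquiv I.n I.p)
      (mem_valueSystem_iff_codeZero I)
  obtain ⟨r, d, hd⟩ : ∃ (r : ℕ) (d : Fin r → I.Tup),
      IsZBasis d (I.endSystem ∩ I.symSystem ∩ I.cenSystem δ ∩ I.wellDefSystem z) := by
    -- the system depends on `δ` and `z`, which are stored in a list for this purpose
    obtain ⟨D, hD⟩ := exists_toRun_eq (I := I) ⟨numδ, δ, numz, z, 0, Fin.elim0, 0, Fin.elim0,
      Fin.elim0, Fin.elim0, 0, Fin.elim0⟩ (ε := Fin.elim0) (funext fun i => i.elim0)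
    have := exists_isZBasis (dim := fun q => codeDim I.code q.1)
      (num := fun q => codeNum I.code q.1) (rel := fun q => codeRel I.code q.1)
      (A := fun q j v => tupCoef I.code D q j (tupKey I.n I.p v))
      (tupEquiv I) (mem_scalarSystem_iff_tupSolves I D)
    rwa [hD] at this
  obtain ⟨g, h₁, h₂, hgen⟩ := exists_scalar_generators hI hf hn hS hδ hz hd
  obtain ⟨ρ, w, hw⟩ : ∃ (ρ : ℕ) (w : Fin ρ → Fin r → ℤ), IsZBasis w (I.relationSystem d) := by
    obtain ⟨D, hD⟩ := exists_toRun_eq (I := I) ⟨0, Fin.elim0, 0, Fin.elim0, r, d, 0, Fin.elim0,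
      0, 0, 0, Fin.elim0⟩ (ε := Fin.elim0) (funext fun i => i.elim0)
    have := exists_isZBasis (dim := fun q => codeDim I.code q.1)
      (num := fun q => codeNum I.code q.1) (rel := fun q => codeRel I.code q.1)
      (A := fun q j v => rawEntry D (3 + q.1) v q.2.1 j) (LinearEquiv.refl ℤ _)
      (mem_relationSystem_iff_codeZero I D)
    rwa [hD] at this
  obtain ⟨v, hv⟩ := hgen 1
  choose t ht using fun i j => hgen (g i * g j)
  have hv' := (mem_oneSystem_iff hI hS.1 h₁ h₂ v).2 hv.symm
  have ht' := fun i j => (mem_mulSystem_iff hI hS.1 h₁ h₂ i j (t i j)).2 (ht i j)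
  have hg : IsRingPresentation g w v t :=
    ⟨hgen, fun x => by rw [← mem_relationSystem_iff hI hS.1 h₁ h₂, ← hw.2, SetLike.mem_coe],
      hv.symm, ht⟩
  have hp := hg.isPresented (y := fun k => if h : k < r then g ⟨k, h⟩ else 0) (fun k => by simp)
      (w' := fun l k => extend (fun l => extend (w l) k) l) (fun _ _ => by simp)
      (v' := extend v) (fun _ => by simp) (t' := extend₃ t) (fun _ _ _ => by simp)
  have := hp.isNoetherianRing
  obtain ⟨ℓ, ε, hε⟩ := exists_isCompletePrimitive (S := S)
  choose x hx using fun i => hgen (ε i)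
  obtain ⟨D, hD⟩ := exists_toRun_eq (I := I) ⟨numδ, δ, numz, z, r, d, ρ, w, v, t, ℓ,
    fun i => linearTerms (x i)⟩ rfl
  refine ⟨D, hD ▸ ⟨hδ, hz, hd, hw, hv', ht', ?_⟩⟩
  refine hg.isIdempotentStep_iff.2 ?_
  simpa only [toPoly_linearTerms, aeval_linear, ← hx] using hε

/-- An unbounded search for the data of a run together with its certificates. -/
theorem exists_search_run : ∃ alg : InputCode →. RunCode, Partrec alg ∧
    ∀ c, (∃ D, RawCert c D) → ∃ D, RawCert c D ∧ alg c = Part.some (runOut c D) :=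
  Semi.exists_search (Semi.rawCert (by fun_prop) (by fun_prop))
    (primrec_runOut (by fun_prop) (by fun_prop))

end Existence

end BilinDecomp

theorem mainTheorem7 :
    ∃ alg : BilinDecomp.InputCode →. BilinDecomp.RunCode, Partrec alg ∧
      ∀ (I : BilinDecomp.Input) (N₁ N₂ M : Type u) [AddCommGroup N₁] [AddCommGroup N₂]
        [AddCommGroup M] (a : Fin I.n → N₁) (a' : Fin I.p → N₂) (b : Fin I.m → M)
        (f : N₁ →+ N₂ →+ M),
        I.Describes a a' b f → BilinDecomp.IsFull f → BilinDecomp.IsNondegenerate f →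
        -- on this input the algorithm stops, and it carries out the steps
        (∃ R : BilinDecomp.Run I, R.IsValid ∧ alg I.code = Part.some R.code) ∧
        -- the maximal ring of scalars exists
        (∃ (S : Type u) (_ : CommRing S) (_ : Module S N₁) (_ : Module S N₂) (_ : Module S M),
          BilinDecomp.IsMaximalRingOfScalars f S) ∧
        -- whatever choices are made in the steps, the results are correct
        ∀ R : BilinDecomp.Run I, R.IsValid →
          ∀ (S : Type u) [CommRing S] [Module S N₁] [Module S N₂] [Module S M],
            BilinDecomp.IsMaximalRingOfScalars f S →
            ∃ g : Fin R.r → S,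
              -- Step 1: the tuples give additive generators of the maximal ring of scalars
              (∀ k i, g k • a i = ∑ j, (R.d k).1 i j • a j) ∧
              (∀ k i, g k • a' i = ∑ j, (R.d k).2 i j • a' j) ∧
              AddSubgroup.closure (Set.range g) = ⊤ ∧
              -- Step 2: the ideal gives a presentation of it
              Function.Surjective (MvPolynomial.aeval (R := ℤ) g) ∧
              RingHom.ker (MvPolynomial.aeval (R := ℤ) g) = R.ideal ∧
              -- Steps 3 to 5: the returned maps are the canonical decomposition
              (∀ i j k, f (R.gen₁ a i j) (R.gen₂ a' i k) = ∑ κ, R.outS i j k κ • b κ) ∧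
              ∃ F : ∀ i, R.out₁ a i →+ R.out₂ a' i →+ R.outM a a' f i,
                (∀ i x y, (F i x y : M) = f x y) ∧
                BilinDecomp.IsCanonicalDecomposition f S
                  (fun i => MvPolynomial.aeval (R := ℤ) g (R.e i).toPoly)
                  (R.out₁ a) (R.out₂ a') (R.outM a a' f) F ∧
                ∀ i, BilinDecomp.IsFull (F i) ∧ BilinDecomp.IsNondegenerate (F i) ∧
                  ¬ BilinDecomp.IsTrivialMap (F i) ∧
                  BilinDecomp.IsDirectlyIndecomposable (F i) := by
  open BilinDecomp in
  obtain ⟨alg, halg, H⟩ := exists_search_run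
  refine ⟨alg, halg, fun I N₁ N₂ M _ _ _ a a' b f hI hf hn => ⟨?_, ?_, ?_⟩⟩
  · obtain ⟨D, hD⟩ := exists_isValid hI hf hn
    obtain ⟨D, hD, hrun⟩ := H I.code ⟨D, (rawCert_iff_isValid hI hf hn).2 hD⟩
    exact ⟨toRun I D, (rawCert_iff_isValid hI hf hn).1 hD, by rw [hrun, code_toRun]⟩
  · exact exists_isMaximalRingOfScalars hf hn
  · intro R hR S _ _ _ _ hS
    exact hR.correct hI hf hn hS
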